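/- Let $K$ be a field of characteristic $0$ (for instance $\mathbb C$), let $q\in K$ be nonzero and not a root of unity, and let $M,N\ge 0$. For $1\le i\le M+N$ put $\bar i=0$ if $i\le M$, $\bar i=1$ if $i>M$, and $q_i=q^{1-2\bar i}$. Put $$R(z,w)=\sum_i (zq_i-wq_i^{-1})E_{ii}\otimes E_{ii}+(z-w)\sum_{i\ne j}E_{ii}\otimes E_{jj}+z\sum_{i<j}(q_j-q_j^{-1})E_{ij}\otimes E_{ji}+w\sum_{i>j}(q_j-q_j^{-1})E_{ij}\otimes E_{ji}.$$ For $M\neq N$ let $R(x)=f(x)\,R(z,w)/(zq-wq^{-1})$ with $x=z/w$, expanded in powers of $x^{-1}=w/z$, where $f(x)=1+\sum_{k\ge1}f_kx^{-k}$ is the unique such series with $$f(xq^{2N-2M})=f(x)\,\frac{(1-xq^{-2})(1-xq^{2N-2M+2})}{(1-x)(1-xq^{2N-2M})}.$$ For $M\ne N$ the quantum affine superalgebra $\mathrm U_q(\widehat{\mathfrak{gl}}_{M|N})$ is the associative $K$-superalgebra generated by $l_{ij}^{\pm(r)}$ ($1\le i,j\le M+N$, $r\ge0$), of parity $\bar i+\bar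 j$, and an invertible even central element $q^c$. Put $l^\pm_{ij}(z)=\sum_{r\ge0}l_{ij}^{\pm(r)}z^{\mp r}$ and $L^\pm(z)=\sum_{i,j}l^\pm_{ij}(z)\otimes E_{ij}$. The defining relations, in graded tensor products with copies of $\mathrm{End}\,K^{M|N}$, are $$l^{+(0)}_{ji}=l^{-(0)}_{ij}=0\ (i<j),\qquad l^{+(0)}_{ii}l^{-(0)}_{ii}=l^{-(0)}_{ii}l^{+(0)}_{ii}=1,$$ $$R(z,w)L_1^\pm(z)L_2^\pm(w)=L_2^\pm(w)L_1^\pm(z)R(z,w),$$ $$R(zq^{c}/w)L_1^+(z)L_2^-(w)=L_2^-(w)L_1^+(z)R(zq^{-c}/w).$$ For arbitrary $M,N$ (including $M=N$), the quantum loop superalgebra is defined in the same way with trivial central charge: $q^c=1$, and the last relation is replaced by $R(z,w)L_1^+(z)L_2^-(w)=L_2^-(w)L_1^+(z)R(z,w)$. In either algebra $L^\pm(z)$ has an inverse $L^\pm(z)^{-1}$ in the graded tensor product with $\mathrm{End}\,K^{M|N}$. The quantum Berezinian is $$\begin{aligned}B_q(L^\pm(z))={}&\sum_{\sigma\in S_M}(-q)^{-l(\sigma)}L^\pm(z)_{\sigma(1),1}\cdots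 L^\pm(zq^{2M-2})_{\sigma(M),M}\\ &\times\sum_{\tau\in S_N}(-q)^{-l(\tau)}\big(L^\pm(zq^{2M-2})^{-1}\big)_{M+1,M+\tau(1)}\cdots\big(L^\pm(zq^{2M-2N})^{-1}\big)_{M+N,M+\tau(N)},\end{aligned}$$ where $l(\cdot)$ is the number of inversions. Write $B_q(L^\pm(z))=\sum_{i\ge0}b_i^\pm z^{\mp i}$. **Theorem.** If $M\ne N$, all coefficients $b_i^\pm$ ($i\ge0$) lie in the center of $\mathrm U_q(\widehat{\mathfrak{gl}}_{M|N})$. For all $M,N$, all coefficients $b_i^\pm$ lie in the center of the quantum loop superalgebra. -/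

import Mathlib

open scoped PowerSeries BigOperators

noncomputable section

namespace QBer

/-- The two signs distinguishing `L⁺(z)` and `L⁻(z)`. -/
inductive Sgn
  | plus
  | minus

section Basics

variable {K : Type*} [Field K] {M N : ℕ}

/-- The index set `{1, …, M+N}`, numbered from `0`. -/
abbrev Idx (M N : ℕ) : Type := Fin (M + N)

/-- The parity of an index: `0` for the first `M` indices and `1` for the last `N`. -/
def par (i : Idx M N) : ℕ := if (i : ℕ) < M then 0 else 1

/-- `q_i = q` for even `i` and `q_i = q⁻¹` for odd `i`. -/
def qIdx (q : K) (i : Idx M N) : K := if par i = 0 then q else q⁻¹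

/-- Entries of the `R`-matrix
`R(z,w) = ∑ᵢ (z qᵢ - w qᵢ⁻¹) Eᵢᵢ ⊗ Eᵢᵢ + (z - w) ∑_{i≠j} Eᵢᵢ ⊗ Eⱼⱼ
  + z ∑_{i<j} (qⱼ - qⱼ⁻¹) Eᵢⱼ ⊗ Eⱼᵢ + w ∑_{i>j} (qⱼ - qⱼ⁻¹) Eᵢⱼ ⊗ Eⱼᵢ`.
A pair `(α, β)` stands for the linear form `α z + β w`; this one is the coefficient of
`E_{aa} ⊗ E_{cc}`. -/
def rDiag (q : K) (a c : Idx M N) : K × K :=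
  if a = c then (qIdx q a, -(qIdx q a)⁻¹) else (1, -1)

/-- The coefficient of `E_{ac} ⊗ E_{ca}` (`a ≠ c`) in `R(z,w)`, up to the sign
`(-1)^{par c}` (note `q_c - q_c⁻¹ = (-1)^{par c} (q - q⁻¹)`), as a linear form in `z, w`. The sign is
merged with the signs of the graded tensor product in `rllLeft` and `rllRight`. -/
def rExch (q : K) (a c : Idx M N) : K × K :=
  if a < c then (q - q⁻¹, 0) else if c < a then (0, q - q⁻¹) else (0, 0)

end Basics

section Normalization

variable {K : Type*} [Field K]

/-- The rational function
`(1 - x q⁻²)(1 - x q^{2N-2M+2}) / ((1 - x)(1 - x q^{2N-2M}))`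
expanded in powers of `y = x⁻¹` (the variable `X` of the power series). -/
def normRatio (q : K) (M N : ℕ) : K⟦X⟧ :=
  (PowerSeries.X - PowerSeries.C (q ^ (-2 : ℤ))) *
    (PowerSeries.X - PowerSeries.C (q ^ (2 * (N : ℤ) - 2 * M + 2))) *
    ((PowerSeries.X - 1) * (PowerSeries.X - PowerSeries.C (q ^ (2 * (N : ℤ) - 2 * M))))⁻¹

/-- Coefficients of the normalizing series, by recursion. -/
def normCoeff (q : K) (M N : ℕ) : ℕ → K
  | 0 => 1
  | n + 1 => ((q ^ (2 * (M : ℤ) - 2 * N)) ^ (n + 1) - 1)⁻¹ *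
      ∑ i : Fin (n + 1), normCoeff q M N i * PowerSeries.coeff (n + 1 - i) (normRatio q M N)

/-- The normalizing series `f(x) = 1 + f₁ y + f₂ y² + ⋯`, `y = x⁻¹`, determined for `M ≠ N` by
`f(x q^{2N-2M}) = f(x) (1 - x q⁻²)(1 - x q^{2N-2M+2}) / ((1 - x)(1 - x q^{2N-2M}))`
(see `normSeries_spec` and `normSeries_unique`). -/
def normSeries (q : K) (M N : ℕ) : K⟦X⟧ := PowerSeries.mk (normCoeff q M N)

lemma constantCoeff_normRatio (q : K) (hq : q ≠ 0) (M N : ℕ) :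
    PowerSeries.constantCoeff (normRatio q M N) = 1 := by
  have h : q ^ (2 * (N : ℤ) - 2 * M) ≠ 0 := zpow_ne_zero _ hq
  simp only [normRatio, map_mul, map_sub, PowerSeries.constantCoeff_X, PowerSeries.constantCoeff_C,
    PowerSeries.constantCoeff_inv, map_one, zpow_add₀ hq, zero_sub]
  rw [zpow_neg]
  have h2 : q ^ (2 : ℤ) ≠ 0 := zpow_ne_zero _ hq
  field_simp

lemma shift_ne_one (q : K) (hroot : ∀ n : ℕ, 0 < n → q ^ n ≠ 1) {M N : ℕ}
    (hMN : M ≠ N) (n : ℕ) : (q ^ (2 * (M : ℤ) - 2 * N)) ^ (n + 1) - 1 ≠ 0 := by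
  intro h
  rw [sub_eq_zero, ← zpow_natCast, ← zpow_mul] at h
  rcases lt_or_gt_of_ne hMN with hlt | hlt
  · apply hroot (2 * (N - M) * (n + 1)) (by have := Nat.sub_pos_of_lt hlt; positivity)
    have h' := congrArg (·⁻¹) h
    simp only [inv_one, ← zpow_neg] at h'
    rw [← h', ← zpow_natCast]
    congr 1
    push_cast [Nat.cast_sub hlt.le]
    ring
  · apply hroot (2 * (M - N) * (n + 1)) (by have := Nat.sub_pos_of_lt hlt; positivity)
    rw [← h, ← zpow_natCast]
    congr 1
    push_cast [Nat.cast_sub hlt.le]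
    ring

private lemma funcEq_iff (q : K) (hq : q ≠ 0) (M N : ℕ) (φ : K⟦X⟧) :
    PowerSeries.rescale (q ^ (2 * (M : ℤ) - 2 * N)) φ = φ * normRatio q M N ↔
      ∀ n : ℕ, ((q ^ (2 * (M : ℤ) - 2 * N)) ^ (n + 1) - 1) * PowerSeries.coeff (n + 1) φ =
        ∑ i : Fin (n + 1), PowerSeries.coeff i φ *
          PowerSeries.coeff (n + 1 - i) (normRatio q M N) := by
  have key : ∀ n : ℕ, PowerSeries.coeff (n + 1) (φ * normRatio q M N) =
      (∑ i : Fin (n + 1), PowerSeries.coeff i φ *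
          PowerSeries.coeff (n + 1 - i) (normRatio q M N)) + PowerSeries.coeff (n + 1) φ := by
    intro n
    rw [PowerSeries.coeff_mul, Finset.Nat.sum_antidiagonal_eq_sum_range_succ
      (fun i j => PowerSeries.coeff i φ * PowerSeries.coeff j (normRatio q M N)),
      Finset.sum_range_succ, ← Fin.sum_univ_eq_sum_range
      (fun i => PowerSeries.coeff i φ * PowerSeries.coeff (n + 1 - i) (normRatio q M N))]
    simp [constantCoeff_normRatio q hq]
  constructor
  · intro h n
    have := congrArg (PowerSeries.coeff (n + 1)) h
    rw [key, PowerSeries.coeff_rescale] at this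
    linear_combination this
  · intro h
    ext n
    cases n with
    | zero =>
      simp [constantCoeff_normRatio q hq]
    | succ n =>
      rw [key, PowerSeries.coeff_rescale]
      linear_combination h n

/-- The defining functional equation: replacing `x` by `x q^{2N-2M}` replaces `y` by
`y q^{2M-2N}`. -/
theorem normSeries_spec (q : K) (hq : q ≠ 0) (hroot : ∀ n : ℕ, 0 < n → q ^ n ≠ 1) {M N : ℕ}
    (hMN : M ≠ N) :
    PowerSeries.constantCoeff (normSeries q M N) = 1 ∧
    PowerSeries.rescale (q ^ (2 * (M : ℤ) - 2 * N)) (normSeries q M N) =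
      normSeries q M N * normRatio q M N := by
  refine ⟨by rw [← PowerSeries.coeff_zero_eq_constantCoeff_apply]; simp [normSeries, normCoeff], ?_⟩
  rw [funcEq_iff q hq]
  intro n
  simp only [normSeries, PowerSeries.coeff_mk]
  rw [normCoeff, mul_inv_cancel_left₀ (shift_ne_one q hroot hMN n)]

theorem normSeries_unique (q : K) (hq : q ≠ 0) (hroot : ∀ n : ℕ, 0 < n → q ^ n ≠ 1) {M N : ℕ}
    (hMN : M ≠ N) (φ : K⟦X⟧) (h1 : PowerSeries.constantCoeff φ = 1)
    (hφ : PowerSeries.rescale (q ^ (2 * (M : ℤ) - 2 * N)) φ = φ * normRatio q M N) :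
    φ = normSeries q M N := by
  have h2 := (normSeries_spec q hq hroot hMN).2
  rw [funcEq_iff q hq] at hφ h2
  ext n
  induction n using Nat.strong_induction_on with
  | _ n ih =>
    cases n with
    | zero => simp [h1, (normSeries_spec q hq hroot hMN).1]
    | succ n =>
      apply mul_left_cancel₀ (shift_ne_one q hroot hMN n)
      rw [hφ, h2]
      exact Finset.sum_congr rfl fun i _ => by rw [ih i i.isLt]

/-- For a linear form `α z + β w`, the series
`f(x) (α z + β w) / (z q - w q⁻¹)`, `x = z / w`, in powers of `x⁻¹ = w / z`. -/
def normalized (q : K) (M N : ℕ) (p : K × K) : K⟦X⟧ :=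
  normSeries q M N * (PowerSeries.C p.1 + PowerSeries.C p.2 * PowerSeries.X) *
    (PowerSeries.C q - PowerSeries.C q⁻¹ * PowerSeries.X)⁻¹

end Normalization

section Relations

variable {K : Type*} [Field K] {M N : ℕ} {A : Type*} [Ring A] [Algebra K A]

/-- The coefficient of `z^m` in `∑_{r ≥ 0} x_r z^{∓ r}`. -/
def zCoeff (ε : Sgn) (x : ℕ → A) (m : ℤ) : A :=
  match ε with
  | .plus => if m ≤ 0 then x (-m).toNat else 0
  | .minus => if 0 ≤ m then x m.toNat else 0

/-- The product of `α z + β w` with `∑ F m n z^m w^n`. -/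
def actPoly (p : K × K) (F : ℤ → ℤ → A) (m n : ℤ) : A :=
  p.1 • F (m - 1) n + p.2 • F m (n - 1)

/-- The product of the series `∑ₖ ρₖ tᵏ (w/z)ᵏ` (`t` an element of the algebra) with
`∑ F m n z^m w^n`. Here `F` contains only nonnegative powers of `w`, so the sum is finite. -/
def actSeries (ρ : K⟦X⟧) (t : A) (F : ℤ → ℤ → A) (m n : ℤ) : A :=
  ∑ k ∈ Finset.range (n.toNat + 1), PowerSeries.coeff k ρ • (t ^ k * F (m + k) (n - k))

/-- The coefficient of `E_{ab} ⊗ E_{cd}` in `R L₁(z) L₂(w)`, computed in the graded tensor product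
(with `l_{ij}` of parity `par i + par j`) and multiplied by the sign
`(-1)^{par b (par c + par d)}`. Here `L₁(z) = ∑ l_{ij}(z) ⊗ E_{ij} ⊗ 1` has entries `∑ₘ X i j m z^m`,
`L₂(w) = ∑ l_{ij}(w) ⊗ 1 ⊗ E_{ij}` has entries `∑ₙ Y i j n w^n`, and `act` multiplies by an entry
of the `R`-matrix. -/
def rllLeft (q : K) (act : K × K → (ℤ → ℤ → A) → ℤ → ℤ → A) (X Y : Idx M N → Idx M N → ℤ → A)
    (a b c d : Idx M N) (m n : ℤ) : A :=
  (-1 : K) ^ (par a * (par c + par d)) •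
      act (rDiag q a c) (fun m n => X a b m * Y c d n) m n +
    (-1 : K) ^ (par c * par d) • act (rExch q a c) (fun m n => X c b m * Y a d n) m n

/-- The coefficient of `E_{ab} ⊗ E_{cd}` in `L₂(w) L₁(z) R`, multiplied by the same sign
`(-1)^{par b (par c + par d)}` as in `rllLeft`. -/
def rllRight (q : K) (act : K × K → (ℤ → ℤ → A) → ℤ → ℤ → A) (X Y : Idx M N → Idx M N → ℤ → A)
    (a b c d : Idx M N) (m n : ℤ) : A :=
  (-1 : K) ^ (par b * (par c + par d)) •
      act (rDiag q b d) (fun m n => Y c d n * X a b m) m n +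
    (-1 : K) ^ (par c * par d) • act (rExch q d b) (fun m n => Y c b n * X a d m) m n

end Relations

section Algebras

variable (K : Type*) [Field K] (q : K) (M N : ℕ)

/-- Generators: `l ε r i j` is `l^{ε (r)}_{ij}`; `qc` and `qcInv` are `q^c` and `q^{-c}`. -/
inductive Gen (M N : ℕ)
  | l (ε : Sgn) (r : ℕ) (i j : Idx M N)
  | qc
  | qcInv

/-- The generators in the free algebra. -/
abbrev fl (ε : Sgn) (r : ℕ) (i j : Idx M N) : FreeAlgebra K (Gen M N) :=
  FreeAlgebra.ι K (Gen.l ε r i j)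

/-- `q^c` in the free algebra. -/
abbrev fqc : FreeAlgebra K (Gen M N) := FreeAlgebra.ι K Gen.qc

/-- `q^{-c}` in the free algebra. -/
abbrev fqcInv : FreeAlgebra K (Gen M N) := FreeAlgebra.ι K Gen.qcInv

/-- The entries of `L^ε(z)` in the free algebra, as formal series. -/
def fL (ε : Sgn) (i j : Idx M N) (m : ℤ) : FreeAlgebra K (Gen M N) :=
  zCoeff ε (fun r => fl K M N ε r i j) m

/-- The relations common to the affine and the loop superalgebra: triangularity and invertibility of
the zero modes, centrality and invertibility of `q^c`, and
`R(z,w) L^ε₁(z) L^ε₂(w) = L^ε₂(w) L^ε₁(z) R(z,w)` for `ε = ±`. -/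
inductive BaseRel : FreeAlgebra K (Gen M N) → FreeAlgebra K (Gen M N) → Prop
  | upper (i j : Idx M N) (h : i < j) : BaseRel (fl K M N .plus 0 j i) 0
  | lower (i j : Idx M N) (h : i < j) : BaseRel (fl K M N .minus 0 i j) 0
  | diag_left (i : Idx M N) : BaseRel (fl K M N .minus 0 i i * fl K M N .plus 0 i i) 1
  | diag_right (i : Idx M N) : BaseRel (fl K M N .plus 0 i i * fl K M N .minus 0 i i) 1
  | qc_left : BaseRel (fqc K M N * fqcInv K M N) 1
  | qc_right : BaseRel (fqcInv K M N * fqc K M N) 1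
  | qc_central (ε : Sgn) (r : ℕ) (i j : Idx M N) :
      BaseRel (fqc K M N * fl K M N ε r i j) (fl K M N ε r i j * fqc K M N)
  | rll (ε : Sgn) (a b c d : Idx M N) (m n : ℤ) :
      BaseRel (rllLeft q actPoly (fL K M N ε) (fL K M N ε) a b c d m n)
        (rllRight q actPoly (fL K M N ε) (fL K M N ε) a b c d m n)

/-- The relations of the quantum affine superalgebra: the common ones and
`R(z q^c / w) L⁺₁(z) L⁻₂(w) = L⁻₂(w) L⁺₁(z) R(z q^{-c} / w)` for the normalized `R`-matrix
`R(x) = f(x) R(z,w) / (z q - w q⁻¹)`, `x = z / w`, expanded in powers of `w / z`. -/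
inductive AffineRel : FreeAlgebra K (Gen M N) → FreeAlgebra K (Gen M N) → Prop
  | base {x y : FreeAlgebra K (Gen M N)} (h : BaseRel K q M N x y) : AffineRel x y
  | cross (a b c d : Idx M N) (m n : ℤ) :
      AffineRel
        (rllLeft q (fun p => actSeries (normalized q M N p) (fqcInv K M N))
          (fL K M N .plus) (fL K M N .minus) a b c d m n)
        (rllRight q (fun p => actSeries (normalized q M N p) (fqc K M N))
          (fL K M N .plus) (fL K M N .minus) a b c d m n)

/-- The relations of the quantum loop superalgebra (trivial central charge, where the normalization
of the `R`-matrix cancels): the common ones, `q^c = 1`, and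
`R(z,w) L⁺₁(z) L⁻₂(w) = L⁻₂(w) L⁺₁(z) R(z,w)`. -/
inductive LoopRel : FreeAlgebra K (Gen M N) → FreeAlgebra K (Gen M N) → Prop
  | base {x y : FreeAlgebra K (Gen M N)} (h : BaseRel K q M N x y) : LoopRel x y
  | qc_one : LoopRel (fqc K M N) 1
  | cross (a b c d : Idx M N) (m n : ℤ) :
      LoopRel (rllLeft q actPoly (fL K M N .plus) (fL K M N .minus) a b c d m n)
        (rllRight q actPoly (fL K M N .plus) (fL K M N .minus) a b c d m n)

/-- The quantum affine superalgebra `U_q(ĝl_{M|N})` (for `M ≠ N`). -/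
abbrev QuantumAffine : Type _ := RingQuot (AffineRel K q M N)

/-- The quantum loop superalgebra: `U_q(ĝl_{M|N})` at trivial central charge. -/
abbrev QuantumLoop : Type _ := RingQuot (LoopRel K q M N)

/-- The element `l^{ε (r)}_{ij}` of the quantum affine superalgebra. -/
def affineGen (ε : Sgn) (r : ℕ) (i j : Idx M N) : QuantumAffine K q M N :=
  RingQuot.mkAlgHom K (AffineRel K q M N) (fl K M N ε r i j)

/-- The element `l^{ε (r)}_{ij}` of the quantum loop superalgebra. -/
def loopGen (ε : Sgn) (r : ℕ) (i j : Idx M N) : QuantumLoop K q M N :=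
  RingQuot.mkAlgHom K (LoopRel K q M N) (fl K M N ε r i j)

end Algebras

section Berezinian

variable {K : Type*} [Field K] {M N : ℕ} {A : Type*} [Ring A] [Algebra K A]

/-- `L(z) = ∑ᵣ L^{(r)} z^{∓ r}` as a power series in `z^{∓1}` with matrix coefficients. -/
def lSeries (x : ℕ → Idx M N → Idx M N → A) : PowerSeries (Matrix (Idx M N) (Idx M N) A) :=
  PowerSeries.mk fun r => Matrix.of (x r)

/-- The `(i,j)` entry of a series of matrices. -/
def entry (F : PowerSeries (Matrix (Idx M N) (Idx M N) A)) (i j : Idx M N) : A⟦X⟧ :=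
  PowerSeries.mk fun r => PowerSeries.coeff r F i j

/-- Multiplication of the `(i,j)` entry by `(-1)^{par i (par i + par j)}`. In the graded tensor
product with `End ℂ^{M|N}`, the product of the even elements `∑ a_{ij} ⊗ E_{ij}` and
`∑ b_{ij} ⊗ E_{ij}` has the entries `∑ⱼ (-1)^{(par i + par j)(par j + par k)} a_{ij} b_{jk}`; this
twist, an involution, turns it into the ordinary matrix product. -/
def twist (F : PowerSeries (Matrix (Idx M N) (Idx M N) A)) :
    PowerSeries (Matrix (Idx M N) (Idx M N) A) :=
  PowerSeries.mk fun r => Matrix.of fun i j =>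
    (-1 : A) ^ (par i * (par i + par j)) * PowerSeries.coeff r F i j

/-- The inverse `L(z)⁻¹` of `L(z) = ∑ l_{ij}(z) ⊗ E_{ij}` in the graded tensor product
(see `superInv_spec`). -/
def superInv (F : PowerSeries (Matrix (Idx M N) (Idx M N) A)) :
    PowerSeries (Matrix (Idx M N) (Idx M N) A) :=
  twist (Ring.inverse (twist F))

/-- The substitution `z ↦ z t` in a series in `z^{∓1}`. -/
def shift (ε : Sgn) (t : K) (F : A⟦X⟧) : A⟦X⟧ :=
  PowerSeries.mk fun r =>
    (match ε with
      | .plus => (t⁻¹) ^ r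
      | .minus => t ^ r) • PowerSeries.coeff r F

/-- The length of a permutation, i.e. its number of inversions. -/
def permLength {n : ℕ} (σ : Equiv.Perm (Fin n)) : ℕ :=
  (Finset.univ.filter fun p : Fin n × Fin n => p.1 < p.2 ∧ σ p.2 < σ p.1).card

/-- The quantum Berezinian
`B_q(L(z)) = ∑_{σ ∈ S_M} (-q)^{-l(σ)} L(z)_{σ(1),1} ⋯ L(z q^{2M-2})_{σ(M),M}
  × ∑_{τ ∈ S_N} (-q)^{-l(τ)} (L(z q^{2M-2})⁻¹)_{M+1,M+τ(1)} ⋯ (L(z q^{2M-2N})⁻¹)_{M+N,M+τ(N)}`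
as a power series in `z^{∓1}`, for `L(z) = ∑ᵣ x_r z^{∓ r}`. -/
def berezinian (q : K) (ε : Sgn) (x : ℕ → Idx M N → Idx M N → A) : A⟦X⟧ :=
  (∑ σ : Equiv.Perm (Fin M), (((-q)⁻¹) ^ permLength σ) •
      (List.ofFn fun i : Fin M =>
        shift ε (q ^ (2 * (i : ℕ)))
          (entry (lSeries x) (Fin.castAdd N (σ i)) (Fin.castAdd N i))).prod) *
  (∑ τ : Equiv.Perm (Fin N), (((-q)⁻¹) ^ permLength τ) •
      (List.ofFn fun j : Fin N =>
        shift ε (q ^ (2 * (M : ℤ) - 2 * ((j : ℕ) + 1)))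
          (entry (superInv (lSeries x)) (Fin.natAdd M j) (Fin.natAdd M (τ j)))).prod)

end Berezinian

section Inverse

variable {M N : ℕ} {A : Type*} [Ring A]

private lemma par_le (i : Idx M N) : par i = 0 ∨ par i = 1 := by
  unfold par; split_ifs <;> simp

private lemma sign_mul (i j k : Idx M N) :
    ((-1 : ℤ) ^ (par i * (par i + par j))) * (-1) ^ (par j * (par j + par k)) =
      (-1) ^ (par i * (par i + par k)) * (-1) ^ ((par i + par j) * (par j + par k)) := by
  rcases par_le i with hi | hi <;> rcases par_le j with hj | hj <;>
    rcases par_le k with hk | hk <;> simp [hi, hj, hk]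

private lemma sign_sq (i j : Idx M N) :
    ((-1 : ℤ) ^ (par i * (par i + par j))) * (-1) ^ (par i * (par i + par j)) = 1 := by
  rw [← mul_pow]; simp

private lemma entry_twist (F : PowerSeries (Matrix (Idx M N) (Idx M N) A)) (i j : Idx M N) :
    entry (twist F) i j = ((-1 : ℤ) ^ (par i * (par i + par j))) • entry F i j := by
  ext r
  rw [map_zsmul]
  simp only [entry, twist, PowerSeries.coeff_mk, Matrix.of_apply, zsmul_eq_mul]
  push_cast
  rfl

private lemma entry_mul (F G : PowerSeries (Matrix (Idx M N) (Idx M N) A)) (i k : Idx M N) :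
    entry (F * G) i k = ∑ j, entry F i j * entry G j k := by
  ext r
  simp only [entry, PowerSeries.coeff_mk, PowerSeries.coeff_mul, map_sum, Matrix.sum_apply,
    Matrix.mul_apply]
  exact Finset.sum_comm

private lemma entry_one (i k : Idx M N) :
    entry (1 : PowerSeries (Matrix (Idx M N) (Idx M N) A)) i k = if i = k then 1 else 0 := by
  ext r
  simp only [entry, PowerSeries.coeff_mk, PowerSeries.coeff_one]
  by_cases hr : r = 0
  · by_cases hik : i = k
    · subst hik
      simp [hr, PowerSeries.coeff_one]
    · simp [hr, hik]
  · by_cases hik : i = k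
    · simp [hr, hik, PowerSeries.coeff_one]
    · simp [hr, hik]

private lemma super_of_twist (F G : PowerSeries (Matrix (Idx M N) (Idx M N) A))
    (h : twist F * twist G = 1) (i k : Idx M N) :
    ∑ j, ((-1 : ℤ) ^ ((par i + par j) * (par j + par k))) • (entry F i j * entry G j k) =
      if i = k then 1 else 0 := by
  have h1 := congrArg (fun H => ((-1 : ℤ) ^ (par i * (par i + par k))) • entry H i k) h
  simp only [entry_mul, entry_twist, entry_one, Finset.smul_sum, smul_mul_smul_comm, sign_mul,
    smul_smul, ← mul_assoc, sign_sq, one_mul] at h1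
  rw [h1]
  by_cases hik : i = k
  · subst hik
    rcases par_le i with hi | hi <;> simp [hi]
  · simp [hik]

private lemma twist_twist (F : PowerSeries (Matrix (Idx M N) (Idx M N) A)) :
    twist (twist F) = F := by
  ext r i j
  simp only [twist, PowerSeries.coeff_mk, Matrix.of_apply, ← mul_assoc]
  rw [← pow_add, ← two_mul, pow_mul]
  simp

/-- If `twist F` is invertible, `superInv F` is the two-sided inverse of `F` for the product of the
graded tensor product. -/
theorem superInv_spec (F : PowerSeries (Matrix (Idx M N) (Idx M N) A)) (h : IsUnit (twist F))
    (i k : Idx M N) :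
    (∑ j, ((-1 : ℤ) ^ ((par i + par j) * (par j + par k))) •
        (entry F i j * entry (superInv F) j k) = if i = k then 1 else 0) ∧
    (∑ j, ((-1 : ℤ) ^ ((par i + par j) * (par j + par k))) •
        (entry (superInv F) i j * entry F j k) = if i = k then 1 else 0) := by
  constructor
  · apply super_of_twist
    rw [superInv, twist_twist, Ring.mul_inverse_cancel _ h]
  · apply super_of_twist
    rw [superInv, twist_twist, Ring.inverse_mul_cancel _ h]

private lemma isUnit_of_triangular (Z : Matrix (Idx M N) (Idx M N) A) (ρ : Idx M N → ℕ)
    (hρ : Function.Injective ρ) (hb : ∀ i, ρ i < M + N)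
    (h0 : ∀ i j, ρ j < ρ i → Z i j = 0) (hd : ∀ i, IsUnit (Z i i)) : IsUnit Z := by
  classical
  choose u hu using hd
  set D : Matrix (Idx M N) (Idx M N) A := Matrix.diagonal fun i => ((u i : Aˣ) : A) with hD
  set E : Matrix (Idx M N) (Idx M N) A := Matrix.diagonal fun i => (((u i)⁻¹ : Aˣ) : A) with hE
  have hDE : D * E = 1 := by simp [hD, hE, Matrix.diagonal_mul_diagonal]
  have hED : E * D = 1 := by simp [hD, hE, Matrix.diagonal_mul_diagonal]
  set T := E * Z - 1 with hT
  have hTz : ∀ i j, ¬ ρ i < ρ j → T i j = 0 := by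
    intro i j hij
    by_cases e : i = j
    · subst e
      simp [hT, hE, Matrix.diagonal_mul, ← hu]
    · have : ρ j < ρ i := lt_of_le_of_ne (not_lt.mp hij) fun h => e (hρ h).symm
      simp [hT, hE, Matrix.diagonal_mul, h0 i j this, e]
  have hpow : ∀ (k : ℕ) (i j : Idx M N), ¬ ρ i + k ≤ ρ j → (T ^ k) i j = 0 := by
    intro k
    induction k with
    | zero =>
      intro i j hij
      have : i ≠ j := by rintro rfl; exact hij (by simp)
      simp [this]
    | succ k ih =>
      intro i j hij
      rw [pow_succ, Matrix.mul_apply]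
      refine Finset.sum_eq_zero fun l _ => ?_
      by_cases h1 : ρ i + k ≤ ρ l
      · rw [hTz l j (by omega), mul_zero]
      · rw [ih i l h1, zero_mul]
  have hnil : IsNilpotent T := by
    refine ⟨M + N, ?_⟩
    ext i j
    rw [hpow (M + N) i j (by have := hb j; omega)]
    rfl
  have hZ : Z = D * (1 + T) := by
    rw [hT, add_sub_cancel, ← mul_assoc, hDE, one_mul]
  rw [hZ]
  exact IsUnit.mul ⟨⟨D, E, hDE, hED⟩, rfl⟩ hnil.isUnit_one_add

private lemma isUnit_sign_mul (n : ℕ) {y : A} (hy : IsUnit y) : IsUnit ((-1 : A) ^ n * y) :=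
  ((isUnit_one.neg).pow n).mul hy

/-- Triangular zero modes with invertible diagonal make the series invertible. -/
theorem isUnit_twist_lSeries (x : Sgn → ℕ → Idx M N → Idx M N → A)
    (hp : ∀ i j, i < j → x .plus 0 j i = 0) (hm : ∀ i j, i < j → x .minus 0 i j = 0)
    (hl : ∀ i, x .minus 0 i i * x .plus 0 i i = 1) (hr : ∀ i, x .plus 0 i i * x .minus 0 i i = 1)
    (ε : Sgn) : IsUnit (twist (lSeries (x ε))) := by
  rw [PowerSeries.isUnit_iff_constantCoeff, ← PowerSeries.coeff_zero_eq_constantCoeff_apply]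
  simp only [twist, lSeries, PowerSeries.coeff_mk]
  cases ε with
  | plus =>
    refine isUnit_of_triangular _ (fun i => (i : ℕ)) Fin.val_injective (fun i => i.isLt) ?_ ?_
    · intro i j hij
      simp [hp j i hij]
    · intro i
      exact isUnit_sign_mul _ ⟨⟨_, _, hr i, hl i⟩, rfl⟩
  | minus =>
    refine isUnit_of_triangular _ (fun i => M + N - 1 - (i : ℕ)) ?_ ?_ ?_ ?_
    · intro i j hij
      have := i.isLt
      have := j.isLt
      dsimp at hij
      exact Fin.ext (by omega)
    · intro i
      have := i.isLt
      omega
    · intro i j hij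
      have h1 := i.isLt
      have h2 := j.isLt
      have : i < j := by
        rw [Fin.lt_def]
        omega
      simp [hm i j this]
    · intro i
      exact isUnit_sign_mul _ ⟨⟨_, _, hl i, hr i⟩, rfl⟩

end Inverse

section Check

variable (K : Type*) [Field K] (q : K) (M N : ℕ)

/-- `L^±(z)` is invertible over the quantum affine superalgebra. -/
theorem isUnit_affine (ε : Sgn) : IsUnit (twist (lSeries (affineGen K q M N ε))) := by
  have rel : ∀ {x y : FreeAlgebra K (Gen M N)}, BaseRel K q M N x y →
      RingQuot.mkAlgHom K (AffineRel K q M N) x = RingQuot.mkAlgHom K (AffineRel K q M N) y :=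
    fun h => RingQuot.mkAlgHom_rel K (AffineRel.base h)
  refine isUnit_twist_lSeries (affineGen K q M N) (fun i j h => ?_) (fun i j h => ?_)
    (fun i => ?_) (fun i => ?_) ε
  · simpa [affineGen] using rel (BaseRel.upper i j h)
  · simpa [affineGen] using rel (BaseRel.lower i j h)
  · simpa [affineGen] using rel (BaseRel.diag_left i)
  · simpa [affineGen] using rel (BaseRel.diag_right i)

/-- `L^±(z)` is invertible over the quantum loop superalgebra. -/
theorem isUnit_loop (ε : Sgn) : IsUnit (twist (lSeries (loopGen K q M N ε))) := by
  have rel : ∀ {x y : FreeAlgebra K (Gen M N)}, BaseRel K q M N x y →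
      RingQuot.mkAlgHom K (LoopRel K q M N) x = RingQuot.mkAlgHom K (LoopRel K q M N) y :=
    fun h => RingQuot.mkAlgHom_rel K (LoopRel.base h)
  refine isUnit_twist_lSeries (loopGen K q M N) (fun i j h => ?_) (fun i j h => ?_)
    (fun i => ?_) (fun i => ?_) ε
  · simpa [loopGen] using rel (BaseRel.upper i j h)
  · simpa [loopGen] using rel (BaseRel.lower i j h)
  · simpa [loopGen] using rel (BaseRel.diag_left i)
  · simpa [loopGen] using rel (BaseRel.diag_right i)

end Check

end QBer

end

/-!
The coefficients of the quantum Berezinian of `L^±(z)` are central.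

The signs of the graded tensor product are removed by tensoring the algebra with `2 × 2` matrices: an entry `l_{ij}` is
multiplied by a product of two anticommuting matrices depending on the parities of `i` and `j` (`parityMat`). The
relations then become ungraded exchange relations (`ExchangeData`, `HatAction.exchange`) for the `R`-matrix with diagonal
parameters `q` (even indices) and `-q⁻¹` (odd indices), and the inverse in the graded tensor product becomes the ordinary
inverse matrix (`isInv_hatInv`).

In an exchange algebra, quantum minors with a repeated row or column vanish because the `R`-matrix degenerates at the
arguments `z`, `z q^{±2}` occurring in the Berezinian. Hence the quotient of the leading quantum minors of sizes `k + 1`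
and `k` is the inverse of the last diagonal entry `N_{kk}` of the inverse of the corner block of `L` of size `k + 1`,
and the quotients of the minors of the inverse matrices are likewise the entries `N_{kk}` themselves
(`leadMinor_succ_mul`, `tailMinor_succ`). So the Berezinian is the ordered product of the `N_{kk}^{-1}` for even `k` and
the `N_{kk}` for odd `k`, taken at suitable arguments (`ExchangeData.minors_eq_prod`).

It suffices to show that this product commutes with a generating set. The exchange relations express every mode by the
modes of the entry `(0,0)`, the diagonal zero modes, and the zero modes `l⁺_{k,k+1}` and `l⁻_{k+1,k}`
(`ExchangeData.mode_mem`).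

* Zero modes. Each `N_{jj}` commutes with the diagonal zero modes, and up to a sign with `l⁺_{k,k+1}` and `l⁻_{k+1,k}`
  if `j ≠ k, k + 1`. The two remaining factors do so together: for equal parities of `k` and `k + 1` by
  `UpperRel.pair_commute`, for opposite parities by `UpperRel.odd_pair`, the two arguments then being equal. The sign
  left over is the one by which the matrices of the tensor product anticommute.
* The entry `(0,0)`. It lies in every corner block, and the exchange relation of a corner block with its inverse gives
  `ρ N_{kk} l_{00} = ρ' l_{00} N_{kk}` with scalar series `ρ`, `ρ'`. For two
  series of the same sign these agree and cancel. For opposite signs they are the values of one series at the central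
  elements `q^{-c}` and `q^c`. In the loop algebra both elements are `1`. In the affine algebra the product of the scalars over all `k`
  telescopes, up to the end terms, and the functional equation of the normalizing series makes it invariant under
  `y ↦ y q^{±2}`, hence constant since `q` is not a root of unity (`prod_factorScalar_affine`).
-/

noncomputable section

namespace QBer

/-! ### Quantum determinants of arrays -/

section QDet

variable {K : Type*} [Field K] {S : Type*} [Ring S] [Algebra K S]

/-- The quantum determinant `∑_σ (-q)^{-l(σ)} F_{0,σ(0)} F_{1,σ(1)} ⋯` of an array, the factors taken
in the order of the first index. -/
def qdet (q : K) {n : ℕ} (F : Fin n → Fin n → S) : S :=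
  ∑ σ : Equiv.Perm (Fin n), (((-q)⁻¹) ^ permLength σ) • (List.ofFn fun i => F i (σ i)).prod

lemma permLength_mul_swap {n : ℕ} (σ : Equiv.Perm (Fin n)) (i : ℕ) (hi : i + 1 < n)
    (h : σ ⟨i, by omega⟩ < σ ⟨i + 1, hi⟩) :
    permLength (σ * Equiv.swap ⟨i, by omega⟩ ⟨i + 1, hi⟩) = permLength σ + 1 := by
  set p : Fin n := ⟨i, by omega⟩ with hp
  set p' : Fin n := ⟨i + 1, hi⟩ with hp'
  set s := Equiv.swap p p' with hs
  have hss : ∀ a, s (s a) = a := fun a => Equiv.swap_apply_self p p' a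
  -- An adjacent transposition preserves the order of every pair but the one it exchanges.
  have mono : ∀ a b : Fin n, a < b → ¬ (a = p ∧ b = p') → s a < s b := by
    intro a b hab hne
    have v1 : (p : ℕ) = i := rfl
    have v2 : (p' : ℕ) = i + 1 := rfl
    rw [hs, Equiv.swap_apply_def, Equiv.swap_apply_def]
    clear h hss hs
    clear_value p p'
    simp only [Fin.ext_iff, Fin.lt_def] at *
    split_ifs <;> omega
  have key : (Finset.univ.filter fun x : Fin n × Fin n =>
        x.1 < x.2 ∧ σ (s x.2) < σ (s x.1)) =
      insert (p, p') ((Finset.univ.filter fun x : Fin n × Fin n =>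
        x.1 < x.2 ∧ σ x.2 < σ x.1).map (Equiv.prodCongr s s).toEmbedding) := by
    ext ⟨a, b⟩
    simp only [Finset.mem_filter, Finset.mem_univ, true_and, Finset.mem_insert, Finset.mem_map,
      Prod.mk.injEq, Prod.exists, Equiv.coe_toEmbedding,
      Equiv.prodCongr_apply, Prod.map_apply]
    constructor
    · rintro ⟨h1, h2⟩
      by_cases e : a = p ∧ b = p'
      · exact Or.inl e
      · exact Or.inr ⟨s a, s b, ⟨mono a b h1 e, h2⟩, hss a, hss b⟩
    · rintro (⟨rfl, rfl⟩ | ⟨a', b', ⟨h1, h2⟩, rfl, rfl⟩)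
      · refine ⟨by simp [p, p', Fin.lt_def], ?_⟩
        rw [hs, Equiv.swap_apply_left, Equiv.swap_apply_right]
        exact h
      · rw [hss, hss]
        refine ⟨mono a' b' h1 ?_, h2⟩
        rintro ⟨rfl, rfl⟩
        exact absurd h2 (not_lt.mpr h.le)
  have hlen : permLength (σ * s) = (Finset.univ.filter fun x : Fin n × Fin n =>
      x.1 < x.2 ∧ σ (s x.2) < σ (s x.1)).card := rfl
  rw [hlen, key, Finset.card_insert_of_notMem, Finset.card_map]
  · rfl
  · simp only [Finset.mem_map, Finset.mem_filter, Finset.mem_univ, true_and, Prod.exists,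
      Equiv.coe_toEmbedding, Equiv.prodCongr_apply, Prod.map_apply, Prod.mk.injEq, not_exists,
      not_and]
    rintro a b ⟨h1, -⟩ ha hb
    have ha' : a = p' := by rw [← hss a, ha, hs, Equiv.swap_apply_left]
    have hb' : b = p := by rw [← hss b, hb, hs, Equiv.swap_apply_right]
    rw [ha', hb', Fin.lt_def] at h1
    simp [p, p'] at h1

lemma prod_ofFn_split {n : ℕ} (G : Fin n → S) (i : ℕ) (hi : i + 1 < n) :
    (List.ofFn G).prod = ((List.ofFn G).take i).prod * (G ⟨i, by omega⟩ * G ⟨i + 1, hi⟩) *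
      ((List.ofFn G).drop (i + 2)).prod := by
  have h1 : (List.ofFn G).drop i =
      G ⟨i, by omega⟩ :: G ⟨i + 1, hi⟩ :: (List.ofFn G).drop (i + 2) := by
    rw [List.drop_eq_getElem_cons (by simp; omega), List.drop_eq_getElem_cons (by simp; omega)]
    simp
  conv_lhs => rw [← List.take_append_drop i (List.ofFn G), List.prod_append, h1]
  simp [mul_assoc]

lemma take_ofFn_congr {T : Type*} {n : ℕ} (G G' : Fin n → T) (i : ℕ)
    (h : ∀ j : Fin n, (j : ℕ) < i → G j = G' j) :
    (List.ofFn G).take i = (List.ofFn G').take i := by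
  apply List.ext_getElem
  · simp
  · intro k h1 h2
    simp only [List.length_take, List.length_ofFn, lt_inf_iff] at h1
    simp [h ⟨k, h1.2⟩ h1.1]

lemma drop_ofFn_congr {T : Type*} {n : ℕ} (G G' : Fin n → T) (i : ℕ)
    (h : ∀ j : Fin n, i ≤ (j : ℕ) → G j = G' j) :
    (List.ofFn G).drop i = (List.ofFn G').drop i := by
  apply List.ext_getElem
  · simp
  · intro k h1 h2
    simp only [List.length_drop, List.length_ofFn] at h1
    simp [h ⟨i + k, by omega⟩ (by simp)]

/-- If two arrays agree off two adjacent positions and their `2 × 2` quantum minors at these positions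
are proportional, so are their quantum determinants. -/
theorem qdet_eq_smul_of_adjacent (q : K) {n : ℕ} (F F' : Fin n → Fin n → S) (i : ℕ) (hi : i + 1 < n)
    (lam : K) (hne : ∀ j : Fin n, (j : ℕ) ≠ i → (j : ℕ) ≠ i + 1 → F j = F' j)
    (h : ∀ a c : Fin n, a < c →
      F ⟨i, by omega⟩ a * F ⟨i + 1, hi⟩ c + (-q)⁻¹ • (F ⟨i, by omega⟩ c * F ⟨i + 1, hi⟩ a) =
      lam • (F' ⟨i, by omega⟩ a * F' ⟨i + 1, hi⟩ c +
        (-q)⁻¹ • (F' ⟨i, by omega⟩ c * F' ⟨i + 1, hi⟩ a))) :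
    qdet q F = lam • qdet q F' := by
  classical
  set p : Fin n := ⟨i, by omega⟩ with hp
  set p' : Fin n := ⟨i + 1, hi⟩ with hp'
  have hpp : p ≠ p' := by simp [hp, hp']
  -- Pair `σ` with its product by the adjacent transposition.
  have pairing : ∀ f : Equiv.Perm (Fin n) → S, ∑ σ, f σ =
      ∑ σ ∈ Finset.univ.filter (fun σ : Equiv.Perm (Fin n) => σ p < σ p'),
        (f σ + f (σ * Equiv.swap p p')) := by
    intro f
    rw [Finset.sum_add_distrib, ← Finset.sum_filter_add_sum_filter_not Finset.univ
      (fun σ : Equiv.Perm (Fin n) => σ p < σ p') f]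
    congr 1
    refine Finset.sum_nbij' (fun σ => σ * Equiv.swap p p') (fun σ => σ * Equiv.swap p p') ?_ ?_ ?_ ?_ ?_
    · intro σ hσ
      simp only [Finset.mem_filter, Finset.mem_univ, true_and, not_lt, Equiv.Perm.mul_apply,
        Equiv.swap_apply_left, Equiv.swap_apply_right] at hσ ⊢
      exact lt_of_le_of_ne hσ fun e => hpp (σ.injective e.symm)
    · intro σ hσ
      simp only [Finset.mem_filter, Finset.mem_univ, true_and, not_lt, Equiv.Perm.mul_apply,
        Equiv.swap_apply_left, Equiv.swap_apply_right] at hσ ⊢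
      exact hσ.le
    · intro σ _; simp [mul_assoc]
    · intro σ _; simp [mul_assoc]
    · intro σ _; simp [mul_assoc]
  have term : ∀ (H : Fin n → Fin n → S) (σ : Equiv.Perm (Fin n)), σ p < σ p' →
      (((-q)⁻¹) ^ permLength σ) • (List.ofFn fun i => H i (σ i)).prod +
        (((-q)⁻¹) ^ permLength (σ * Equiv.swap p p')) •
          (List.ofFn fun i => H i ((σ * Equiv.swap p p') i)).prod =
      (((-q)⁻¹) ^ permLength σ) • (((List.ofFn fun i => H i (σ i)).take i).prod *
        (H p (σ p) * H p' (σ p') + (-q)⁻¹ • (H p (σ p') * H p' (σ p))) *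
        ((List.ofFn fun i => H i (σ i)).drop (i + 2)).prod) := by
    intro H σ hσ
    have hsw : ∀ j : Fin n, (j : ℕ) ≠ i → (j : ℕ) ≠ i + 1 →
        (σ * Equiv.swap p p') j = σ j := by
      intro j h1 h2
      rw [Equiv.Perm.mul_apply, Equiv.swap_apply_of_ne_of_ne]
      · intro e; exact h1 (congrArg Fin.val e)
      · intro e; exact h2 (congrArg Fin.val e)
    rw [permLength_mul_swap σ i hi hσ, prod_ofFn_split _ i hi,
      prod_ofFn_split (fun j => H j ((σ * Equiv.swap p p') j)) i hi,
      take_ofFn_congr (fun j => H j ((σ * Equiv.swap p p') j)) (fun j => H j (σ j)) i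
        (fun j hj => by rw [hsw j (by omega) (by omega)]),
      drop_ofFn_congr (fun j => H j ((σ * Equiv.swap p p') j)) (fun j => H j (σ j)) (i + 2)
        (fun j hj => by rw [hsw j (by omega) (by omega)])]
    simp only [Equiv.Perm.mul_apply, ← hp, ← hp', Equiv.swap_apply_left, Equiv.swap_apply_right]
    rw [pow_succ, mul_smul, ← smul_add, mul_add, add_mul, mul_smul_comm, smul_mul_assoc]
  unfold qdet
  rw [pairing, pairing, Finset.smul_sum]
  refine Finset.sum_congr rfl fun σ hσ => ?_
  have hσ' : σ p < σ p' := by simpa using hσ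
  rw [term F σ hσ', term F' σ hσ', h _ _ hσ',
    take_ofFn_congr (fun j => F j (σ j)) (fun j => F' j (σ j)) i
      (fun j hj => by rw [hne j (by omega) (by omega)]),
    drop_ofFn_congr (fun j => F j (σ j)) (fun j => F' j (σ j)) (i + 2)
      (fun j hj => by rw [hne j (by omega) (by omega)])]
  rw [mul_smul_comm, smul_mul_assoc, smul_comm]

/-- The `2 × 2` quantum minors of `T i`, `T (i+1)` in rows `a < c` are, as functions of the pair of columns, quantum
antisymmetric: interchanging the columns multiplies them by a scalar independent of the rows, and they vanish for
equal columns. Only columns satisfying `good` are considered. -/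
def QAntisymm (q : K) (n : ℕ) (good : ℕ → Prop) (T : ℕ → ℕ → ℕ → S) : Prop :=
  ∀ i, i + 1 < n → ∀ u v, good u → good v → ∃ lam : K, (u = v → lam = 0) ∧ ∀ a c, a < c → c < n →
    T i a u * T (i + 1) c v + (-q)⁻¹ • (T i c u * T (i + 1) a v) =
      lam • (T i a v * T (i + 1) c u + (-q)⁻¹ • (T i c v * T (i + 1) a u))

/-- A quantum minor with a repeated column vanishes: adjacent columns are interchanged until the equal ones are next to
each other. Here `k + 1` is the distance of the equal columns. -/
theorem qdet_eq_zero_of_repeated (q : K) {n : ℕ} {good : ℕ → Prop} {T : ℕ → ℕ → ℕ → S}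
    (hT : QAntisymm q n good T) (k : ℕ) : ∀ (w : ℕ → ℕ) (p : ℕ), (∀ i < n, good (w i)) →
      p + k + 1 < n → w p = w (p + k + 1) →
      qdet q (fun i a : Fin n => T i a (w i)) = 0 := by
  induction k with
  | zero =>
    intro w p hw hp he
    obtain ⟨lam, h0, h⟩ := hT p (by omega) (w p) (w (p + 1)) (hw _ (by omega)) (hw _ (by omega))
    have := qdet_eq_smul_of_adjacent q (fun i a : Fin n => T i a (w i))
      (fun i a : Fin n => T i a (w i)) p (by omega) 0 (fun _ _ _ => rfl) (by
        intro a c hac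
        have := h a c hac c.2
        rw [h0 he] at this
        simpa using this)
    rw [this, zero_smul]
  | succ k ih =>
    intro w p hw hp he
    obtain ⟨lam, h0, h⟩ := hT (p + k + 1) (by omega) (w (p + k + 1)) (w (p + k + 2))
      (hw _ (by omega)) (hw _ (by omega))
    have key := qdet_eq_smul_of_adjacent q (fun i a : Fin n => T i a (w i))
      (fun i a : Fin n => T i a (w (Equiv.swap (p + k + 1) (p + k + 2) (i : ℕ)))) (p + k + 1)
      (by omega) lam ?_ ?_
    · rw [key, ih (fun i => w (Equiv.swap (p + k + 1) (p + k + 2) i)) p ?_ (by omega) ?_, smul_zero]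
      · intro i hi
        apply hw
        rw [Equiv.swap_apply_def]
        split_ifs <;> omega
      · rw [Equiv.swap_apply_left, Equiv.swap_apply_of_ne_of_ne (by omega) (by omega), he]
        rfl
    · intro j h1 h2
      rw [Equiv.swap_apply_of_ne_of_ne h1 h2]
    · intro a c hac
      simp only [Equiv.swap_apply_left, Equiv.swap_apply_right]
      exact h a c hac c.2

/-- The cofactor of the entry `F 0 c` in the expansion of `qdet F` along its first factor, as a function
of the remaining factors. -/
def headCofactor (q : K) {n : ℕ} (G : Fin n → Fin (n + 1) → S) (c : Fin (n + 1)) : S :=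
  ∑ σ ∈ Finset.univ.filter (fun σ : Equiv.Perm (Fin (n + 1)) => σ 0 = c),
    (((-q)⁻¹) ^ permLength σ) • (List.ofFn fun i => G i (σ i.succ)).prod

/-- The cofactor of the entry `F n c` in the expansion of `qdet F` along its last factor, as a function
of the remaining factors. -/
def lastCofactor (q : K) {n : ℕ} (G : Fin n → Fin (n + 1) → S) (c : Fin (n + 1)) : S :=
  ∑ σ ∈ Finset.univ.filter (fun σ : Equiv.Perm (Fin (n + 1)) => σ (Fin.last n) = c),
    (((-q)⁻¹) ^ permLength σ) • (List.ofFn fun i => G i (σ i.castSucc)).prod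

theorem qdet_eq_sum_head (q : K) {n : ℕ} (F : Fin (n + 1) → Fin (n + 1) → S) :
    qdet q F = ∑ c, F 0 c * headCofactor q (fun i => F i.succ) c := by
  unfold qdet headCofactor
  rw [← Finset.sum_fiberwise Finset.univ (fun σ : Equiv.Perm (Fin (n + 1)) => σ 0)]
  refine Finset.sum_congr rfl fun c _ => ?_
  rw [Finset.mul_sum]
  refine Finset.sum_congr rfl fun σ hσ => ?_
  simp only [Finset.mem_filter, Finset.mem_univ, true_and] at hσ
  rw [List.ofFn_succ, List.prod_cons, hσ, mul_smul_comm]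

theorem qdet_eq_sum_last (q : K) {n : ℕ} (F : Fin (n + 1) → Fin (n + 1) → S) :
    qdet q F = ∑ c, lastCofactor q (fun i => F i.castSucc) c * F (Fin.last n) c := by
  unfold qdet lastCofactor
  rw [← Finset.sum_fiberwise Finset.univ (fun σ : Equiv.Perm (Fin (n + 1)) => σ (Fin.last n))]
  refine Finset.sum_congr rfl fun c _ => ?_
  rw [Finset.sum_mul]
  refine Finset.sum_congr rfl fun σ hσ => ?_
  simp only [Finset.mem_filter, Finset.mem_univ, true_and] at hσ
  rw [List.ofFn_succ_last, List.prod_append, List.prod_singleton, hσ, smul_mul_assoc]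

lemma permLength_of_embedding {n : ℕ} (f : Fin n ↪o Fin (n + 1)) (e : Fin (n + 1))
    (hf : ∀ a, a ≠ e → ∃ b, f b = a) (σ : Equiv.Perm (Fin (n + 1))) (τ : Equiv.Perm (Fin n))
    (h : ∀ a, σ (f a) = f (τ a)) (he : σ e = e) (hext : (∀ a, e ≤ a) ∨ (∀ a, a ≤ e)) :
    permLength σ = permLength τ := by
  unfold permLength
  rw [← Finset.card_map (f.toEmbedding.prodMap f.toEmbedding)]
  congr 1
  ext ⟨a, b⟩
  simp only [Finset.mem_filter, Finset.mem_univ, true_and, Finset.mem_map, Prod.exists,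
    Function.Embedding.coe_prodMap, RelEmbedding.coe_toEmbedding, Prod.map_apply, Prod.mk.injEq]
  constructor
  · rintro ⟨h1, h2⟩
    have ha : a ≠ e := by
      rintro rfl
      rcases hext with hx | hx
      · exact absurd h2 (not_lt.mpr (he.symm ▸ hx (σ b)))
      · exact absurd h1 (not_lt.mpr (hx _))
    have hb : b ≠ e := by
      rintro rfl
      rcases hext with hx | hx
      · exact absurd h1 (not_lt.mpr (hx _))
      · exact absurd h2 (not_lt.mpr (he.symm ▸ hx (σ a)))
    obtain ⟨a', rfl⟩ := hf a ha
    obtain ⟨b', rfl⟩ := hf b hb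
    rw [h, h] at h2
    exact ⟨a', b', ⟨f.lt_iff_lt.mp h1, f.lt_iff_lt.mp h2⟩, rfl, rfl⟩
  · rintro ⟨a', b', ⟨h1, h2⟩, rfl, rfl⟩
    rw [h, h]
    exact ⟨f.lt_iff_lt.mpr h1, f.lt_iff_lt.mpr h2⟩

lemma sum_perm_fixing {n : ℕ} (f : Fin n ↪o Fin (n + 1)) (e : Fin (n + 1)) (hfe : ∀ a, f a ≠ e)
    (hf : ∀ a, a ≠ e → ∃ b, f b = a) (φ : Equiv.Perm (Fin (n + 1)) → S)
    (ψ : Equiv.Perm (Fin n) → S)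
    (h : ∀ σ τ, σ e = e → (∀ a, σ (f a) = f (τ a)) → φ σ = ψ τ) :
    ∑ σ ∈ Finset.univ.filter (fun σ : Equiv.Perm (Fin (n + 1)) => σ e = e), φ σ = ∑ τ, ψ τ := by
  classical
  -- The permutation of `Fin (n + 1)` extending `τ` and fixing `e`.
  let E : Fin n ≃ {a // a ≠ e} := Equiv.ofBijective (fun a => ⟨f a, hfe a⟩)
    ⟨fun a b hab => f.injective (congrArg Subtype.val hab),
      fun ⟨a, ha⟩ => by obtain ⟨b, rfl⟩ := hf a ha; exact ⟨b, rfl⟩⟩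
  have hE : ∀ (τ : Equiv.Perm (Fin n)) a, (τ.extendDomain E) (f a) = f (τ a) := fun τ a =>
    Equiv.Perm.extendDomain_apply_image τ E a
  have hEe : ∀ τ : Equiv.Perm (Fin n), (τ.extendDomain E) e = e := fun τ =>
    Equiv.Perm.extendDomain_apply_not_subtype τ E (by simp)
  symm
  refine Finset.sum_bij (fun τ _ => τ.extendDomain E) ?_ ?_ ?_ ?_
  · intro τ _
    simp [hEe τ]
  · intro τ _ τ' _ heq
    ext a
    have : f (τ a) = f (τ' a) := by rw [← hE, ← hE, heq]
    rw [f.injective this]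
  · intro σ hσ
    simp only [Finset.mem_filter, Finset.mem_univ, true_and] at hσ
    have hinv : ∀ a, σ a ≠ e ↔ a ≠ e := fun a => by
      rw [not_iff_not]
      constructor
      · intro h'; exact σ.injective (h'.trans hσ.symm)
      · rintro rfl; exact hσ
    refine ⟨E.permCongr.symm (σ.subtypePerm (p := fun a => a ≠ e) hinv), Finset.mem_univ _, ?_⟩
    ext1 a
    by_cases ha : a = e
    · rw [ha, hEe, hσ]
    · obtain ⟨b, rfl⟩ := hf a ha
      rw [hE]
      have : f (E.symm (σ.subtypePerm (p := fun a => a ≠ e) hinv (E b))) =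
          (E (E.symm (σ.subtypePerm (p := fun a => a ≠ e) hinv (E b)))).1 := rfl
      rw [Equiv.permCongr_symm_apply, this, Equiv.apply_symm_apply]
      rfl
  · intro τ _
    exact (h _ _ (hEe τ) (hE τ)).symm

theorem headCofactor_zero (q : K) {n : ℕ} (G : Fin n → Fin (n + 1) → S) :
    headCofactor q G 0 = qdet q (fun i a => G i a.succ) := by
  have hf : ∀ a : Fin (n + 1), a ≠ 0 → ∃ b : Fin n, Fin.succOrderEmb n b = a :=
    fun a ha => ⟨a.pred ha, by simp⟩
  refine sum_perm_fixing (Fin.succOrderEmb n) 0 (fun a => Fin.succ_ne_zero a) hf _ _ ?_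
  intro σ τ h0 h
  rw [permLength_of_embedding (Fin.succOrderEmb n) 0 hf σ τ h h0 (Or.inl fun a => Fin.zero_le a)]
  have h' : ∀ a : Fin n, σ a.succ = (τ a).succ := h
  simp only [h']

theorem lastCofactor_last (q : K) {n : ℕ} (G : Fin n → Fin (n + 1) → S) :
    lastCofactor q G (Fin.last n) = qdet q (fun i a => G i a.castSucc) := by
  have hf : ∀ a : Fin (n + 1), a ≠ Fin.last n → ∃ b : Fin n, Fin.castSuccOrderEmb b = a :=
    fun a ha => ⟨a.castPred ha, by simp⟩
  refine sum_perm_fixing Fin.castSuccOrderEmb (Fin.last n) (fun a => (Fin.castSucc_lt_last a).ne)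
    hf _ _ ?_
  intro σ τ h0 h
  rw [permLength_of_embedding Fin.castSuccOrderEmb (Fin.last n) hf σ τ h h0
    (Or.inr fun a => Fin.le_last a)]
  have h' : ∀ a : Fin n, σ a.castSucc = (τ a).castSucc := h
  simp only [h']

end QDet

/-! ### Exchange relations and inverses of corner blocks -/

section Exchange

variable {Λ : Type*} [CommRing Λ] {S : Type*} [Ring S] [Algebra Λ S]

/-- The entries of the relation `R X₁ Y₂ = Y₂ X₁ R'` for `R = ∑ r_{ac} E_{aa} ⊗ E_{cc} + ∑ x_{ac} E_{ac} ⊗ E_{ca}`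
and `R'` likewise. Matrices are indexed by all natural numbers; a finite matrix is extended by zero. -/
def RLL (r r' x x' : ℕ → ℕ → Λ) (X Y : ℕ → ℕ → S) : Prop :=
  ∀ a b c d, r a c • (X a b * Y c d) + x a c • (X c b * Y a d) =
    r' b d • (Y c d * X a b) + x' d b • (Y c b * X a d)

/-- `N` is inverse to the corner block of `X` formed by the first `m` rows and columns. -/
structure IsInv (m : ℕ) (X N : ℕ → ℕ → S) : Prop where
  left : ∀ i < m, ∀ d < m, ∑ c ∈ Finset.range m, N i c * X c d = if i = d then 1 else 0
  right : ∀ i < m, ∀ d < m, ∑ c ∈ Finset.range m, X i c * N c d = if i = d then 1 else 0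

/-- The product of a row of `N`, cut after `m` entries, with a column of `X`. -/
def rowMul (m : ℕ) (N X : ℕ → ℕ → S) (i b : ℕ) : S := ∑ c ∈ Finset.range m, N i c * X c b

/-- The relation between `X` and the inverse `N` of a corner block of `Y`. The rows and columns of `X`
are not restricted to the block. -/
theorem RLL.inv_right {r r' x x' : ℕ → ℕ → Λ} {X Y N : ℕ → ℕ → S} (h : RLL r r' x x' X Y) {m : ℕ}
    (hN : IsInv m Y N) {i l : ℕ} (hi : i < m) (hl : l < m) (a b : ℕ) :
    r a l • (N i l * X a b) +
        ∑ c ∈ Finset.range m, x a c • (N i c * X c b * rowMul m Y N a l) =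
      r' b i • (X a b * N i l) +
        ∑ d ∈ Finset.range m, x' d b • (rowMul m N Y i b * (X a d * N d l)) := by
  have key : ∑ c ∈ Finset.range m, ∑ d ∈ Finset.range m,
      N i c * (r a c • (X a b * Y c d) + x a c • (X c b * Y a d)) * N d l =
      ∑ c ∈ Finset.range m, ∑ d ∈ Finset.range m,
        N i c * (r' b d • (Y c d * X a b) + x' d b • (Y c b * X a d)) * N d l :=
    Finset.sum_congr rfl fun c _ => Finset.sum_congr rfl fun d _ => by rw [h a b c d]
  have e1 : ∑ c ∈ Finset.range m, ∑ d ∈ Finset.range m,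
      N i c * (r a c • (X a b * Y c d) + x a c • (X c b * Y a d)) * N d l =
      r a l • (N i l * X a b) +
        ∑ c ∈ Finset.range m, x a c • (N i c * X c b * rowMul m Y N a l) := by
    simp only [mul_add, add_mul, Finset.sum_add_distrib]
    congr 1
    · have : ∀ c ∈ Finset.range m, ∑ d ∈ Finset.range m, N i c * (r a c • (X a b * Y c d)) * N d l =
          if c = l then r a l • (N i l * X a b) else 0 := by
        intro c hc
        have h1 : ∀ d ∈ Finset.range m, N i c * (r a c • (X a b * Y c d)) * N d l =
            r a c • (N i c * X a b * (Y c d * N d l)) := fun d _ => by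
          simp only [mul_smul_comm, smul_mul_assoc, mul_assoc]
        rw [Finset.sum_congr rfl h1, ← Finset.smul_sum, ← Finset.mul_sum,
          hN.right c (Finset.mem_range.mp hc) l hl]
        split_ifs with e
        · subst e; simp
        · simp
      rw [Finset.sum_congr rfl this, Finset.sum_ite_eq' , if_pos (Finset.mem_range.mpr hl)]
    · refine Finset.sum_congr rfl fun c _ => ?_
      rw [rowMul, Finset.mul_sum, Finset.smul_sum]
      refine Finset.sum_congr rfl fun d _ => ?_
      simp only [mul_smul_comm, smul_mul_assoc, mul_assoc]
  have e2 : ∑ c ∈ Finset.range m, ∑ d ∈ Finset.range m,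
      N i c * (r' b d • (Y c d * X a b) + x' d b • (Y c b * X a d)) * N d l =
      r' b i • (X a b * N i l) +
        ∑ d ∈ Finset.range m, x' d b • (rowMul m N Y i b * (X a d * N d l)) := by
    rw [Finset.sum_comm]
    simp only [mul_add, add_mul, Finset.sum_add_distrib]
    congr 1
    · have : ∀ d ∈ Finset.range m, ∑ c ∈ Finset.range m, N i c * (r' b d • (Y c d * X a b)) * N d l =
          if i = d then r' b i • (X a b * N i l) else 0 := by
        intro d hd
        have h1 : ∀ c ∈ Finset.range m, N i c * (r' b d • (Y c d * X a b)) * N d l =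
            (N i c * Y c d) * (r' b d • (X a b * N d l)) := fun c _ => by
          simp only [mul_smul_comm, smul_mul_assoc, mul_assoc]
        rw [Finset.sum_congr rfl h1, ← Finset.sum_mul, hN.left i hi d (Finset.mem_range.mp hd)]
        split_ifs with e
        · subst e; simp
        · simp
      rw [Finset.sum_congr rfl this, Finset.sum_ite_eq, if_pos (Finset.mem_range.mpr hi)]
    · refine Finset.sum_congr rfl fun d _ => ?_
      rw [rowMul, Finset.sum_mul, Finset.smul_sum]
      refine Finset.sum_congr rfl fun c _ => ?_
      simp only [mul_smul_comm, smul_mul_assoc, mul_assoc]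
  rw [← e1, key, e2]

lemma IsInv.rowMul_left {m : ℕ} {X N : ℕ → ℕ → S} (h : IsInv m X N) {i d : ℕ} (hi : i < m)
    (hd : d < m) : rowMul m N X i d = if i = d then 1 else 0 := h.left i hi d hd

lemma IsInv.rowMul_right {m : ℕ} {X N : ℕ → ℕ → S} (h : IsInv m X N) {i d : ℕ} (hi : i < m)
    (hd : d < m) : rowMul m X N i d = if i = d then 1 else 0 := h.right i hi d hd

/-- The inverses of corner blocks satisfy the exchange relation in the opposite order. -/
theorem RLL.inv_inv {r r' x x' : ℕ → ℕ → Λ} {X Y X' Y' : ℕ → ℕ → S} (h : RLL r r' x x' X Y) {m : ℕ}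
    (hX : IsInv m X X') (hY : IsInv m Y Y') {a b c d : ℕ} (ha : a < m) (hb : b < m) (hc : c < m)
    (hd : d < m) :
    r' a c • (Y' c d * X' a b) + x' a c • (Y' a d * X' c b) =
      r b d • (X' a b * Y' c d) + x d b • (X' a d * Y' c b) := by
  have h0 : ∀ u ∈ Finset.range m, ∀ v ∈ Finset.range m,
      r u d • (Y' c d * X u v) + (if u = d then ∑ w ∈ Finset.range m, x d w • (Y' c w * X w v) else 0) =
      r' v c • (X u v * Y' c d) +
        (if c = v then ∑ w ∈ Finset.range m, x' w c • (X u w * Y' w d) else 0) := by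
    intro u hu v hv
    rw [Finset.mem_range] at hu hv
    have := h.inv_right hY hc hd u v
    rw [hY.rowMul_right hu hd, hY.rowMul_left hc hv] at this
    rcases eq_or_ne u d with rfl | hud <;> rcases eq_or_ne c v with rfl | hcv <;>
      simpa [*] using this
  have key : ∑ u ∈ Finset.range m, ∑ v ∈ Finset.range m, X' a u *
      (r u d • (Y' c d * X u v) + (if u = d then ∑ w ∈ Finset.range m, x d w • (Y' c w * X w v) else 0)) *
        X' v b = ∑ u ∈ Finset.range m, ∑ v ∈ Finset.range m, X' a u *
      (r' v c • (X u v * Y' c d) +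
        (if c = v then ∑ w ∈ Finset.range m, x' w c • (X u w * Y' w d) else 0)) * X' v b :=
    Finset.sum_congr rfl fun u hu => Finset.sum_congr rfl fun v hv => by rw [h0 u hu v hv]
  have e1 : ∑ u ∈ Finset.range m, ∑ v ∈ Finset.range m, X' a u *
      (r u d • (Y' c d * X u v) + (if u = d then ∑ w ∈ Finset.range m, x d w • (Y' c w * X w v) else 0)) *
        X' v b = r b d • (X' a b * Y' c d) + x d b • (X' a d * Y' c b) := by
    simp only [mul_add, add_mul, Finset.sum_add_distrib]
    congr 1
    · have : ∀ u ∈ Finset.range m, ∑ v ∈ Finset.range m, X' a u * (r u d • (Y' c d * X u v)) * X' v b =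
          if u = b then r b d • (X' a b * Y' c d) else 0 := by
        intro u hu
        have h1 : ∀ v ∈ Finset.range m, X' a u * (r u d • (Y' c d * X u v)) * X' v b =
            r u d • (X' a u * Y' c d * (X u v * X' v b)) := fun v _ => by
          simp only [mul_smul_comm, smul_mul_assoc, mul_assoc]
        rw [Finset.sum_congr rfl h1, ← Finset.smul_sum, ← Finset.mul_sum,
          hX.right u (Finset.mem_range.mp hu) b hb]
        split_ifs with e
        · subst e; simp
        · simp
      rw [Finset.sum_congr rfl this, Finset.sum_ite_eq', if_pos (Finset.mem_range.mpr hb)]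
    · rw [Finset.sum_eq_single d (fun u _ hu => by simp [hu])
        (fun hh => absurd (Finset.mem_range.mpr hd) hh)]
      simp only [if_true, Finset.mul_sum, Finset.sum_mul]
      rw [Finset.sum_comm]
      have : ∀ w ∈ Finset.range m, ∑ v ∈ Finset.range m, X' a d * (x d w • (Y' c w * X w v)) * X' v b =
          if w = b then x d b • (X' a d * Y' c b) else 0 := by
        intro w hw
        have h1 : ∀ v ∈ Finset.range m, X' a d * (x d w • (Y' c w * X w v)) * X' v b =
            x d w • (X' a d * Y' c w * (X w v * X' v b)) := fun v _ => by
          simp only [mul_smul_comm, smul_mul_assoc, mul_assoc]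
        rw [Finset.sum_congr rfl h1, ← Finset.smul_sum, ← Finset.mul_sum,
          hX.right w (Finset.mem_range.mp hw) b hb]
        split_ifs with e
        · subst e; simp
        · simp
      rw [Finset.sum_congr rfl this, Finset.sum_ite_eq', if_pos (Finset.mem_range.mpr hb)]
  have e2 : ∑ u ∈ Finset.range m, ∑ v ∈ Finset.range m, X' a u *
      (r' v c • (X u v * Y' c d) +
        (if c = v then ∑ w ∈ Finset.range m, x' w c • (X u w * Y' w d) else 0)) * X' v b =
      r' a c • (Y' c d * X' a b) + x' a c • (Y' a d * X' c b) := by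
    rw [Finset.sum_comm]
    simp only [mul_add, add_mul, Finset.sum_add_distrib]
    congr 1
    · have : ∀ v ∈ Finset.range m, ∑ u ∈ Finset.range m, X' a u * (r' v c • (X u v * Y' c d)) * X' v b =
          if a = v then r' a c • (Y' c d * X' a b) else 0 := by
        intro v hv
        have h1 : ∀ u ∈ Finset.range m, X' a u * (r' v c • (X u v * Y' c d)) * X' v b =
            (X' a u * X u v) * (r' v c • (Y' c d * X' v b)) := fun u _ => by
          simp only [mul_smul_comm, smul_mul_assoc, mul_assoc]
        rw [Finset.sum_congr rfl h1, ← Finset.sum_mul, hX.left a ha v (Finset.mem_range.mp hv)]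
        split_ifs with e
        · subst e; simp
        · simp
      rw [Finset.sum_congr rfl this, Finset.sum_ite_eq, if_pos (Finset.mem_range.mpr ha)]
    · rw [Finset.sum_eq_single c (fun u _ hu => by simp [Ne.symm hu])
        (fun hh => absurd (Finset.mem_range.mpr hc) hh)]
      simp only [if_true, Finset.mul_sum, Finset.sum_mul]
      rw [Finset.sum_comm]
      have : ∀ w ∈ Finset.range m, ∑ u ∈ Finset.range m, X' a u * (x' w c • (X u w * Y' w d)) * X' c b =
          if a = w then x' a c • (Y' a d * X' c b) else 0 := by
        intro w hw
        have h1 : ∀ u ∈ Finset.range m, X' a u * (x' w c • (X u w * Y' w d)) * X' c b =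
            (X' a u * X u w) * (x' w c • (Y' w d * X' c b)) := fun v _ => by
          simp only [mul_smul_comm, smul_mul_assoc, mul_assoc]
        rw [Finset.sum_congr rfl h1, ← Finset.sum_mul, hX.left a ha w (Finset.mem_range.mp hw)]
        split_ifs with e
        · subst e; simp
        · simp
      rw [Finset.sum_congr rfl this, Finset.sum_ite_eq, if_pos (Finset.mem_range.mpr ha)]
  rw [← e1, key, e2]

/-- Exchanging the roles of the two matrices: if `R̄ R = c` and `R' R̄' = c'` for scalars `c`, `c'`, then
`R X₁ Y₂ = Y₂ X₁ R'` implies `c' R̄ Y₂ X₁ = c X₁ Y₂ R̄'`; both sides are written with the two tensor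
factors interchanged. -/
theorem RLL.swap {r r' x x' s s' y y' : ℕ → ℕ → Λ} {c c' : Λ} {X Y : ℕ → ℕ → S}
    (h : RLL r r' x x' X Y)
    (h1 : ∀ a b, s a b * r a b + y a b * x b a = c) (h2 : ∀ a b, s a b * x a b + y a b * r b a = 0)
    (h1' : ∀ a b, r' a b * s' a b + x' a b * y' b a = c')
    (h2' : ∀ a b, r' a b * y' a b + x' a b * s' b a = 0) :
    RLL (fun a b => c' * s b a) (fun a b => c * s' b a) (fun a b => c' * y b a)
      (fun a b => c * y' b a) Y X := by
  intro c0 d a b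
  linear_combination (norm := module) (-(s a c0 * s' b d)) • h a b c0 d - (y a c0 * s' b d) • h c0 b a d -
    (s a c0 * y' d b) • h a d c0 b - (y a c0 * y' d b) • h c0 d a b +
    (s' b d * h1 a c0) • (X a b * Y c0 d) + (s' b d * h2 a c0) • (X c0 b * Y a d) +
    (y' d b * h1 a c0) • (X a d * Y c0 b) + (y' d b * h2 a c0) • (X c0 d * Y a b) -
    (s a c0 * h1' b d) • (Y c0 d * X a b) - (s a c0 * h2' d b) • (Y c0 b * X a d) -
    (y a c0 * h1' b d) • (Y a d * X c0 b) - (y a c0 * h2' d b) • (Y a b * X c0 d)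

end Exchange

/-! ### Factorization of the two quantum minors of the Berezinian -/

section Minors

variable {K : Type*} [Field K]

/-- `q` for even indices and `-q⁻¹` for odd ones, i.e. the two roots of `t - t⁻¹ = q - q⁻¹`. This is the diagonal
parameter of the `R`-matrix after the signs of the graded tensor product have been removed. -/
def qt (q : K) (M a : ℕ) : K := if a < M then q else -q⁻¹

/-- The sign `(-1)^{par a par c}`. -/
def sg (K : Type*) [Field K] (M a c : ℕ) : K := if M ≤ a ∧ M ≤ c then -1 else 1

/-- The coefficient of `E_{aa} ⊗ E_{cc}` in the ungraded `R`-matrix; the pair `(α, β)` stands for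
`α z + β w`. -/
def rho (q : K) (M a c : ℕ) : K × K :=
  if a = c then (qt q M a, -(qt q M a)⁻¹) else (sg K M a c, -sg K M a c)

/-- The coefficient of `E_{ac} ⊗ E_{ca}` in the ungraded `R`-matrix. -/
def rex (q : K) (a c : ℕ) : K × K :=
  if a < c then (q - q⁻¹, 0) else if c < a then (0, q - q⁻¹) else (0, 0)

/-- The value of the linear form `α z + β w`. -/
def evalForm (p : K × K) (z w : K) : K := p.1 * z + p.2 * w

variable {S : Type*} [Ring S] [Algebra K S]

/-- The exchange relation with the `R`-matrix `R(z,w)`, for scalars `z`, `w`. -/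
def RZ (q : K) (M : ℕ) (z w : K) (X Y : ℕ → ℕ → S) : Prop :=
  RLL (fun a c => evalForm (rho q M a c) z w) (fun a c => evalForm (rho q M a c) z w)
    (fun a c => evalForm (rex q a c) z w) (fun a c => evalForm (rex q a c) z w) X Y

/-- For even indices, the exchange relation at the points `c`, `c q²`, where the `R`-matrix degenerates, makes the
columns quantum antisymmetric. -/
lemma qAntisymm_columns {q : K} (hq : q ≠ 0) (hq2 : q ^ 2 ≠ 1) {M : ℕ} {c : ℕ → K}
    (hc : ∀ i, c i ≠ 0) {X : ℕ → ℕ → ℕ → S}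
    (hX : ∀ i, i + 1 < M → RZ q M (c i) (c i * q ^ 2) (X i) (X (i + 1))) {m : ℕ} (hm : m ≤ M) :
    QAntisymm q m (· < M) X := by
  intro i hi u v hu hv
  have h := hX i (by omega)
  have hδ : 1 - q ^ 2 ≠ 0 := sub_ne_zero.mpr hq2.symm
  have hci := hc i
  -- The values of the coefficients at `w = z q²`.
  have off : ∀ a b, a < M → a ≠ b →
      evalForm (rho q M a b) (c i) (c i * q ^ 2) = c i * (1 - q ^ 2) := by
    intro a b ha hab
    simp only [evalForm, rho, if_neg hab, sg, if_neg (show ¬ (M ≤ a ∧ M ≤ b) by omega)]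
    ring
  have up : ∀ a b, a < b → evalForm (rex q a b) (c i) (c i * q ^ 2) = c i * (q - q⁻¹) := by
    intro a b hab
    simp only [evalForm, rex, if_pos hab]
    ring
  have dn : ∀ a b, b < a → evalForm (rex q a b) (c i) (c i * q ^ 2) = c i * q ^ 2 * (q - q⁻¹) := by
    intro a b hab
    simp only [evalForm, rex, if_pos hab, if_neg (show ¬ a < b by omega)]
    ring
  have main : ∀ u v a b, u < v → u < M → v < M → a < b → b < M →
      X i a u * X (i + 1) b v + (-q)⁻¹ • (X i b u * X (i + 1) a v) =
      (-q) • (X i a v * X (i + 1) b u + (-q)⁻¹ • (X i b v * X (i + 1) a u)) := by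
    intro u v a b huv hu hv hab hb
    have h1 := h a u b v
    have h2 := h a v b u
    simp only [off a b (by omega) (by omega), off u v hu (by omega), off v u hv (by omega),
      up a b hab, up u v huv, dn v u huv] at h1 h2
    linear_combination (norm := skip) (c i * (1 - q ^ 2))⁻¹ • h1 + (q * (c i * (1 - q ^ 2))⁻¹) • h2
    match_scalars <;> field_simp <;> ring
  rcases lt_trichotomy u v with huv | rfl | huv
  · exact ⟨-q, fun e => absurd e huv.ne, fun a b hab hb => main u v a b huv hu hv hab (by omega)⟩
  · refine ⟨0, fun _ => rfl, fun a b hab hb => ?_⟩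
    have h1 := h a u b u
    have z1 : evalForm (rho q M u u) (c i) (c i * q ^ 2) = 0 := by
      simp only [evalForm, rho, if_true, qt, if_pos hu]
      field_simp
      ring
    have z2 : evalForm (rex q u u) (c i) (c i * q ^ 2) = 0 := by simp [evalForm, rex]
    simp only [off a b (by omega) (by omega), up a b hab, z1, z2] at h1
    linear_combination (norm := skip) (c i * (1 - q ^ 2))⁻¹ • h1
    match_scalars <;> field_simp <;> ring
  · refine ⟨-q⁻¹, fun e => absurd e huv.ne', fun a b hab hb => ?_⟩
    have := main v u a b huv hv hu hab (by omega)
    linear_combination (norm := skip) (-q⁻¹) • this.symm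
    match_scalars <;> field_simp <;> ring

/-- For odd indices, the exchange relation at the points `c`, `c q⁻²` makes the rows of the inverse matrices quantum
antisymmetric. -/
lemma qAntisymm_rows {q : K} (hq : q ≠ 0) (hq2 : q ^ 2 ≠ 1) {M n : ℕ} {c : ℕ → K}
    (hc : ∀ i, c i ≠ 0) {X P : ℕ → ℕ → ℕ → S}
    (hX : ∀ i, M ≤ i → i + 1 < n → RZ q M (c i) (c i * (q ^ 2)⁻¹) (X i) (X (i + 1)))
    (hP : ∀ i, M ≤ i → i < n → IsInv n (X i) (P i)) {k l : ℕ} (hk : M ≤ k) (hl : k + l ≤ n) :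
    QAntisymm q l (fun u => M ≤ u ∧ u < n) (fun i a u => P (k + i) u (k + a)) := by
  intro i hi u v hu hv
  have hi1 : k + (i + 1) = k + i + 1 := rfl
  have h := fun a b c d ha hb hc hd => (hX (k + i) (by omega) (by omega)).inv_inv
    (hP (k + i) (by omega) (by omega)) (hP (k + i + 1) (by omega) (by omega)) (a := a) (b := b)
    (c := c) (d := d) ha hb hc hd
  have hδ : q ^ 2 - 1 ≠ 0 := sub_ne_zero.mpr hq2
  have hci := hc (k + i)
  set z := c (k + i) with hz
  -- The values of the coefficients at `w = z q⁻²`.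
  have off : ∀ a b, M ≤ a → M ≤ b → a ≠ b →
      evalForm (rho q M a b) z (z * (q ^ 2)⁻¹) = -(z * (1 - (q ^ 2)⁻¹)) := by
    intro a b ha hb hab
    simp only [evalForm, rho, if_neg hab, sg, if_pos (show M ≤ a ∧ M ≤ b by omega)]
    ring
  have up : ∀ a b, a < b → evalForm (rex q a b) z (z * (q ^ 2)⁻¹) = z * (q - q⁻¹) := by
    intro a b hab
    simp only [evalForm, rex, if_pos hab]
    ring
  have dn : ∀ a b, b < a →
      evalForm (rex q a b) z (z * (q ^ 2)⁻¹) = z * (q ^ 2)⁻¹ * (q - q⁻¹) := by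
    intro a b hab
    simp only [evalForm, rex, if_pos hab, if_neg (show ¬ a < b by omega)]
    ring
  have main : ∀ u v a b, u < v → M ≤ u → v < n → a < b → b < l →
      P (k + i) u (k + a) * P (k + (i + 1)) v (k + b) +
        (-q)⁻¹ • (P (k + i) u (k + b) * P (k + (i + 1)) v (k + a)) =
      (-q) • (P (k + i) v (k + a) * P (k + (i + 1)) u (k + b) +
        (-q)⁻¹ • (P (k + i) v (k + b) * P (k + (i + 1)) u (k + a))) := by
    intro u v a b huv hu hv hab hb
    rw [hi1]
    have h1 := h u (k + a) v (k + b) (by omega) (by omega) (by omega) (by omega)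
    have h2 := h v (k + a) u (k + b) (by omega) (by omega) (by omega) (by omega)
    simp only [off u v (by omega) (by omega) (by omega), off v u (by omega) (by omega) (by omega),
      off (k + a) (k + b) (by omega) (by omega) (by omega),
      up u v huv, dn v u huv, dn (k + b) (k + a) (by omega)] at h1 h2
    linear_combination (norm := skip) (z * (1 - (q ^ 2)⁻¹))⁻¹ • h1 +
      (q * (z * (1 - (q ^ 2)⁻¹))⁻¹) • h2
    match_scalars <;> field_simp <;> ring
  rcases lt_trichotomy u v with huv | rfl | huv
  · exact ⟨-q, fun e => absurd e huv.ne, fun a b hab hb => main u v a b huv hu.1 hv.2 hab hb⟩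
  · refine ⟨0, fun _ => rfl, fun a b hab hb => ?_⟩
    beta_reduce
    rw [hi1]
    have h1 := h u (k + a) u (k + b) (by omega) (by omega) (by omega) (by omega)
    have z1 : evalForm (rho q M u u) z (z * (q ^ 2)⁻¹) = 0 := by
      simp only [evalForm, rho, if_true, qt, if_neg (show ¬ u < M by omega)]
      field_simp
      ring
    have z2 : evalForm (rex q u u) z (z * (q ^ 2)⁻¹) = 0 := by simp [evalForm, rex]
    simp only [off (k + a) (k + b) (by omega) (by omega) (by omega), dn (k + b) (k + a) (by omega),
      z1, z2] at h1
    linear_combination (norm := skip) (z * (1 - (q ^ 2)⁻¹))⁻¹ • h1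
    match_scalars <;> field_simp <;> ring
  · refine ⟨-q⁻¹, fun e => absurd e huv.ne', fun a b hab hb => ?_⟩
    have := main v u a b huv hv.1 hu.2 hab hb
    linear_combination (norm := skip) (-q⁻¹) • this.symm
    match_scalars <;> field_simp <;> ring

/-- The leading quantum minor with rows and columns `0, …, m-1`. -/
def leadMinor (q : K) (X : ℕ → ℕ → ℕ → S) (m : ℕ) : S :=
  qdet q fun i a : Fin m => X i a i

/-- The quantum minor of the matrices `P` with rows and columns `k, …, k+l-1`. -/
def tailMinor (q : K) (P : ℕ → ℕ → ℕ → S) (k l : ℕ) : S :=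
  qdet q fun i c : Fin l => P (k + i) (k + i) (k + c)

/-- The vector of cofactors of the last column annihilates all other columns; multiplication by the inverse
of the last matrix gives the quotient of successive leading minors. -/
theorem leadMinor_succ_mul {q : K} {M m : ℕ} {X : ℕ → ℕ → ℕ → S} {N : ℕ → ℕ → S} (hm : m < M)
    (hT : QAntisymm q (m + 1) (· < M) X) (hN : IsInv (m + 1) (X m) N) :
    leadMinor q X (m + 1) * N m m = leadMinor q X m := by
  set f : Fin (m + 1) → S := lastCofactor q (fun (i : Fin m) (a : Fin (m + 1)) => X i a i) with hf
  have expand : ∀ j : Fin (m + 1), ∑ c, f c * X m c j =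
      if j = Fin.last m then leadMinor q X (m + 1) else 0 := by
    intro j
    have h1 := qdet_eq_sum_last q
      (fun (i a : Fin (m + 1)) => X i a (if (i : ℕ) = m then j else i))
    have h2 : (fun (i : Fin m) (a : Fin (m + 1)) =>
        X (i.castSucc : Fin (m + 1)) a (if ((i.castSucc : Fin (m + 1)) : ℕ) = m then (j : ℕ)
          else (i.castSucc : Fin (m + 1)))) = fun (i : Fin m) (a : Fin (m + 1)) => X i a i := by
      funext i a
      simp [i.2.ne]
    rw [h2] at h1
    simp only [Fin.val_last, if_true] at h1
    rw [← h1]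
    split_ifs with hj
    · unfold leadMinor
      congr 1
      funext i a
      split_ifs with hi
      · rw [hj, Fin.val_last, hi]
      · rfl
    · have hjm : (j : ℕ) < m := Fin.val_lt_last hj
      refine qdet_eq_zero_of_repeated q hT (m - j - 1) (fun i => if i = m then j else i) j ?_ ?_ ?_
      · intro i hi
        have : i < M := by omega
        have : (j : ℕ) < M := by omega
        split_ifs <;> assumption
      · omega
      · rw [if_neg hjm.ne, if_pos (by omega)]
  -- The sum of `f c X_{cj} N_{jm}` over `c` and `j`, evaluated in the two orders.
  have h3 : ∑ j : Fin (m + 1), (∑ c, f c * X m c j) * N j m = f (Fin.last m) := by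
    simp only [Finset.sum_mul]
    rw [Finset.sum_comm]
    simp only [mul_assoc, ← Finset.mul_sum]
    rw [Finset.sum_eq_single (Fin.last m)]
    · rw [Fin.sum_univ_eq_sum_range (fun j => X m (Fin.last m : Fin (m + 1)) j * N j m),
        hN.right _ (by simp) _ (by omega)]
      simp
    · intro c _ hc
      rw [Fin.sum_univ_eq_sum_range (fun j => X m c j * N j m), hN.right _ c.2 _ (by omega),
        if_neg (fun e => hc (Fin.ext (e.trans (Fin.val_last m).symm))), mul_zero]
    · simp
  simp only [expand] at h3
  rw [Finset.sum_eq_single (Fin.last m) (fun j _ hj => by rw [if_neg hj, zero_mul]) (by simp),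
    if_pos rfl, Fin.val_last] at h3
  rw [h3, hf, lastCofactor_last]
  rfl

/-- The quotient of successive minors of the inverse matrices: the corner inverse `N` of `X k` combines the
rows `k, k+1, …` of `P k` to a multiple of the first coordinate. -/
theorem tailMinor_succ {q : K} {M k l n : ℕ} {X P : ℕ → ℕ → ℕ → S} {N : ℕ → ℕ → S} (hk : M ≤ k)
    (hn : k + (l + 1) = n)
    (hT : QAntisymm q (l + 1) (fun u => M ≤ u ∧ u < n) (fun i a u => P (k + i) u (k + a)))
    (hP : IsInv n (X k) (P k)) (hN : IsInv (k + 1) (X k) N) :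
    tailMinor q P k (l + 1) = N k k * tailMinor q P (k + 1) l := by
  set f : Fin (l + 1) → S := headCofactor q
    (fun (i : Fin l) (a : Fin (l + 1)) => P (k + (i + 1)) (k + (i + 1)) (k + a)) with hf
  have expand : ∀ j < l + 1, ∑ c : Fin (l + 1), P k (k + j) (k + c) * f c =
      if j = 0 then tailMinor q P k (l + 1) else 0 := by
    intro j hjl
    have h1 := qdet_eq_sum_head q
      (fun (i a : Fin (l + 1)) => P (k + i) (if (i : ℕ) = 0 then k + j else k + i) (k + a))
    have h2 : (fun (i : Fin l) (a : Fin (l + 1)) =>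
        P (k + (i.succ : Fin (l + 1))) (if ((i.succ : Fin (l + 1)) : ℕ) = 0 then k + j
          else k + (i.succ : Fin (l + 1))) (k + a)) =
        fun (i : Fin l) (a : Fin (l + 1)) => P (k + (i + 1)) (k + (i + 1)) (k + a) := by
      funext i a
      simp
    rw [h2] at h1
    simp only [Fin.val_zero, if_true, add_zero] at h1
    rw [← h1]
    split_ifs with hj
    · unfold tailMinor
      congr 1
      funext i a
      split_ifs with hi
      · rw [hj, hi]
      · rfl
    · refine qdet_eq_zero_of_repeated q hT (j - 1) (fun i => if i = 0 then k + j else k + i) 0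
        ?_ ?_ ?_
      · intro i hi
        split_ifs <;> omega
      · omega
      · rw [if_pos rfl, if_neg (by omega)]
        omega
  -- The last row of `N`, multiplied by `X k` and by its inverse `P k`.
  have hrow : ∀ c < n, ∑ b ∈ Finset.range n, rowMul (k + 1) N (X k) k b * P k b c =
      if c < k + 1 then N k c else 0 := by
    intro c hc
    simp only [rowMul, Finset.sum_mul]
    rw [Finset.sum_comm]
    have : ∀ a ∈ Finset.range (k + 1), ∑ b ∈ Finset.range n, N k a * X k a b * P k b c =
        if a = c then N k a else 0 := by
      intro a ha
      simp only [mul_assoc, ← Finset.mul_sum]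
      rw [hP.right a (by have := Finset.mem_range.mp ha; omega) c hc]
      simp
    rw [Finset.sum_congr rfl this, Finset.sum_ite_eq']
    simp
  have h3 : ∑ c : Fin (l + 1), (∑ b ∈ Finset.range n, rowMul (k + 1) N (X k) k b * P k b (k + c)) * f c =
      N k k * f 0 := by
    rw [Finset.sum_eq_single 0]
    · rw [hrow _ (by simp; omega)]
      simp
    · intro c _ hc
      have : (c : ℕ) ≠ 0 := fun e => hc (Fin.ext e)
      rw [hrow _ (by omega), if_neg (by omega), zero_mul]
    · simp
  simp only [Finset.sum_mul, mul_assoc] at h3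
  rw [Finset.sum_comm] at h3
  simp only [← Finset.mul_sum] at h3
  rw [Finset.sum_eq_single k] at h3
  · have e0 := expand 0 (by omega)
    rw [if_pos rfl, add_zero] at e0
    rw [e0, hN.rowMul_left (by omega) (by omega), if_pos rfl, one_mul] at h3
    rw [h3, hf, headCofactor_zero]
    unfold tailMinor
    congr 2
    funext i c
    simp only [Fin.val_succ, add_assoc, add_comm 1]
  · intro b hb hbk
    rcases lt_or_gt_of_ne hbk with hlt | hlt
    · rw [hN.rowMul_left (by omega) (by omega), if_neg (by omega), zero_mul]
    · have hb' := Finset.mem_range.mp hb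
      have e0 := expand (b - k) (by omega)
      rw [if_neg (by omega), show k + (b - k) = b by omega] at e0
      rw [e0, mul_zero]
  · intro hh
    exact absurd (Finset.mem_range.mpr (by omega)) hh

end Minors

/-! ### Zero modes and corner inverses -/

section ZeroModes

variable {K : Type*} [Field K] {S : Type*} [Ring S] [Algebra K S]

/-- The diagonal coefficients `t_a` and `s_{ac}` (`a ≠ c`) of a constant `R`-matrix. -/
def diagCoeff (t : ℕ → K) (s : ℕ → ℕ → K) (a c : ℕ) : K := if a = c then t a else s a c

/-- The exchange relation with a constant upper triangular `R`-matrix, for an upper triangular `U`. -/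
structure UpperRel (t : ℕ → K) (s : ℕ → ℕ → K) (κ : K) (U X : ℕ → ℕ → S) : Prop where
  tri : ∀ i j, i < j → U j i = 0
  rel : RLL (diagCoeff t s) (diagCoeff t s) (fun a c => if a < c then κ else 0)
    (fun a c => if a < c then κ else 0) U X

/-- The exchange relation with a constant lower triangular `R`-matrix, for a lower triangular `V`. -/
structure LowerRel (t : ℕ → K) (s : ℕ → ℕ → K) (κ : K) (V X : ℕ → ℕ → S) : Prop where
  tri : ∀ i j, i < j → V i j = 0
  rel : RLL (diagCoeff t s) (diagCoeff t s) (fun a c => if c < a then κ else 0)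
    (fun a c => if c < a then κ else 0) V X

/-- The transposed matrix over the opposite ring. -/
def opT (X : ℕ → ℕ → S) (a b : ℕ) : Sᵐᵒᵖ := MulOpposite.op (X b a)

lemma IsInv.opT {m : ℕ} {X N : ℕ → ℕ → S} (h : IsInv m X N) : IsInv m (opT X) (opT N) := by
  constructor
  · intro i hi d hd
    have := congrArg MulOpposite.op (h.right d hd i hi)
    simp only [QBer.opT, ← MulOpposite.op_mul, ← Finset.op_sum]
    rw [this]
    rcases eq_or_ne i d with rfl | hne
    · simp
    · simp [hne, hne.symm]
  · intro i hi d hd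
    have := congrArg MulOpposite.op (h.left d hd i hi)
    simp only [QBer.opT, ← MulOpposite.op_mul, ← Finset.op_sum]
    rw [this]
    rcases eq_or_ne i d with rfl | hne
    · simp
    · simp [hne, hne.symm]

lemma LowerRel.opT {t : ℕ → K} {s : ℕ → ℕ → K} {κ : K} {V X : ℕ → ℕ → S}
    (h : LowerRel t s κ V X) : UpperRel t s κ (opT V) (opT X) := by
  refine ⟨fun i j hij => by simp [QBer.opT, h.tri i j hij], fun a b c d => ?_⟩
  have := congrArg MulOpposite.op (h.rel b a d c)
  simp only [MulOpposite.op_add, MulOpposite.op_smul, MulOpposite.op_mul] at this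
  exact this.symm

variable {t : ℕ → K} {s : ℕ → ℕ → K} {κ : K} {U V X : ℕ → ℕ → S}

/-- The last diagonal entry of a corner inverse moved past an arbitrary zero mode. -/
lemma UpperRel.inv_diag (h : UpperRel t s κ U X) {j : ℕ} {N : ℕ → ℕ → S} (hN : IsInv (j + 1) X N)
    (a b : ℕ) :
    diagCoeff t s a j • (N j j * U a b) = diagCoeff t s b j • (U a b * N j j) +
      ∑ d ∈ Finset.range (j + 1), (if d < b then κ else 0) •
        (rowMul (j + 1) N X j b * (U a d * N d j)) := by
  have := h.rel.inv_right hN (Nat.lt_succ_self j) (Nat.lt_succ_self j) a b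
  rw [Finset.sum_eq_zero, add_zero] at this
  · exact this
  · intro c hc
    have hc' := Finset.mem_range.mp hc
    split_ifs with hac
    · rw [hN.rowMul_right (by omega) (by omega), if_neg (by omega)]
      simp
    · simp

lemma UpperRel.diag_commute (h : UpperRel t s κ U X) (ht : ∀ a, t a ≠ 0)
    (hs : ∀ a b, s a b ≠ 0) {j : ℕ} {N : ℕ → ℕ → S} (hN : IsInv (j + 1) X N) (k : ℕ) :
    N j j * U k k = U k k * N j j := by
  have := h.inv_diag hN k k
  rw [Finset.sum_eq_zero, add_zero] at this
  · have hne : diagCoeff t s k j ≠ 0 := by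
      unfold diagCoeff
      split_ifs
      · exact ht _
      · exact hs _ _
    exact smul_right_injective S hne this
  · intro d _
    split_ifs with hd
    · simp [h.tri d k hd]
    · simp

/-- The zero mode `U_{k,k+1}` commutes up to signs with the corner inverses not ending at `k` or `k + 1`. -/
lemma UpperRel.far (h : UpperRel t s κ U X) {j : ℕ} {N : ℕ → ℕ → S} (hN : IsInv (j + 1) X N)
    {k : ℕ} (h1 : j ≠ k) (h2 : j ≠ k + 1) :
    s k j • (N j j * U k (k + 1)) = s (k + 1) j • (U k (k + 1) * N j j) := by
  have := h.inv_diag hN k (k + 1)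
  rw [Finset.sum_eq_zero, add_zero] at this
  · simpa [diagCoeff, h1.symm, h2.symm] using this
  · intro d hd
    have hd' := Finset.mem_range.mp hd
    split_ifs with hdk
    · rcases Nat.lt_or_ge d k with hlt | hge
      · simp [h.tri d k hlt]
      · rw [hN.rowMul_left (by omega) (by omega), if_neg (by omega)]
        simp
    · simp

/-- The entry above the last diagonal entry of a corner inverse, in terms of the next smaller corner. -/
lemma IsInv.succ_apply {k : ℕ} {N N' : ℕ → ℕ → S} (hN : IsInv (k + 1) X N)
    (hN' : IsInv (k + 2) X N') :
    N' k (k + 1) = -(rowMul (k + 1) N X k (k + 1) * N' (k + 1) (k + 1)) := by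
  have h1 : ∑ b ∈ Finset.range (k + 2), rowMul (k + 1) N X k b * N' b (k + 1) = 0 := by
    simp only [rowMul, Finset.sum_mul]
    rw [Finset.sum_comm]
    refine Finset.sum_eq_zero fun c hc => ?_
    have hc' := Finset.mem_range.mp hc
    simp only [mul_assoc, ← Finset.mul_sum]
    rw [hN'.right c (by omega) (k + 1) (by omega), if_neg (by omega), mul_zero]
  rw [Finset.sum_range_succ, Finset.sum_eq_single k] at h1
  · rw [hN.rowMul_left (by omega) (by omega), if_pos rfl, one_mul] at h1
    exact eq_neg_of_add_eq_zero_left h1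
  · intro b hb hbk
    rw [hN.rowMul_left (by omega) (Finset.mem_range.mp hb), if_neg (Ne.symm hbk), zero_mul]
  · simp

/-- The zero mode `U_{k,k+1}` and the last diagonal entry of the inverse of the corner of size `k + 1`. -/
lemma UpperRel.near_left (h : UpperRel t s κ U X) (ht : ∀ a, t a ≠ 0) (hsq : ∀ a b, s a b * s a b = 1)
    (hsymm : ∀ a b, s a b = s b a) {k : ℕ} {N : ℕ → ℕ → S} (hN : IsInv (k + 1) X N) :
    N k k * U k (k + 1) = s k (k + 1) • (((t k)⁻¹ • U k (k + 1) +
      κ • (U k k * rowMul (k + 1) N X k (k + 1))) * N k k) := by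
  have htk := ht k
  have hsk := hsq k (k + 1)
  have h1 := h.inv_diag hN k (k + 1)
  rw [Finset.sum_range_succ, Finset.sum_eq_zero] at h1
  swap
  · intro d hd
    simp [h.tri d k (Finset.mem_range.mp hd)]
  have hN1 : ∀ c ∈ Finset.range (k + 1),
      diagCoeff t s k c • (N k c * U k k) = t k • (U k k * N k c) := by
    intro c hc
    have hc' := Finset.mem_range.mp hc
    have := h.rel.inv_right hN (Nat.lt_succ_self k) hc' k k
    rw [Finset.sum_eq_zero, Finset.sum_eq_zero] at this
    · simpa [diagCoeff] using this
    · intro d _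
      split_ifs with hd
      · simp [h.tri d k hd]
      · simp
    · intro d hd
      have hd' := Finset.mem_range.mp hd
      rw [if_neg (by omega)]
      simp
  have hX1 : ∀ c ∈ Finset.range (k + 1),
      diagCoeff t s k c • (U k k * X c (k + 1)) = s k (k + 1) • (X c (k + 1) * U k k) := by
    intro c hc
    have hc' := Finset.mem_range.mp hc
    have := h.rel k k c (k + 1)
    simpa [diagCoeff, show ¬ k < c by omega] using this
  have heh : rowMul (k + 1) N X k (k + 1) * U k k =
      (s k (k + 1) * t k) • (U k k * rowMul (k + 1) N X k (k + 1)) := by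
    simp only [rowMul, Finset.sum_mul, Finset.mul_sum, Finset.smul_sum]
    refine Finset.sum_congr rfl fun c hc => ?_
    have e1 : N k c * (X c (k + 1) * U k k) =
        (s k (k + 1) * diagCoeff t s k c) • (N k c * (U k k * X c (k + 1))) := by
      rw [mul_smul, ← mul_smul_comm (diagCoeff t s k c), hX1 c hc, mul_smul_comm, smul_smul, hsk,
        one_smul]
    rw [mul_assoc, e1, mul_smul, ← mul_assoc, ← smul_mul_assoc (diagCoeff t s k c), hN1 c hc,
      mul_smul, smul_mul_assoc, mul_assoc]
  rw [if_pos (Nat.lt_succ_self k), ← mul_assoc, heh] at h1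
  simp only [diagCoeff, if_true, if_neg (Nat.succ_ne_self k), hsymm (k + 1) k, zero_add] at h1
  have h2 : N k k * U k (k + 1) = (t k)⁻¹ • t k • (N k k * U k (k + 1)) := by
    rw [smul_smul, inv_mul_cancel₀ htk, one_smul]
  rw [h2, h1]
  simp only [smul_add, add_mul, smul_mul_assoc, smul_smul]
  congr 2
  · ring
  · field_simp

/-- The zero mode `U_{k,k+1}` and the last diagonal entry of the inverse of the corner of size `k + 2`. -/
lemma UpperRel.near_right (h : UpperRel t s κ U X) (hsq : ∀ a b, s a b * s a b = 1) {k : ℕ}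
    {N N' : ℕ → ℕ → S} (hN : IsInv (k + 1) X N) (hN' : IsInv (k + 2) X N') :
    N' (k + 1) (k + 1) * U k (k + 1) = s k (k + 1) • ((t (k + 1) • U k (k + 1) -
      κ • (U k k * rowMul (k + 1) N X k (k + 1))) * N' (k + 1) (k + 1)) := by
  have h1 := h.inv_diag hN' k (k + 1)
  rw [Finset.sum_range_succ, Finset.sum_range_succ, Finset.sum_eq_zero] at h1
  swap
  · intro d hd
    simp [h.tri d k (Finset.mem_range.mp hd)]
  rw [hN'.rowMul_left (by omega) (by omega), if_pos rfl, if_pos (Nat.lt_succ_self k),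
    if_neg (lt_irrefl _), hN.succ_apply hN'] at h1
  simp only [diagCoeff, if_true, if_neg (Nat.succ_ne_self k).symm, zero_smul, add_zero, zero_add,
    one_mul] at h1
  have h2 : N' (k + 1) (k + 1) * U k (k + 1) =
      s k (k + 1) • s k (k + 1) • (N' (k + 1) (k + 1) * U k (k + 1)) := by
    rw [smul_smul, hsq, one_smul]
  rw [h2, h1]
  simp only [smul_add, sub_mul, smul_mul_assoc, smul_sub, mul_neg, smul_neg, mul_assoc]
  abel

/-- At a pair of neighbours of equal parity, the product of the two diagonal entries, with the parameters
of the two matrices in the ratio `t_k²`, commutes with the zero mode. -/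
theorem UpperRel.pair_commute {X' : ℕ → ℕ → S} (h : UpperRel t s κ U X) (h' : UpperRel t s κ U X')
    (ht : ∀ a, t a ≠ 0) (hs : ∀ a b, s a b ≠ 0) (hsq : ∀ a b, s a b * s a b = 1)
    (hsymm : ∀ a b, s a b = s b a) {k : ℕ} (htk : t (k + 1) = t k)
    {N N₁ N' : ℕ → ℕ → S} (hN : IsInv (k + 1) X N) (hN₁ : IsInv (k + 1) X' N₁)
    (hN' : IsInv (k + 2) X' N')
    (he : (s k (k + 1) * t k) • (N' (k + 1) (k + 1) * rowMul (k + 1) N X k (k + 1)) =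
      rowMul (k + 1) N₁ X' k (k + 1) * N' (k + 1) (k + 1)) :
    N' (k + 1) (k + 1) * N k k * U k (k + 1) = U k (k + 1) * (N' (k + 1) (k + 1) * N k k) := by
  have h1 := h.near_left ht hsq hsymm hN
  have h2 := h'.near_right hsq hN₁ hN'
  have h3 := h'.diag_commute ht hs hN' k
  have htk0 := ht k
  have hsk := hsq k (k + 1)
  rw [htk] at h2
  set y := U k (k + 1)
  set e := rowMul (k + 1) N X k (k + 1)
  set e' := rowMul (k + 1) N₁ X' k (k + 1)
  set n := N k k
  set n' := N' (k + 1) (k + 1)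
  set u := U k k
  have he' : n' * e = (s k (k + 1) * (t k)⁻¹) • (e' * n') := by
    rw [← he, smul_smul, show s k (k + 1) * (t k)⁻¹ * (s k (k + 1) * t k) =
      (s k (k + 1) * s k (k + 1)) * ((t k)⁻¹ * t k) by ring, hsk, inv_mul_cancel₀ htk0, one_mul,
      one_smul]
  have h4 : n' * (u * e) = (s k (k + 1) * (t k)⁻¹) • (u * (e' * n')) := by
    rw [← mul_assoc, h3, mul_assoc, he', mul_smul_comm]
  calc n' * n * y = n' * (n * y) := mul_assoc _ _ _
    _ = s k (k + 1) • (((t k)⁻¹ • (n' * y) + κ • (n' * (u * e))) * n) := by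
        rw [h1]
        simp only [mul_smul_comm, mul_add, add_mul, smul_mul_assoc, mul_assoc]
    _ = y * (n' * n) := by
        rw [h2, h4]
        simp only [smul_add, smul_sub, add_mul, sub_mul, smul_mul_assoc, smul_smul, mul_assoc]
        have c1 : s k (k + 1) * ((t k)⁻¹ * (s k (k + 1) * t k)) = 1 := by
          rw [show s k (k + 1) * ((t k)⁻¹ * (s k (k + 1) * t k)) =
            (s k (k + 1) * s k (k + 1)) * ((t k)⁻¹ * t k) by ring, hsk, inv_mul_cancel₀ htk0, one_mul]
        rw [c1, one_smul]
        have c2 : s k (k + 1) * ((t k)⁻¹ * (s k (k + 1) * κ)) =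
            s k (k + 1) * (κ * (s k (k + 1) * (t k)⁻¹)) := by ring
        rw [c2]
        abel

/-- At a pair of neighbours of opposite parity, the two diagonal entries transform the zero mode into the
same element, up to the sign. -/
theorem UpperRel.odd_pair (h : UpperRel t s κ U X) (ht : ∀ a, t a ≠ 0)
    (hsq : ∀ a b, s a b * s a b = 1) (hsymm : ∀ a b, s a b = s b a) {k : ℕ}
    (htk : t (k + 1) = -(t k)⁻¹) {N N' : ℕ → ℕ → S} (hN : IsInv (k + 1) X N)
    (hN' : IsInv (k + 2) X N') :
    ∃ Z, N k k * U k (k + 1) = Z * N k k ∧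
      N' (k + 1) (k + 1) * U k (k + 1) = -(Z * N' (k + 1) (k + 1)) := by
  refine ⟨s k (k + 1) • ((t k)⁻¹ • U k (k + 1) + κ • (U k k * rowMul (k + 1) N X k (k + 1))), ?_, ?_⟩
  · rw [h.near_left ht hsq hsymm hN, smul_mul_assoc]
  · rw [h.near_right hsq hN hN', htk, smul_mul_assoc, ← smul_neg]
    congr 1
    rw [← neg_mul]
    congr 1
    rw [neg_smul]
    abel

end ZeroModes

section PairRelation

variable {K : Type*} [Field K] {S : Type*} [Ring S] [Algebra K S]

lemma qt_sub_inv {q : K} (M a : ℕ) : qt q M a - (qt q M a)⁻¹ = q - q⁻¹ := by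
  unfold qt
  split_ifs
  · rfl
  · rw [inv_neg, inv_inv]; ring

lemma qt_ne_zero {q : K} (hq : q ≠ 0) (M a : ℕ) : qt q M a ≠ 0 := by
  unfold qt
  split_ifs
  · exact hq
  · simpa using hq

lemma sg_sq (M a c : ℕ) : sg K M a c * sg K M a c = 1 := by
  unfold sg; split_ifs <;> simp

lemma sg_symm (M a c : ℕ) : sg K M a c = sg K M c a := by
  unfold sg; simp only [and_comm]

lemma sg_ne_zero (M a c : ℕ) : sg K M a c ≠ 0 := by
  unfold sg; split_ifs <;> simp

variable {q : K} {M k : ℕ} {z : K} {X X' N N' N₁ N₁' : ℕ → ℕ → S}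

/-- The hypothesis `he` of `UpperRel.pair_commute`, from the entry `(k, k+1)`, `(k+1, k+1)` of the exchange relation of
the corner inverses of size `k + 2`. -/
lemma RZ.row_relation (hq : q ≠ 0) (hκ : q - q⁻¹ ≠ 0) (hz : z ≠ 0)
    (hk : qt q M (k + 1) = qt q M k) (h : RZ q M z (z * qt q M k ^ 2) X X')
    (hN : IsInv (k + 1) X N) (hN' : IsInv (k + 2) X N') (hN₁ : IsInv (k + 1) X' N₁)
    (hN₁' : IsInv (k + 2) X' N₁') (hu : IsUnit (N' (k + 1) (k + 1))) :
    (sg K M k (k + 1) * qt q M k) • (N₁' (k + 1) (k + 1) * rowMul (k + 1) N X k (k + 1)) =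
      rowMul (k + 1) N₁ X' k (k + 1) * N₁' (k + 1) (k + 1) := by
  have ht := qt_ne_zero hq M k
  have htt := qt_sub_inv (q := q) M k
  have h1 := h.inv_inv hN' hN₁' (a := k) (b := k + 1) (c := k + 1) (d := k + 1) (by omega) (by omega)
    (by omega) (by omega)
  simp only [evalForm, rho, rex, if_true, if_neg (Nat.succ_ne_self k).symm,
    if_pos (Nat.lt_succ_self k), if_neg (lt_irrefl (k + 1)), hk] at h1
  rw [hN.succ_apply hN', hN₁.succ_apply hN₁'] at h1
  set τ := qt q M k
  set σ := sg K M k (k + 1)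
  rw [← htt] at h1 hκ
  apply hu.mul_right_cancel
  simp only [smul_mul_assoc, mul_assoc, mul_neg, neg_mul, smul_neg] at h1 ⊢
  set A := N₁' (k + 1) (k + 1) * (rowMul (k + 1) N X k (k + 1) * N' (k + 1) (k + 1))
  set B := rowMul (k + 1) N₁ X' k (k + 1) * (N₁' (k + 1) (k + 1) * N' (k + 1) (k + 1))
  linear_combination (norm := skip) ((τ - τ⁻¹)⁻¹ * z⁻¹) • h1
  have hne : τ ^ 2 - 1 ≠ 0 := by
    intro e
    apply hκ
    field_simp
    simpa using e
  match_scalars <;> field_simp <;> ring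

/-- The hypothesis `he` of `UpperRel.pair_commute` for the transposed matrices. -/
lemma RZ.col_relation (hq : q ≠ 0) (hκ : q - q⁻¹ ≠ 0) (hz : z ≠ 0)
    (hk : qt q M (k + 1) = qt q M k) (h : RZ q M z (z * qt q M k ^ 2) X X')
    (hN : IsInv (k + 1) X N) (hN' : IsInv (k + 2) X N') (hN₁ : IsInv (k + 1) X' N₁)
    (hN₁' : IsInv (k + 2) X' N₁') (hu : IsUnit (N' (k + 1) (k + 1))) :
    (sg K M k (k + 1) * (qt q M k)⁻¹) • (rowMul (k + 1) X N (k + 1) k * N₁' (k + 1) (k + 1)) =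
      N₁' (k + 1) (k + 1) * rowMul (k + 1) X' N₁ (k + 1) k := by
  have ht := qt_ne_zero hq M k
  have htt := qt_sub_inv (q := q) M k
  have hop : ∀ {Y L L' : ℕ → ℕ → S}, IsInv (k + 1) Y L → IsInv (k + 2) Y L' →
      L' (k + 1) k = -(L' (k + 1) (k + 1) * rowMul (k + 1) Y L (k + 1) k) := by
    intro Y L L' hL hL'
    have := congrArg MulOpposite.unop (hL.opT.succ_apply hL'.opT)
    simpa [QBer.opT, rowMul] using this
  have h1 := h.inv_inv hN' hN₁' (a := k + 1) (b := k) (c := k + 1) (d := k + 1) (by omega) (by omega)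
    (by omega) (by omega)
  simp only [evalForm, rho, rex, if_true, if_neg (Nat.succ_ne_self k).symm,
    if_neg (show ¬ k + 1 < k by omega),
    if_pos (Nat.lt_succ_self k), if_neg (lt_irrefl (k + 1)), hk] at h1
  rw [hop hN hN', hop hN₁ hN₁'] at h1
  set τ := qt q M k
  set σ := sg K M k (k + 1)
  rw [← htt] at h1 hκ
  apply hu.mul_left_cancel
  simp only [mul_smul_comm, mul_assoc, mul_neg, neg_mul, smul_neg] at h1 ⊢
  linear_combination (norm := skip) (-((τ - τ⁻¹)⁻¹ * z⁻¹ * (τ⁻¹) ^ 2)) • h1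
  have hne : τ ^ 2 - 1 ≠ 0 := by
    intro e
    apply hκ
    field_simp
    simpa using e
  match_scalars <;> field_simp <;> ring

end PairRelation

/-! ### Generating series of an exchange algebra -/

section Data

variable {K : Type*} [Field K] {B : Type*} [Ring B] [Algebra K B]

/-- The coefficient of a linear form `p` at the variable which raises the mode of the second matrix:
a factor `z` lowers the power of `z⁻¹`, so clearing denominators in `L⁺` moves `z` to the second
variable. -/
def formSnd (ε : Sgn) (p : K × K) : K :=
  match ε with
  | .plus => p.1
  | .minus => p.2

/-- The coefficient of a linear form `p` at the variable which raises the mode of the first matrix. -/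
def formFst (ε : Sgn) (p : K × K) : K :=
  match ε with
  | .plus => p.2
  | .minus => p.1

/-- Multiplication of `∑ G_{rs} v^r u^s` by `α u + β v`. -/
def shiftMul (α β : K) (G : ℕ → ℕ → B) (r s : ℕ) : B :=
  β • (if r = 0 then 0 else G (r - 1) s) + α • (if s = 0 then 0 else G r (s - 1))

/-- Multiplication of `∑ G_{rs} v^r u^s` by `∑ ρ_k τ^k (uv)^k`. -/
def diagMul (ρ : K⟦X⟧) (τ : B) (G : ℕ → ℕ → B) (r s : ℕ) : B :=
  ∑ k ∈ Finset.range (min r s + 1), PowerSeries.coeff k ρ • (τ ^ k * G (r - k) (s - k))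

/-- The linear form `α z + β w` divided by `z`, as a series in `w / z`. -/
def lin (p : K × K) : K⟦X⟧ := PowerSeries.C p.1 + PowerSeries.C p.2 * PowerSeries.X

/-- Two families of modes `l⁺`, `l⁻` with triangular zero modes, satisfying the ungraded exchange relations
with `R`-matrix `R(z,w)` among themselves, and the relation with the `R`-matrices
`g(w τ / z) R(z, w τ) / z` and `g(w τ' / z) R(z, w τ') / z` between `l⁺` and `l⁻`. -/
structure ExchangeData (q : K) (M n : ℕ) (g : K⟦X⟧) (τ τ' : B) (l : Sgn → ℕ → ℕ → ℕ → B) : Prop where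
  upper : ∀ i j, i < j → l .plus 0 j i = 0
  lower : ∀ i j, i < j → l .minus 0 i j = 0
  diag_left : ∀ i < n, l .minus 0 i i * l .plus 0 i i = 1
  diag_right : ∀ i < n, l .plus 0 i i * l .minus 0 i i = 1
  same : ∀ ε a b c d r s,
    shiftMul (formSnd ε (rho q M a c)) (formFst ε (rho q M a c)) (fun r s => l ε r a b * l ε s c d) r s +
      shiftMul (formSnd ε (rex q a c)) (formFst ε (rex q a c)) (fun r s => l ε r c b * l ε s a d) r s =
    shiftMul (formSnd ε (rho q M b d)) (formFst ε (rho q M b d)) (fun r s => l ε s c d * l ε r a b) r s +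
      shiftMul (formSnd ε (rex q d b)) (formFst ε (rex q d b)) (fun r s => l ε s c b * l ε r a d) r s
  cross : ∀ a b c d r s,
    diagMul (g * lin (rho q M a c)) τ (fun r s => l .plus r a b * l .minus s c d) r s +
      diagMul (g * lin (rex q a c)) τ (fun r s => l .plus r c b * l .minus s a d) r s =
    diagMul (g * lin (rho q M b d)) τ' (fun r s => l .minus s c d * l .plus r a b) r s +
      diagMul (g * lin (rex q d b)) τ' (fun r s => l .minus s c b * l .plus r a d) r s
  central : ∀ x, Commute τ x
  central' : ∀ x, Commute τ' x
  unit : PowerSeries.constantCoeff g ≠ 0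

/-- The factor by which the substitution `z ↦ z c` multiplies the variable `z^{∓1}`. -/
def scale (ε : Sgn) (c : K) : K :=
  match ε with
  | .plus => c⁻¹
  | .minus => c

/-- The series `l^ε_{ab}(z c)` in the variable `z^{∓1}`. -/
def ser (l : Sgn → ℕ → ℕ → ℕ → B) (ε : Sgn) (c : K) (a b : ℕ) : B⟦X⟧ :=
  PowerSeries.mk fun r => scale ε c ^ r • l ε r a b

variable {q : K} {M n : ℕ} {g : K⟦X⟧} {τ τ' : B} {l : Sgn → ℕ → ℕ → ℕ → B}

lemma constantCoeff_lin (p : K × K) : PowerSeries.constantCoeff (lin p) = p.1 := by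
  simp [lin]

lemma diagMul_left_zero (ρ : K⟦X⟧) (t : B) (G : ℕ → ℕ → B) (s : ℕ) :
    diagMul ρ t G 0 s = PowerSeries.constantCoeff ρ • G 0 s := by
  simp [diagMul]

lemma diagMul_right_zero (ρ : K⟦X⟧) (t : B) (G : ℕ → ℕ → B) (r : ℕ) :
    diagMul ρ t G r 0 = PowerSeries.constantCoeff ρ • G r 0 := by
  simp [diagMul]

lemma rho_fst (q : K) (M a c : ℕ) : (rho q M a c).1 = diagCoeff (qt q M) (sg K M) a c := by
  unfold rho diagCoeff; split_ifs <;> rfl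

lemma rho_snd (q : K) (M a c : ℕ) :
    (rho q M a c).2 = -diagCoeff (fun a => (qt q M a)⁻¹) (sg K M) a c := by
  unfold rho diagCoeff; split_ifs <;> rfl

lemma rex_fst (q : K) (a c : ℕ) : (rex q a c).1 = if a < c then q - q⁻¹ else 0 := by
  unfold rex; split_ifs <;> rfl

lemma rex_snd (q : K) (a c : ℕ) : (rex q a c).2 = if c < a then q - q⁻¹ else 0 := by
  unfold rex; split_ifs <;> first | rfl | omega

/-- The zero modes of `l⁺` satisfy an exchange relation with a constant `R`-matrix: the relations are compared at the
lowest mode. -/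
lemma ExchangeData.zero_plus (h : ExchangeData q M n g τ τ' l) (ε : Sgn) (s : ℕ) :
    RLL (diagCoeff (qt q M) (sg K M)) (diagCoeff (qt q M) (sg K M))
      (fun a c => if a < c then q - q⁻¹ else 0) (fun a c => if a < c then q - q⁻¹ else 0)
      (l .plus 0) (l ε s) := by
  intro a b c d
  cases ε with
  | plus =>
    have := h.same .plus a b c d 0 (s + 1)
    simpa [shiftMul, formSnd, rho_fst, rex_fst] using this
  | minus =>
    have := h.cross a b c d 0 s
    simp only [diagMul_left_zero, map_mul, constantCoeff_lin, rho_fst, rex_fst, mul_smul, ← smul_add] at this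
    exact smul_right_injective B h.unit this

/-- The analogue of `ExchangeData.zero_plus` for the zero modes of `l⁻`. Against `l⁺` the zero mode occurs as the second
factor, and `RLL.swap` interchanges the factors. -/
lemma ExchangeData.zero_minus (hq : q ≠ 0) (h : ExchangeData q M n g τ τ' l) (ε : Sgn) (s : ℕ) :
    RLL (diagCoeff (fun a => (qt q M a)⁻¹) (sg K M)) (diagCoeff (fun a => (qt q M a)⁻¹) (sg K M))
      (fun a c => if c < a then -(q - q⁻¹) else 0) (fun a c => if c < a then -(q - q⁻¹) else 0)
      (l .minus 0) (l ε s) := by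
  cases ε with
  | minus =>
    intro a b c d
    have := h.same .minus a b c d 0 (s + 1)
    simp only [shiftMul, formSnd, if_true, smul_zero, zero_add, Nat.succ_ne_zero, if_false,
      Nat.add_sub_cancel, rho_snd, rex_snd] at this
    have e : ∀ a c : ℕ, (if c < a then -(q - q⁻¹) else 0) = -(if c < a then q - q⁻¹ else 0) := by
      intro a c; split_ifs <;> simp
    simp only [e]
    linear_combination (norm := module) (-1 : K) • this
  | plus =>
    have h0 : RLL (diagCoeff (qt q M) (sg K M)) (diagCoeff (qt q M) (sg K M))
        (fun a c => if a < c then q - q⁻¹ else 0) (fun a c => if a < c then q - q⁻¹ else 0)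
        (l .plus s) (l .minus 0) := by
      intro a b c d
      have := h.cross a b c d s 0
      simp only [diagMul_right_zero, map_mul, constantCoeff_lin, rho_fst, rex_fst, mul_smul,
        ← smul_add] at this
      exact smul_right_injective B h.unit this
    have hd : ∀ a b, diagCoeff (fun a => (qt q M a)⁻¹) (sg K M) a b =
        diagCoeff (fun a => (qt q M a)⁻¹) (sg K M) b a := by
      intro a b
      unfold diagCoeff
      rw [sg_symm]
      split_ifs with h1 h2 h2
      · rw [h1]
      · exact absurd h1.symm h2
      · exact absurd h2.symm h1
      · rfl
    have g1 : ∀ a b, diagCoeff (fun a => (qt q M a)⁻¹) (sg K M) a b *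
        diagCoeff (qt q M) (sg K M) a b = 1 := by
      intro a b
      unfold diagCoeff
      split_ifs
      · exact inv_mul_cancel₀ (qt_ne_zero hq M a)
      · exact sg_sq M a b
    have g2 : ∀ a b : ℕ, (if a < b then -(q - q⁻¹) else 0) * (if b < a then q - q⁻¹ else 0) = 0 := by
      intro a b
      split_ifs <;> first | omega | simp
    have g3 : ∀ a b : ℕ, diagCoeff (fun a => (qt q M a)⁻¹) (sg K M) a b *
        (if a < b then q - q⁻¹ else 0) + (if a < b then -(q - q⁻¹) else 0) *
        diagCoeff (qt q M) (sg K M) b a = 0 := by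
      intro a b
      unfold diagCoeff
      split_ifs <;> first | omega | (rw [sg_symm]; ring) | ring
    have := h0.swap (s := diagCoeff (fun a => (qt q M a)⁻¹) (sg K M))
      (s' := diagCoeff (fun a => (qt q M a)⁻¹) (sg K M))
      (y := fun a c => if a < c then -(q - q⁻¹) else 0)
      (y' := fun a c => if a < c then -(q - q⁻¹) else 0) (c := 1) (c' := 1)
      (fun a b => by rw [g1, g2, add_zero]) g3
      (fun a b => by rw [mul_comm, g1, mul_comm, g2, add_zero])
      (fun a b => by
        unfold diagCoeff
        split_ifs <;> first | omega | (rw [sg_symm]; ring) | ring)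
    simpa only [one_mul, ← hd] using this

lemma ExchangeData.upperRel (h : ExchangeData q M n g τ τ' l) (ε : Sgn) (c : K) :
    UpperRel (qt q M) (sg K M) (q - q⁻¹) (fun a b => PowerSeries.C (l .plus 0 a b)) (ser l ε c) := by
  refine ⟨fun i j hij => by rw [h.upper i j hij, map_zero], fun a b c' d => ?_⟩
  ext s
  have := h.zero_plus ε s a b c' d
  simp only [map_add, PowerSeries.coeff_smul, PowerSeries.coeff_C_mul, PowerSeries.coeff_mul_C, ser,
    PowerSeries.coeff_mk, mul_smul_comm, smul_mul_assoc]
  rw [smul_comm _ (scale ε c ^ s), smul_comm _ (scale ε c ^ s), smul_comm _ (scale ε c ^ s),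
    smul_comm _ (scale ε c ^ s), ← smul_add, ← smul_add, this]

lemma ExchangeData.lowerRel (hq : q ≠ 0) (h : ExchangeData q M n g τ τ' l) (ε : Sgn) (c : K) :
    LowerRel (fun a => (qt q M a)⁻¹) (sg K M) (-(q - q⁻¹))
      (fun a b => PowerSeries.C (l .minus 0 a b)) (ser l ε c) := by
  refine ⟨fun i j hij => by rw [h.lower i j hij, map_zero], fun a b c' d => ?_⟩
  ext s
  have := h.zero_minus hq ε s a b c' d
  simp only [map_add, PowerSeries.coeff_smul, PowerSeries.coeff_C_mul, PowerSeries.coeff_mul_C, ser,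
    PowerSeries.coeff_mk, mul_smul_comm, smul_mul_assoc]
  rw [smul_comm _ (scale ε c ^ s), smul_comm _ (scale ε c ^ s), smul_comm _ (scale ε c ^ s),
    smul_comm _ (scale ε c ^ s), ← smul_add, ← smul_add, this]

lemma sum_antidiagonal_shiftMul (α β x y : K) (G : ℕ → ℕ → B) (k : ℕ) :
    ∑ p ∈ Finset.HasAntidiagonal.antidiagonal (k + 1), (x ^ p.1 * y ^ p.2) • shiftMul α β G p.1 p.2 =
      (β * x + α * y) • ∑ p ∈ Finset.HasAntidiagonal.antidiagonal k, (x ^ p.1 * y ^ p.2) • G p.1 p.2 := by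
  simp only [shiftMul, smul_add, Finset.sum_add_distrib]
  rw [Finset.Nat.sum_antidiagonal_succ, Finset.Nat.sum_antidiagonal_succ']
  simp only [if_true, smul_zero, zero_add, Nat.succ_ne_zero, if_false, Nat.add_sub_cancel]
  rw [add_smul, Finset.smul_sum, Finset.smul_sum]
  congr 1 <;> refine Finset.sum_congr rfl fun p _ => ?_
  · rw [smul_smul, smul_smul]
    congr 1
    ring
  · rw [smul_smul, smul_smul]
    congr 1
    ring

lemma coeff_ser_mul_ser (ε : Sgn) (x y : K) (a b c d k : ℕ) :
    PowerSeries.coeff k (ser l ε x a b * ser l ε y c d) =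
      ∑ p ∈ Finset.HasAntidiagonal.antidiagonal k, (scale ε x ^ p.1 * scale ε y ^ p.2) • (l ε p.1 a b * l ε p.2 c d) := by
  rw [PowerSeries.coeff_mul]
  refine Finset.sum_congr rfl fun p _ => ?_
  simp only [ser, PowerSeries.coeff_mk, smul_mul_smul_comm]

lemma coeff_ser_mul_ser' (ε : Sgn) (x y : K) (a b c d k : ℕ) :
    PowerSeries.coeff k (ser l ε y c d * ser l ε x a b) =
      ∑ p ∈ Finset.HasAntidiagonal.antidiagonal k, (scale ε x ^ p.1 * scale ε y ^ p.2) • (l ε p.2 c d * l ε p.1 a b) := by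
  rw [coeff_ser_mul_ser, ← Finset.Nat.sum_antidiagonal_swap]
  refine Finset.sum_congr rfl fun p _ => ?_
  simp only [Prod.fst_swap, Prod.snd_swap, mul_comm]

/-- The values of a linear form in `z`, `w` are proportional to those of the linear form in `z^{∓1}`, `w^{∓1}` obtained
by clearing denominators. -/
lemma form_eval (ε : Sgn) {x y : K} (hx : x ≠ 0) (hy : y ≠ 0) :
    ∃ θ : K, θ ≠ 0 ∧ ∀ p, evalForm p x y =
      θ * (formFst ε p * scale ε x + formSnd ε p * scale ε y) := by
  cases ε with
  | plus =>
    refine ⟨x * y, mul_ne_zero hx hy, fun p => ?_⟩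
    simp only [evalForm, formFst, formSnd, scale]
    field_simp
    ring
  | minus =>
    refine ⟨1, one_ne_zero, fun p => ?_⟩
    simp [evalForm, formFst, formSnd, scale]

/-- Specialization of both variables of the exchange relation to multiples of the same variable `z`. -/
lemma ExchangeData.rz (h : ExchangeData q M n g τ τ' l) (ε : Sgn) {x y : K} (hx : x ≠ 0) (hy : y ≠ 0) :
    RZ q M x y (ser l ε x) (ser l ε y) := by
  intro a b c d
  obtain ⟨θ, hθ, he⟩ := form_eval ε hx hy
  ext k
  simp only [he, map_add, PowerSeries.coeff_smul, mul_smul]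
  rw [coeff_ser_mul_ser, coeff_ser_mul_ser, coeff_ser_mul_ser' ε x y, coeff_ser_mul_ser' ε x y,
    ← smul_add, ← smul_add]
  congr 1
  rw [← sum_antidiagonal_shiftMul _ _ _ _ (fun r s => l ε r a b * l ε s c d),
    ← sum_antidiagonal_shiftMul _ _ _ _ (fun r s => l ε r c b * l ε s a d),
    ← sum_antidiagonal_shiftMul _ _ _ _ (fun r s => l ε s c d * l ε r a b),
    ← sum_antidiagonal_shiftMul _ _ _ _ (fun r s => l ε s c b * l ε r a d),
    ← Finset.sum_add_distrib, ← Finset.sum_add_distrib]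
  refine Finset.sum_congr rfl fun p _ => ?_
  rw [← smul_add, ← smul_add]
  congr 1
  exact h.same ε a b c d p.1 p.2

/-- Corner blocks of the series are invertible, and the last diagonal entry of the inverse is a unit. -/
lemma ExchangeData.exists_inv (h : ExchangeData q M n g τ τ' l) (ε : Sgn) (c : K) {j : ℕ} (hj : j < n) :
    ∃ N, IsInv (j + 1) (ser l ε c) N ∧ IsUnit (N j j) := by
  set F : PowerSeries (Matrix (Idx (j + 1) 0) (Idx (j + 1) 0) B) :=
    PowerSeries.mk fun r => Matrix.of fun a b => scale ε c ^ r • l ε r a b with hF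
  have hFe : ∀ a b, entry F a b = ser l ε c a b := fun a b => by
    ext r
    simp [entry, hF, ser]
  have hunit : IsUnit F := by
    rw [PowerSeries.isUnit_iff_constantCoeff, ← PowerSeries.coeff_zero_eq_constantCoeff_apply]
    simp only [hF, PowerSeries.coeff_mk, pow_zero, one_smul]
    cases ε with
    | plus =>
      refine isUnit_of_triangular _ (fun i => (i : ℕ)) Fin.val_injective (fun i => i.isLt) ?_ ?_
      · intro a b hab
        exact h.upper _ _ hab
      · intro i
        exact ⟨⟨_, _, h.diag_right i (by omega), h.diag_left i (by omega)⟩, rfl⟩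
    | minus =>
      refine isUnit_of_triangular _ (fun i => j - (i : ℕ)) ?_ ?_ ?_ ?_
      · intro a b hab
        have := a.isLt
        have := b.isLt
        dsimp at hab
        exact Fin.ext (by omega)
      · intro i
        omega
      · intro a b hab
        exact h.lower _ _ (by omega)
      · intro i
        exact ⟨⟨_, _, h.diag_left i (by omega), h.diag_right i (by omega)⟩, rfl⟩
  obtain ⟨u, hu⟩ := hunit
  set G := ((u⁻¹ : (PowerSeries (Matrix (Idx (j + 1) 0) (Idx (j + 1) 0) B))ˣ) :
    PowerSeries (Matrix (Idx (j + 1) 0) (Idx (j + 1) 0) B)) with hG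
  have h1 : F * G = 1 := by rw [← hu]; exact u.mul_inv
  have h2 : G * F = 1 := by rw [← hu]; exact u.inv_mul
  set N : ℕ → ℕ → B⟦X⟧ := fun a b =>
    if hab : a < j + 1 ∧ b < j + 1 then entry G ⟨a, hab.1⟩ ⟨b, hab.2⟩ else 0 with hN
  have hNe : ∀ a b : Idx (j + 1) 0, N a b = entry G a b := fun a b => by
    simp only [hN]
    rw [dif_pos ⟨a.isLt, b.isLt⟩]
  have hinv : IsInv (j + 1) (ser l ε c) N := by
    constructor
    · intro i hi d hd
      have := congrArg (fun H => entry H (⟨i, hi⟩ : Idx (j + 1) 0) (⟨d, hd⟩ : Idx (j + 1) 0)) h2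
      simp only [entry_mul, entry_one, hFe, ← hNe, Fin.mk.injEq] at this
      rw [← this, Finset.sum_range]
    · intro i hi d hd
      have := congrArg (fun H => entry H (⟨i, hi⟩ : Idx (j + 1) 0) (⟨d, hd⟩ : Idx (j + 1) 0)) h1
      simp only [entry_mul, entry_one, hFe, ← hNe, Fin.mk.injEq] at this
      rw [← this, Finset.sum_range]
  refine ⟨N, hinv, ?_⟩
  rw [PowerSeries.isUnit_iff_constantCoeff]
  -- By triangularity the constant term of `N j j` is inverse to the zero mode.
  cases ε with
  | plus =>
    have := congrArg PowerSeries.constantCoeff (hinv.right j (by omega) j (by omega))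
    rw [map_sum, Finset.sum_range_succ, Finset.sum_eq_zero, if_pos rfl, map_mul, map_one,
      zero_add] at this
    · have h0 : PowerSeries.constantCoeff (ser l .plus c j j) = l .plus 0 j j := by simp [ser]
      rw [h0] at this
      have e : PowerSeries.constantCoeff (N j j) = l .minus 0 j j := by
        rw [← one_mul (PowerSeries.constantCoeff (N j j)), ← h.diag_left j hj, mul_assoc, this, mul_one]
      rw [e]
      exact ⟨⟨_, _, h.diag_left j hj, h.diag_right j hj⟩, rfl⟩
    · intro d hd
      have h0 : PowerSeries.constantCoeff (ser l .plus c j d) = l .plus 0 j d := by simp [ser]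
      rw [map_mul, h0, h.upper d j (Finset.mem_range.mp hd), zero_mul]
  | minus =>
    have := congrArg PowerSeries.constantCoeff (hinv.left j (by omega) j (by omega))
    rw [map_sum, Finset.sum_range_succ, Finset.sum_eq_zero, if_pos rfl, map_mul, map_one,
      zero_add] at this
    · have h0 : PowerSeries.constantCoeff (ser l .minus c j j) = l .minus 0 j j := by simp [ser]
      rw [h0] at this
      have e : PowerSeries.constantCoeff (N j j) = l .plus 0 j j := by
        rw [← mul_one (PowerSeries.constantCoeff (N j j)), ← h.diag_left j hj, ← mul_assoc, this, one_mul]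
      rw [e]
      exact ⟨⟨_, _, h.diag_right j hj, h.diag_left j hj⟩, rfl⟩
    · intro d hd
      have h0 : PowerSeries.constantCoeff (ser l .minus c d j) = l .minus 0 d j := by simp [ser]
      rw [map_mul, h0, h.lower d j (Finset.mem_range.mp hd), mul_zero]

end Data

/-! ### Series in two variables -/

section TwoVariables

lemma PowerSeries.commute_of_coeff {S : Type*} [Semiring S] {F G : S⟦X⟧}
    (h : ∀ i j, Commute (PowerSeries.coeff i F) (PowerSeries.coeff j G)) : Commute F G := by
  ext k
  rw [PowerSeries.coeff_mul, PowerSeries.coeff_mul, ← Finset.Nat.sum_antidiagonal_swap]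
  exact Finset.sum_congr rfl fun p _ => h _ _

variable {K : Type*} [Field K] {B : Type*} [Ring B] [Algebra K B]

/-- The series `∑ x_r v^r` in the outer variable `v`. -/
def outer (x : ℕ → B) : B⟦X⟧⟦X⟧ := PowerSeries.mk fun r => PowerSeries.C (x r)

lemma coeff_outer_mul (x : ℕ → B) (F : B⟦X⟧) (r : ℕ) :
    PowerSeries.coeff r (outer x * PowerSeries.C F) = PowerSeries.C (x r) * F := by
  rw [PowerSeries.coeff_mul_C, outer, PowerSeries.coeff_mk]

lemma coeff_mul_outer (x : ℕ → B) (F : B⟦X⟧) (r : ℕ) :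
    PowerSeries.coeff r (PowerSeries.C F * outer x) = F * PowerSeries.C (x r) := by
  rw [PowerSeries.coeff_C_mul, outer, PowerSeries.coeff_mk]

lemma coeff_coeff_outer_mul (x : ℕ → B) (F : B⟦X⟧) (r s : ℕ) :
    PowerSeries.coeff s (PowerSeries.coeff r (outer x * PowerSeries.C F)) =
      x r * PowerSeries.coeff s F := by
  rw [coeff_outer_mul, PowerSeries.coeff_C_mul]

lemma coeff_coeff_mul_outer (x : ℕ → B) (F : B⟦X⟧) (r s : ℕ) :
    PowerSeries.coeff s (PowerSeries.coeff r (PowerSeries.C F * outer x)) =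
      PowerSeries.coeff s F * x r := by
  rw [coeff_mul_outer, PowerSeries.coeff_mul_C]

/-- The central element `α u + β v`, where `u` is the inner and `v` the outer variable. -/
def linElt (B : Type*) [Ring B] [Algebra K B] (α β : K) : Subring.center (B⟦X⟧⟦X⟧) :=
  ⟨α • PowerSeries.C (PowerSeries.X : B⟦X⟧) + β • (PowerSeries.X : B⟦X⟧⟦X⟧), by
    rw [Subring.mem_center_iff]
    intro F
    rw [mul_add, add_mul]
    congr 1
    · rw [mul_smul_comm, smul_mul_assoc]
      congr 1
      ext r : 1
      rw [PowerSeries.coeff_mul_C, PowerSeries.coeff_C_mul]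
      exact PowerSeries.commute_X _
    · rw [mul_smul_comm, smul_mul_assoc]
      congr 1
      exact PowerSeries.commute_X _⟩

lemma coeff_linElt_smul (α β : K) (F : B⟦X⟧⟦X⟧) (r s : ℕ) :
    PowerSeries.coeff s (PowerSeries.coeff r (linElt B α β • F)) =
      shiftMul α β (fun r s => PowerSeries.coeff s (PowerSeries.coeff r F)) r s := by
  rw [Subring.smul_def, linElt, smul_eq_mul, add_mul, smul_mul_assoc, smul_mul_assoc, shiftMul,
    add_comm]
  simp only [map_add, PowerSeries.coeff_smul, PowerSeries.coeff_C_mul]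
  congr 2
  · cases r with
    | zero => simp
    | succ r => simp [PowerSeries.coeff_succ_X_mul]
  · cases s with
    | zero => simp
    | succ s => simp [PowerSeries.coeff_succ_X_mul]

lemma linElt_smul_cancel {α β : K} (hβ : β ≠ 0) {F G : B⟦X⟧⟦X⟧}
    (h : linElt B α β • F = linElt B α β • G) : F = G := by
  rw [← sub_eq_zero, ← smul_sub] at h
  rw [← sub_eq_zero]
  set H := F - G
  have key : ∀ s r, PowerSeries.coeff s (PowerSeries.coeff r H) = 0 := by
    intro s
    induction s with
    | zero =>
      intro r
      have := congrArg (fun F => PowerSeries.coeff 0 (PowerSeries.coeff (r + 1) F)) h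
      simp only [coeff_linElt_smul, shiftMul] at this
      simpa [hβ] using this
    | succ s ih =>
      intro r
      have := congrArg (fun F => PowerSeries.coeff (s + 1) (PowerSeries.coeff (r + 1) F)) h
      simp only [coeff_linElt_smul, shiftMul] at this
      simpa [hβ, ih] using this
  ext r s
  rw [key]
  simp

/-- The homomorphism `∑ ρ_k y^k ↦ ∑ ρ_k τ^k (u v)^k`, for a central element `τ`. -/
def evHom (K : Type*) [Field K] {B : Type*} [Ring B] [Algebra K B] (τ : B) (hτ : ∀ x, Commute τ x) :
    K⟦X⟧ →+* Subring.center (B⟦X⟧⟦X⟧) where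
  toFun ρ := ⟨PowerSeries.mk fun k => PowerSeries.monomial k (PowerSeries.coeff k ρ • τ ^ k), by
    rw [Subring.mem_center_iff]
    intro F
    refine (PowerSeries.commute_of_coeff fun i j => PowerSeries.commute_of_coeff fun i' j' => ?_).symm
    rw [PowerSeries.coeff_mk, PowerSeries.coeff_monomial]
    split_ifs
    · exact ((hτ _).pow_left i).smul_left _
    · exact Commute.zero_left _⟩
  map_one' := by
    ext k : 2
    simp only [PowerSeries.coeff_mk, Subring.coe_one, PowerSeries.coeff_one]
    split_ifs with hk
    · subst hk
      simp
    · simp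
  map_zero' := by
    ext k : 2
    simp
  map_add' ρ ρ' := by
    ext k : 2
    simp [add_smul]
  map_mul' ρ ρ' := by
    ext k : 2
    simp only [PowerSeries.coeff_mk, Subring.coe_mul, PowerSeries.coeff_mul,
      PowerSeries.monomial_mul_monomial, smul_mul_smul_comm, ← pow_add]
    rw [Finset.sum_smul, map_sum]
    refine Finset.sum_congr rfl fun p hp => ?_
    rw [Finset.HasAntidiagonal.mem_antidiagonal.mp hp]

lemma coeff_evHom_smul {τ : B} (hτ : ∀ x, Commute τ x) (ρ : K⟦X⟧) (F : B⟦X⟧⟦X⟧) (r s : ℕ) :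
    PowerSeries.coeff s (PowerSeries.coeff r (evHom K τ hτ ρ • F)) =
      diagMul ρ τ (fun r s => PowerSeries.coeff s (PowerSeries.coeff r F)) r s := by
  have hmon : ∀ (k : ℕ) (b : B) (G : B⟦X⟧), PowerSeries.coeff s (PowerSeries.monomial k b * G) =
      if k ≤ s then b * PowerSeries.coeff (s - k) G else 0 := by
    intro k b G
    have e : PowerSeries.monomial k b = PowerSeries.C b * PowerSeries.X ^ k := by
      ext i
      rw [PowerSeries.coeff_C_mul, PowerSeries.coeff_X_pow, PowerSeries.coeff_monomial]
      split_ifs <;> simp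
    rw [e, mul_assoc, PowerSeries.coeff_C_mul, PowerSeries.coeff_X_pow_mul']
    split_ifs <;> simp
  rw [Subring.smul_def, smul_eq_mul, PowerSeries.coeff_mul, map_sum,
    Finset.Nat.sum_antidiagonal_eq_sum_range_succ_mk]
  simp only [evHom, RingHom.coe_mk, MonoidHom.coe_mk, OneHom.coe_mk, PowerSeries.coeff_mk, hmon]
  rw [diagMul, ← Finset.sum_filter]
  have : (Finset.range r.succ).filter (fun k => k ≤ s) = Finset.range (min r s + 1) := by
    ext k
    simp only [Finset.mem_filter, Finset.mem_range]
    omega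
  rw [this]
  exact Finset.sum_congr rfl fun k _ => by rw [smul_mul_assoc]

lemma IsInv.map {S S' : Type*} [Ring S] [Ring S'] (f : S →+* S') {m : ℕ} {X N : ℕ → ℕ → S}
    (h : IsInv m X N) : IsInv m (fun a b => f (X a b)) (fun a b => f (N a b)) := by
  constructor
  · intro i hi d hd
    have := congrArg f (h.left i hi d hd)
    rw [map_sum] at this
    simp only [map_mul] at this
    rw [this]
    split_ifs <;> simp
  · intro i hi d hd
    have := congrArg f (h.right i hi d hd)
    rw [map_sum] at this
    simp only [map_mul] at this
    rw [this]
    split_ifs <;> simp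

end TwoVariables

/-! ### Diagonal entries of the corner inverses against the other entries -/

section Corner

variable {Λ : Type*} [CommRing Λ] {S : Type*} [Ring S] [Algebra Λ S]

/-- The last diagonal entry of the inverse of a corner block of `Y`, moved past an entry of the
corresponding block of `X`. -/
lemma RLL.corner {r r' x x' : ℕ → ℕ → Λ} {X Y N : ℕ → ℕ → S} (h : RLL r r' x x' X Y) {k : ℕ}
    (hN : IsInv (k + 1) Y N) {a b : ℕ} (ha : a ≤ k) (hb : b ≤ k)
    (hxa : a = k → ∀ c ≤ k, x a c = 0) (hxb : b = k → ∀ d ≤ k, x' d b = 0) :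
    r a k • (N k k * X a b) = r' b k • (X a b * N k k) := by
  have := h.inv_right hN (Nat.lt_succ_self k) (Nat.lt_succ_self k) a b
  rw [Finset.sum_eq_zero, Finset.sum_eq_zero, add_zero, add_zero] at this
  · exact this
  · intro d hd
    rw [hN.rowMul_left (by omega) (by omega)]
    split_ifs with e
    · rw [hxb e.symm d (Nat.le_of_lt_succ (Finset.mem_range.mp hd)), zero_smul]
    · rw [zero_mul, smul_zero]
  · intro c hc
    rw [hN.rowMul_right (by omega) (by omega)]
    split_ifs with e
    · rw [hxa e c (Nat.le_of_lt_succ (Finset.mem_range.mp hc)), zero_smul]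
    · rw [mul_zero, smul_zero]

/-- An element that commutes up to signs with the entries of a matrix commutes with the diagonal
entries of its inverse. -/
lemma IsInv.diag_commute_of_signs {K : Type*} [Field K] [Algebra K S] {m : ℕ} {X N : ℕ → ℕ → S}
    (hN : IsInv m X N) {e : ℕ → K} (he : ∀ a, e a * e a = 1) {y : S}
    (hy : ∀ a < m, ∀ b < m, e a • (y * X a b) = e b • (X a b * y)) {k : ℕ} (hk : k < m) :
    Commute (N k k) y := by
  have h1 : ∑ a ∈ Finset.range m, ∑ b ∈ Finset.range m,
      N k a * ((e a * e k) • (y * X a b)) * N b k = N k k * y := by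
    have : ∀ a ∈ Finset.range m, ∑ b ∈ Finset.range m, N k a * ((e a * e k) • (y * X a b)) * N b k =
        if a = k then N k k * y else 0 := by
      intro a ha
      have h2 : ∀ b ∈ Finset.range m, N k a * ((e a * e k) • (y * X a b)) * N b k =
          (e a * e k) • (N k a * y * (X a b * N b k)) := fun b _ => by
        simp only [mul_smul_comm, smul_mul_assoc, mul_assoc]
      rw [Finset.sum_congr rfl h2, ← Finset.smul_sum, ← Finset.mul_sum,
        hN.right a (Finset.mem_range.mp ha) k hk]
      split_ifs with hak
      · rw [hak, he, one_smul, mul_one]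
      · rw [mul_zero, smul_zero]
    rw [Finset.sum_congr rfl this, Finset.sum_ite_eq', if_pos (Finset.mem_range.mpr hk)]
  have h2 : ∑ a ∈ Finset.range m, ∑ b ∈ Finset.range m,
      N k a * ((e b * e k) • (X a b * y)) * N b k = y * N k k := by
    rw [Finset.sum_comm]
    have : ∀ b ∈ Finset.range m, ∑ a ∈ Finset.range m, N k a * ((e b * e k) • (X a b * y)) * N b k =
        if k = b then y * N k k else 0 := by
      intro b hb
      have h2 : ∀ a ∈ Finset.range m, N k a * ((e b * e k) • (X a b * y)) * N b k =
          (N k a * X a b) * ((e b * e k) • (y * N b k)) := fun a _ => by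
        simp only [mul_smul_comm, smul_mul_assoc, mul_assoc]
      rw [Finset.sum_congr rfl h2, ← Finset.sum_mul, hN.left k hk b (Finset.mem_range.mp hb)]
      split_ifs with hak
      · rw [← hak, he, one_smul, one_mul]
      · rw [zero_mul]
    rw [Finset.sum_congr rfl this, Finset.sum_ite_eq, if_pos (Finset.mem_range.mpr hk)]
  rw [Commute, SemiconjBy, ← h1, ← h2]
  refine Finset.sum_congr rfl fun a ha => Finset.sum_congr rfl fun b hb => ?_
  rw [mul_comm (e a), mul_comm (e b), mul_smul, mul_smul,
    hy a (Finset.mem_range.mp ha) b (Finset.mem_range.mp hb)]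

end Corner

section Data

variable {K : Type*} [Field K] {B : Type*} [Ring B] [Algebra K B]

lemma shiftMul_scale (α β σ : K) (G : ℕ → ℕ → B) (r s : ℕ) :
    shiftMul (α * σ) β (fun r s => σ ^ s • G r s) r s = σ ^ s • shiftMul α β G r s := by
  unfold shiftMul
  rw [smul_add]
  congr 1
  · split_ifs
    · simp
    · rw [smul_comm]
  · split_ifs with hs
    · simp
    · obtain ⟨s, rfl⟩ := Nat.exists_eq_succ_of_ne_zero hs
      simp only [Nat.succ_eq_add_one, Nat.add_sub_cancel, smul_smul]
      congr 1
      ring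

lemma diagMul_scale (ρ : K⟦X⟧) (σ : K) (t : B) (G : ℕ → ℕ → B) (r s : ℕ) :
    diagMul (PowerSeries.rescale σ ρ) t (fun r s => σ ^ s • G r s) r s =
      σ ^ s • diagMul ρ t G r s := by
  unfold diagMul
  rw [Finset.smul_sum]
  refine Finset.sum_congr rfl fun k hk => ?_
  have hk' : k ≤ s := by have := Finset.mem_range.mp hk; omega
  rw [PowerSeries.coeff_rescale, mul_smul_comm, smul_smul, smul_smul]
  congr 1
  rw [mul_right_comm, ← pow_add, Nat.add_sub_cancel' hk']

lemma diagMul_swap (ρ : K⟦X⟧) (t : B) (G : ℕ → ℕ → B) (r s : ℕ) :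
    diagMul ρ t (fun r s => G s r) r s = diagMul ρ t G s r := by
  unfold diagMul
  rw [min_comm]

lemma linElt_smul (e α β : K) (F : B⟦X⟧⟦X⟧) :
    linElt B (e * α) (e * β) • F = linElt B α β • (e • F) := by
  ext r s
  rw [coeff_linElt_smul, coeff_linElt_smul]
  unfold shiftMul
  split_ifs <;> simp only [smul_zero, PowerSeries.coeff_smul, mul_smul, zero_add, add_zero] <;>
    first
    | rw [smul_comm e α, smul_comm e β]
    | rw [smul_comm e α]
    | rw [smul_comm e β]

/-- The other sign. -/
def Sgn.opp : Sgn → Sgn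
  | .plus => .minus
  | .minus => .plus

variable {q : K} {M n : ℕ} {g : K⟦X⟧} {τ τ' : B} {l : Sgn → ℕ → ℕ → ℕ → B}

/-- The exchange relation of one sign, as a relation between series in two independent variables. -/
lemma ExchangeData.same_rll (h : ExchangeData q M n g τ τ' l) (ε : Sgn) (c₀ : K) :
    RLL (fun a c => linElt B (formSnd ε (rho q M a c) * scale ε c₀) (formFst ε (rho q M a c)))
      (fun a c => linElt B (formSnd ε (rho q M a c) * scale ε c₀) (formFst ε (rho q M a c)))
      (fun a c => linElt B (formSnd ε (rex q a c) * scale ε c₀) (formFst ε (rex q a c)))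
      (fun a c => linElt B (formSnd ε (rex q a c) * scale ε c₀) (formFst ε (rex q a c)))
      (fun a b => outer fun r => l ε r a b) (fun a b => PowerSeries.C (ser l ε c₀ a b)) := by
  intro a b c d
  ext r s
  simp only [map_add, coeff_linElt_smul, coeff_coeff_outer_mul, coeff_coeff_mul_outer,
    ser, PowerSeries.coeff_mk, mul_smul_comm, smul_mul_assoc]
  rw [shiftMul_scale _ _ _ (fun r s => l ε r a b * l ε s c d),
    shiftMul_scale _ _ _ (fun r s => l ε r c b * l ε s a d),
    shiftMul_scale _ _ _ (fun r s => l ε s c d * l ε r a b),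
    shiftMul_scale _ _ _ (fun r s => l ε s c b * l ε r a d), ← smul_add, ← smul_add,
    h.same ε a b c d r s]

lemma linElt_zero : linElt B (0 : K) 0 = 0 := by
  ext
  simp [linElt]

lemma form_zero (ε : Sgn) : formSnd ε ((0, 0) : K × K) = 0 ∧ formFst ε ((0, 0) : K × K) = 0 := by
  cases ε <;> exact ⟨rfl, rfl⟩

/-- `rho` is proportional to `z - w` off the diagonal, with a nonzero coefficient of either variable. -/
lemma form_rho_of_ne (ε : Sgn) :
    ∃ α β : K, β ≠ 0 ∧ ∀ (q : K) (M a c : ℕ), a ≠ c → formSnd ε (rho q M a c) = sg K M a c * α ∧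
      formFst ε (rho q M a c) = sg K M a c * β := by
  cases ε with
  | plus =>
    refine ⟨1, -1, by simp, fun q M a c hac => ?_⟩
    rw [rho, if_neg hac]
    simp [formSnd, formFst]
  | minus =>
    refine ⟨-1, 1, by simp, fun q M a c hac => ?_⟩
    rw [rho, if_neg hac]
    simp [formSnd, formFst]

/-- A diagonal entry of a corner inverse moved past an entry of the smaller corner: the same linear form occurs on both
sides and can be cancelled. -/
lemma ExchangeData.same_corner (h : ExchangeData q M n g τ τ' l) {ε : Sgn} {c₀ : K} {k : ℕ}
    {N : ℕ → ℕ → B⟦X⟧} (hN : IsInv (k + 1) (ser l ε c₀) N) {a b : ℕ} (ha : a < k) (hb : b < k) (r : ℕ) :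
    sg K M a k • (N k k * PowerSeries.C (l ε r a b)) =
      sg K M b k • (PowerSeries.C (l ε r a b) * N k k) := by
  have := (h.same_rll ε c₀).corner (hN.map PowerSeries.C) ha.le hb.le (by omega) (by omega)
  obtain ⟨α, β, hβ, hαβ⟩ := form_rho_of_ne (K := K) ε
  rw [(hαβ q M a k ha.ne).1, (hαβ q M a k ha.ne).2, (hαβ q M b k hb.ne).1, (hαβ q M b k hb.ne).2,
    mul_assoc, mul_assoc, linElt_smul, linElt_smul] at this
  have := congrArg (PowerSeries.coeff r) (linElt_smul_cancel hβ this)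
  rwa [PowerSeries.coeff_smul, PowerSeries.coeff_smul, coeff_mul_outer, coeff_outer_mul] at this

lemma ExchangeData.same_corner_zero (hq : q ≠ 0) (h : ExchangeData q M n g τ τ' l) {ε : Sgn} {c₀ : K}
    {k : ℕ} {N : ℕ → ℕ → B⟦X⟧} (hN : IsInv (k + 1) (ser l ε c₀) N) (r : ℕ) :
    N k k * PowerSeries.C (l ε r 0 0) = PowerSeries.C (l ε r 0 0) * N k k := by
  rcases Nat.eq_zero_or_pos k with rfl | hk
  · have hz : linElt B (formSnd ε (rex q 0 0) * scale ε c₀) (formFst ε (rex q 0 0)) = 0 := by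
      have e : rex q 0 0 = (0, 0) := by simp [rex]
      rw [e, (form_zero ε).1, (form_zero ε).2, zero_mul, linElt_zero]
    have := (h.same_rll ε c₀).corner (hN.map PowerSeries.C) (a := 0) (b := 0) le_rfl le_rfl
      (fun _ c hc => by obtain rfl := Nat.le_zero.mp hc; exact hz)
      (fun _ c hc => by obtain rfl := Nat.le_zero.mp hc; exact hz)
    have hne : formFst ε (rho q M 0 0) ≠ 0 := by
      have hqt := qt_ne_zero hq M 0
      cases ε <;> simpa [formFst, rho] using hqt
    have := congrArg (PowerSeries.coeff r) (linElt_smul_cancel hne this)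
    rwa [coeff_mul_outer, coeff_outer_mul] at this
  · exact smul_right_injective _ (sg_ne_zero M 0 k) (h.same_corner hN hk hk r)

/-- The last diagonal entries of the inverses of two successive corner blocks commute. -/
lemma ExchangeData.adjacent_commute (h : ExchangeData q M n g τ τ' l) {ε : Sgn} {c₀ c₁ : K}
    {k : ℕ} {N N' : ℕ → ℕ → B⟦X⟧} (hN : IsInv (k + 1) (ser l ε c₀) N)
    (hN' : IsInv (k + 2) (ser l ε c₁) N') : Commute (N k k) (N' (k + 1) (k + 1)) := by
  refine hN.diag_commute_of_signs (e := fun a => sg K M a (k + 1)) (fun a => sg_sq M a _)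
    (fun a ha b hb => ?_) (Nat.lt_succ_self k)
  ext t
  rw [PowerSeries.coeff_smul, PowerSeries.coeff_smul, PowerSeries.coeff_mul, PowerSeries.coeff_mul,
    ← Finset.Nat.sum_antidiagonal_swap, Finset.smul_sum, Finset.smul_sum]
  refine Finset.sum_congr rfl fun p _ => ?_
  have := congrArg (PowerSeries.coeff p.2) (h.same_corner hN' ha hb p.1)
  rw [PowerSeries.coeff_smul, PowerSeries.coeff_smul, PowerSeries.coeff_mul_C,
    PowerSeries.coeff_C_mul] at this
  simp only [ser, PowerSeries.coeff_mk, Prod.fst_swap, Prod.snd_swap, mul_smul_comm, smul_mul_assoc]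
  rw [smul_comm (sg K M a (k + 1)), smul_comm (sg K M b (k + 1)), this]

/-- `R(z,w)` and the `R`-matrix with exchanged arguments and tensor factors are inverse up to this scalar, divided by
`z²`. -/
def unitarity (q : K) : K⟦X⟧ := lin (q, -q⁻¹) * lin (-q⁻¹, q)

/-- The scalar occurring when a diagonal entry of a corner inverse of `L^ε` is moved past the entry `(0,0)` of the
series of the other sign. -/
def crossScalar (q : K) (M : ℕ) (g : K⟦X⟧) (ε : Sgn) (k : ℕ) : K⟦X⟧ :=
  match ε with
  | .plus => lin (rho q M k 0).swap * (g * unitarity q)⁻¹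
  | .minus => g * lin (rho q M 0 k)

lemma lin_mul_add (hq : q ≠ 0) (M a b : ℕ) :
    lin (rho q M a b).swap * lin (rho q M a b) + lin (rex q b a).swap * lin (rex q b a) = unitarity q := by
  have hC : ∀ x : K, x ≠ 0 → PowerSeries.C x * PowerSeries.C x⁻¹ = 1 := fun x hx => by
    rw [← map_mul, mul_inv_cancel₀ hx, map_one]
  have hqq := hC q hq
  have e : PowerSeries.C (-q⁻¹) = -PowerSeries.C q⁻¹ := map_neg _ _
  unfold unitarity lin rho rex qt sg
  split_ifs <;> first
    | omega
    | (simp only [Prod.fst_swap, Prod.snd_swap, map_sub, map_neg, map_zero, inv_neg, inv_inv,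
        neg_neg]
       grind)

lemma lin_mul_add' (q : K) (M a b : ℕ) :
    lin (rho q M a b).swap * lin (rex q a b) + lin (rex q b a).swap * lin (rho q M b a) = 0 := by
  unfold lin rho rex
  rw [sg_symm M b a]
  split_ifs <;> first
    | omega
    | (simp only [Prod.fst_swap, Prod.snd_swap, map_sub, map_neg, map_zero]
       ring)

lemma constantCoeff_unitarity (hq : q ≠ 0) : PowerSeries.constantCoeff (unitarity q) = -1 := by
  rw [unitarity, map_mul, constantCoeff_lin, constantCoeff_lin]
  field_simp

lemma ExchangeData.cross_rll_minus (h : ExchangeData q M n g τ τ' l) (σ : K) :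
    RLL (fun a c => evHom K τ h.central (PowerSeries.rescale σ (g * lin (rho q M a c))))
      (fun a c => evHom K τ' h.central' (PowerSeries.rescale σ (g * lin (rho q M a c))))
      (fun a c => evHom K τ h.central (PowerSeries.rescale σ (g * lin (rex q a c))))
      (fun a c => evHom K τ' h.central' (PowerSeries.rescale σ (g * lin (rex q a c))))
      (fun a b => outer fun r => l .plus r a b) (fun a b => PowerSeries.C (ser l .minus σ a b)) := by
  intro a b c d
  ext r s
  simp only [map_add, coeff_evHom_smul, coeff_coeff_outer_mul, coeff_coeff_mul_outer,
    ser, scale, PowerSeries.coeff_mk, mul_smul_comm, smul_mul_assoc]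
  rw [diagMul_scale _ _ _ (fun r s => l .plus r a b * l .minus s c d),
    diagMul_scale _ _ _ (fun r s => l .plus r c b * l .minus s a d),
    diagMul_scale _ _ _ (fun r s => l .minus s c d * l .plus r a b),
    diagMul_scale _ _ _ (fun r s => l .minus s c b * l .plus r a d), ← smul_add, ← smul_add,
    h.cross a b c d r s]

lemma ExchangeData.cross_rll_plus (h : ExchangeData q M n g τ τ' l) (c₀ : K) :
    RLL (fun a c => evHom K τ h.central (PowerSeries.rescale c₀⁻¹ (g * lin (rho q M a c))))
      (fun a c => evHom K τ' h.central' (PowerSeries.rescale c₀⁻¹ (g * lin (rho q M a c))))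
      (fun a c => evHom K τ h.central (PowerSeries.rescale c₀⁻¹ (g * lin (rex q a c))))
      (fun a c => evHom K τ' h.central' (PowerSeries.rescale c₀⁻¹ (g * lin (rex q a c))))
      (fun a b => PowerSeries.C (ser l .plus c₀ a b)) (fun a b => outer fun r => l .minus r a b) := by
  intro a b c d
  ext r s
  simp only [map_add, coeff_evHom_smul, coeff_coeff_outer_mul, coeff_coeff_mul_outer,
    ser, scale, PowerSeries.coeff_mk, mul_smul_comm, smul_mul_assoc]
  rw [diagMul_scale _ _ _ (fun r s => l .plus s a b * l .minus r c d),
    diagMul_scale _ _ _ (fun r s => l .plus s c b * l .minus r a d),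
    diagMul_scale _ _ _ (fun r s => l .minus r c d * l .plus s a b),
    diagMul_scale _ _ _ (fun r s => l .minus r c b * l .plus s a d), ← smul_add, ← smul_add,
    diagMul_swap _ _ (fun r s => l .plus r a b * l .minus s c d),
    diagMul_swap _ _ (fun r s => l .plus r c b * l .minus s a d),
    diagMul_swap _ _ (fun r s => l .minus s c d * l .plus r a b),
    diagMul_swap _ _ (fun r s => l .minus s c b * l .plus r a d), h.cross a b c d s r]

lemma rho_symm (q : K) (M a b : ℕ) : rho q M a b = rho q M b a := by
  unfold rho
  rw [sg_symm M b a]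
  split_ifs with h1 h2 h2
  · rw [h1]
  · exact absurd h1.symm h2
  · exact absurd h2.symm h1
  · rfl

lemma rex_zero_lin (q : K) : lin (rex q 0 0) = 0 ∧ lin (rex q 0 0).swap = 0 := by
  simp [rex, lin]

/-- The case `ε = +` of `cross_corner_zero` uses the exchange relation with the two tensor factors
interchanged. -/
lemma RLL.swap_corner {Λ : Type*} [CommRing Λ] {S : Type*} [Ring S] [Algebra Λ S] (hq : q ≠ 0)
    (hg : PowerSeries.constantCoeff g ≠ 0) {φ φ' : K⟦X⟧ →+* Λ} {X Y N : ℕ → ℕ → S}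
    (h : RLL (fun a c => φ (g * lin (rho q M a c))) (fun a c => φ' (g * lin (rho q M a c)))
      (fun a c => φ (g * lin (rex q a c))) (fun a c => φ' (g * lin (rex q a c))) X Y)
    {k : ℕ} (hN : IsInv (k + 1) X N) :
    φ (crossScalar q M g .plus k) • (N k k * Y 0 0) =
      φ' (crossScalar q M g .plus k) • (Y 0 0 * N k k) := by
  have key : ∀ ψ : K⟦X⟧ →+* Λ, ∀ a b,
      ψ (lin (rho q M a b).swap) * ψ (g * lin (rho q M a b)) +
        ψ (lin (rex q b a).swap) * ψ (g * lin (rex q b a)) = ψ (g * unitarity q) := by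
    intro ψ a b
    rw [← map_mul, ← map_mul, ← map_add, ← lin_mul_add hq M a b]
    congr 1
    ring
  have key' : ∀ ψ : K⟦X⟧ →+* Λ, ∀ a b,
      ψ (lin (rho q M a b).swap) * ψ (g * lin (rex q a b)) +
        ψ (lin (rex q b a).swap) * ψ (g * lin (rho q M b a)) = 0 := by
    intro ψ a b
    rw [← map_mul, ← map_mul, ← map_add, ← map_zero ψ, ← mul_zero g, ← lin_mul_add' q M a b]
    congr 1
    ring
  have hs := h.swap (s := fun a b => φ (lin (rho q M a b).swap))
    (s' := fun a b => φ' (lin (rho q M a b).swap)) (y := fun a b => φ (lin (rex q b a).swap))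
    (y' := fun a b => φ' (lin (rex q b a).swap)) (c := φ (g * unitarity q))
    (c' := φ' (g * unitarity q)) (key φ) (key' φ)
    (fun a b => by
      rw [← key φ' b a, rho_symm q M b a]
      ring)
    (fun a b => by
      have := key' φ' a b
      rw [rho_symm q M b a] at this ⊢
      linear_combination this)
  obtain ⟨-, e0⟩ := rex_zero_lin q
  have hc := hs.corner hN (Nat.zero_le k) (Nat.zero_le k)
    (by
      rintro rfl c hc
      obtain rfl := Nat.le_zero.mp hc
      simp only [e0, map_zero, mul_zero])
    (by
      rintro rfl c hc
      obtain rfl := Nat.le_zero.mp hc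
      simp only [e0, map_zero, mul_zero])
  have hu : ∀ ψ : K⟦X⟧ →+* Λ, ψ (g * unitarity q)⁻¹ * ψ (g * unitarity q) = 1 := by
    intro ψ
    rw [← map_mul, PowerSeries.inv_mul_cancel, map_one]
    rw [map_mul, constantCoeff_unitarity hq]
    simpa using hg
  have := congrArg (fun F => (φ (g * unitarity q)⁻¹ * φ' (g * unitarity q)⁻¹) • F) hc
  simp only [smul_smul] at this
  have a1 := hu φ
  have a2 := hu φ'
  rw [crossScalar, map_mul, map_mul]
  convert this using 2
  · linear_combination (-(φ (g * unitarity q)⁻¹ * φ (lin (rho q M k 0).swap))) * a2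
  · linear_combination (-(φ' (g * unitarity q)⁻¹ * φ' (lin (rho q M k 0).swap))) * a1

/-- The diagonal entries of corner inverses moved past the entry `(0,0)` of the series of the other sign; the scalar is
evaluated at the two central elements `τ` and `τ'`. -/
theorem ExchangeData.cross_corner_zero (hq : q ≠ 0) (h : ExchangeData q M n g τ τ' l) {ε : Sgn} {c₀ : K}
    {k : ℕ} {N : ℕ → ℕ → B⟦X⟧} (hN : IsInv (k + 1) (ser l ε c₀) N) :
    evHom K τ h.central (PowerSeries.rescale (scale ε c₀) (crossScalar q M g ε k)) •
        (PowerSeries.C (N k k) * outer fun r => l ε.opp r 0 0) =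
      evHom K τ' h.central' (PowerSeries.rescale (scale ε c₀) (crossScalar q M g ε k)) •
        ((outer fun r => l ε.opp r 0 0) * PowerSeries.C (N k k)) := by
  cases ε with
  | minus =>
    obtain ⟨e0, -⟩ := rex_zero_lin q
    have key := (h.cross_rll_minus c₀).corner (k := k) (N := fun a b => PowerSeries.C (N a b))
      (a := 0) (b := 0) (hN.map PowerSeries.C) (Nat.zero_le k) (Nat.zero_le k)
      (by
        rintro rfl c hc
        obtain rfl := Nat.le_zero.mp hc
        rw [e0, mul_zero, map_zero, map_zero])
      (by
        rintro rfl c hc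
        obtain rfl := Nat.le_zero.mp hc
        rw [e0, mul_zero, map_zero, map_zero])
    simp only [scale, crossScalar, Sgn.opp]
    exact key
  | plus =>
    have h1 := h.cross_rll_plus c₀
    simp only [← RingHom.comp_apply] at h1
    have key := RLL.swap_corner (φ := (evHom K τ h.central).comp (PowerSeries.rescale c₀⁻¹))
      (φ' := (evHom K τ' h.central').comp (PowerSeries.rescale c₀⁻¹)) hq h.unit h1
      (k := k) (N := fun a b => PowerSeries.C (N a b)) (hN.map PowerSeries.C)
    simp only [RingHom.comp_apply] at key
    simp only [scale, Sgn.opp]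
    exact key

end Data

/-! ### The product of the two minors -/

section SignedCommutation

variable {K : Type*} [Field K] {S : Type*} [Ring S] [Algebra K S]

/-- If the factors of a product commute with `y` up to signs, except for two successive factors for which only
their product is known to do so, then the product commutes with `y` up to the product of the signs. -/
lemma prod_mul_eq_smul {e : ℕ → S} {y : S} {χ : ℕ → K} {n k : ℕ}
    (hfar : ∀ j < n, j ≠ k → j ≠ k + 1 → e j * y = χ j • (y * e j))
    (hnear : e k * e (k + 1) * y = (χ k * χ (k + 1)) • (y * (e k * e (k + 1)))) (m : ℕ) (hm : m ≤ n)
    (hmk : m ≠ k + 1) :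
    ((List.range m).map e).prod * y =
      (∏ j ∈ Finset.range m, χ j) • (y * ((List.range m).map e).prod) := by
  induction m using Nat.strong_induction_on with
  | _ m ih =>
    cases m with
    | zero => simp
    | succ m =>
      rcases eq_or_ne m (k + 1) with rfl | h1
      · have := ih k (by omega) (by omega) (by omega)
        simp only [List.range_succ, List.map_append, List.map_cons, List.map_nil, List.prod_append,
          List.prod_singleton, Finset.prod_range_succ]
        rw [mul_assoc _ (e k), mul_assoc, hnear, mul_smul_comm, ← mul_assoc, this, smul_mul_assoc,
          smul_smul, mul_assoc y]
        congr 1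
        ring
      · have := ih m (by omega) (by omega) h1
        simp only [List.range_succ, List.map_append, List.map_cons, List.map_nil, List.prod_append,
          List.prod_singleton, Finset.prod_range_succ]
        rw [mul_assoc, hfar m (by omega) (by omega) (by omega), mul_smul_comm, ← mul_assoc, this,
          smul_mul_assoc, smul_smul, mul_assoc]
        congr 1
        ring

lemma units_inv_mul_eq_smul {u : Sˣ} {y : S} {χ : K} (hχ : χ * χ = 1)
    (h : (u : S) * y = χ • (y * u)) : (↑u⁻¹ : S) * y = χ • (y * ↑u⁻¹) := by
  have : y * (↑u⁻¹ : S) = χ • (↑u⁻¹ * y) := by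
    calc y * (↑u⁻¹ : S) = ↑u⁻¹ * (↑u * y) * ↑u⁻¹ := by rw [← mul_assoc, u.inv_mul, one_mul]
      _ = χ • (↑u⁻¹ * y) := by
        rw [h, mul_smul_comm, smul_mul_assoc, mul_assoc, mul_assoc, u.mul_inv, mul_one]
  rw [this, smul_smul, hχ, one_smul]

end SignedCommutation

section Data

variable {K : Type*} [Field K] {B : Type*} [Ring B] [Algebra K B]

/-- The factor of the Berezinian belonging to the index `k` has the argument `z q^{2k}` if `k < M`, and
`z q^{4M-2k-2}` otherwise; this is the quotient of the argument by `z`. -/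
def point (q : K) (M k : ℕ) : K := if k < M then q ^ (2 * k) else q ^ (4 * (M : ℤ) - 2 * k - 2)

/-- The units `u k` are the last diagonal entries of the inverses of the corner blocks of the matrices
`L^ε(z c)`, `c = point q M k`. -/
def CornerUnits (q : K) (M n : ℕ) (l : Sgn → ℕ → ℕ → ℕ → B) (ε : Sgn) (u : ℕ → (B⟦X⟧)ˣ) : Prop :=
  ∀ k < n, ∃ N, IsInv (k + 1) (ser l ε (point q M k)) N ∧ N k k = u k

/-- The factor of the Berezinian belonging to the index `k`: the unit `u k` if `k ≥ M`, and its inverse if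
`k < M`. -/
def factor (M : ℕ) (u : ℕ → (B⟦X⟧)ˣ) (k : ℕ) : B⟦X⟧ := if k < M then ↑(u k)⁻¹ else ↑(u k)

variable {q : K} {M n : ℕ} {g : K⟦X⟧} {τ τ' : B} {l : Sgn → ℕ → ℕ → ℕ → B} {ε : Sgn}
  {u : ℕ → (B⟦X⟧)ˣ}

lemma point_ne_zero (hq : q ≠ 0) (k : ℕ) : point q M k ≠ 0 := by
  unfold point
  split_ifs
  · exact pow_ne_zero _ hq
  · exact zpow_ne_zero _ hq

lemma point_succ (hq : q ≠ 0) {k : ℕ} (hk : k + 1 ≠ M) :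
    point q M (k + 1) = point q M k * qt q M k ^ 2 := by
  unfold point qt
  split_ifs
  · ring
  · omega
  · omega
  · rw [neg_sq, inv_pow, ← zpow_natCast, ← zpow_neg, ← zpow_add₀ hq]
    congr 1
    push_cast
    ring

lemma point_boundary (k : ℕ) : point q (k + 1) (k + 1) = point q (k + 1) k := by
  unfold point
  rw [if_neg (by omega), if_pos (by omega), ← zpow_natCast]
  congr 1
  push_cast
  ring

lemma ExchangeData.exists_cornerUnits (h : ExchangeData q M n g τ τ' l) (ε : Sgn) :
    ∃ u, CornerUnits q M n l ε u := by
  have : ∀ k, ∃ v : (B⟦X⟧)ˣ, k < n →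
      ∃ N, IsInv (k + 1) (ser l ε (point q M k)) N ∧ N k k = v := by
    intro k
    by_cases hk : k < n
    · obtain ⟨N, hN, v, hv⟩ := h.exists_inv ε (point q M k) hk
      exact ⟨v, fun _ => ⟨N, hN, hv.symm⟩⟩
    · exact ⟨1, fun hk' => absurd hk' hk⟩
  choose u hu using this
  exact ⟨u, hu⟩

lemma qt_succ {k : ℕ} (hk : k + 1 ≠ M) : qt q M (k + 1) = qt q M k := by
  unfold qt
  split_ifs <;> first | rfl | omega

lemma qt_boundary {k : ℕ} : qt q (k + 1) (k + 1) = -(qt q (k + 1) k)⁻¹ := by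
  unfold qt
  rw [if_neg (by omega), if_pos (by omega)]

/-- The sign by which the factor with index `j` commutes with the zero modes between `k` and `k+1`. -/
def sgnFactor (K : Type*) [Field K] (M k j : ℕ) : K := if k + 1 = M ∧ M ≤ j then -1 else 1

lemma sgnFactor_sq (M k j : ℕ) : sgnFactor K M k j * sgnFactor K M k j = 1 := by
  unfold sgnFactor; split_ifs <;> simp

lemma sg_mul_sg (M k j : ℕ) : sg K M k j * sg K M (k + 1) j = sgnFactor K M k j := by
  unfold sg sgnFactor
  split_ifs <;> first | omega | simp

lemma prod_sgnFactor {M n k : ℕ} (hM : M ≤ n) :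
    ∏ j ∈ Finset.range n, sgnFactor K M k j = if k + 1 = M then (-1) ^ (n - M) else 1 := by
  split_ifs with hk
  · obtain ⟨m, rfl⟩ := Nat.exists_eq_add_of_le hM
    rw [Nat.add_sub_cancel_left, Finset.prod_range_add, Finset.prod_eq_one, one_mul]
    · rw [Finset.prod_congr rfl fun j _ => show sgnFactor K M k (M + j) = -1 by
        unfold sgnFactor; rw [if_pos ⟨hk, by omega⟩]]
      simp
    · intro j hj
      unfold sgnFactor
      rw [if_neg (by have := Finset.mem_range.mp hj; omega)]
  · exact Finset.prod_eq_one fun j _ => by unfold sgnFactor; rw [if_neg (by omega)]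

/-- The product of all factors commutes with `l⁺_{k,k+1}` up to a sign: all factors but those of index `k` and `k + 1`
do, and so does the product of these two. -/
lemma ExchangeData.factor_zero_mode_upper (hq : q ≠ 0) (hκ : q - q⁻¹ ≠ 0)
    (h : ExchangeData q M n g τ τ' l) (hu : CornerUnits q M n l ε u) {k : ℕ} (hk : k + 1 < n) (hM : M ≤ n) :
    ((List.range n).map (factor M u)).prod * PowerSeries.C (l .plus 0 k (k + 1)) =
      (if k + 1 = M then (-1) ^ (n - M) else 1 : K) •
        (PowerSeries.C (l .plus 0 k (k + 1)) * ((List.range n).map (factor M u)).prod) := by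
  rw [← prod_sgnFactor hM]
  have hrel := fun c => h.upperRel ε c
  have ht := fun a => qt_ne_zero hq M a
  set y := PowerSeries.C (l .plus 0 k (k + 1)) with hy
  refine prod_mul_eq_smul (k := k) ?_ ?_ n le_rfl (by omega)
  · intro j hj h1 h2
    obtain ⟨N, hN, hNu⟩ := hu j hj
    have e := (hrel (point q M j)).far hN h1 h2
    rw [hNu] at e
    have e' : (u j : B⟦X⟧) * y = sgnFactor K M k j • (y * u j) := by
      rw [← sg_mul_sg, mul_smul, ← e, smul_smul, sg_sq, one_smul]
    unfold factor
    split_ifs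
    · exact units_inv_mul_eq_smul (sgnFactor_sq M k j) e'
    · exact e'
  · obtain ⟨N, hN, hNu⟩ := hu k (by omega)
    obtain ⟨N', hN', hNu'⟩ := hu (k + 1) hk
    have hadj := h.adjacent_commute hN hN'
    rw [hNu, hNu'] at hadj
    rcases eq_or_ne (k + 1) M with rfl | hkM
    · rw [point_boundary] at hN'
      obtain ⟨Z, e1, e2⟩ := (hrel (point q (k + 1) k)).odd_pair ht (sg_sq _) (sg_symm _) qt_boundary
        hN hN'
      rw [hNu, ← hy] at e1
      rw [hNu', ← hy] at e2
      simp only [factor, sgnFactor, if_pos (Nat.lt_succ_self k), if_neg (lt_irrefl (k + 1)), true_and,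
        if_neg (Nat.not_succ_le_self k), le_refl, if_true, one_mul, neg_smul, one_smul]
      have e3 : (↑(u k)⁻¹ : B⟦X⟧) * Z = y * ↑(u k)⁻¹ := by
        rw [Units.inv_mul_eq_iff_eq_mul, ← mul_assoc, e1, mul_assoc, (u k).mul_inv, mul_one]
      rw [mul_assoc, e2, mul_neg, ← mul_assoc, e3, mul_assoc]
    · have hs : sgnFactor K M k k * sgnFactor K M k (k + 1) = 1 := by
        simp [sgnFactor, hkM]
      rw [hs, one_smul]
      obtain ⟨N₁, hN₁, -⟩ := h.exists_inv ε (point q M (k + 1)) (show k < n by omega)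
      obtain ⟨N₂, hN₂, hu₂⟩ := h.exists_inv ε (point q M k) hk
      have he := RZ.row_relation hq hκ (point_ne_zero hq k) (qt_succ hkM)
        (by rw [← point_succ hq hkM]; exact h.rz ε (point_ne_zero hq _) (point_ne_zero hq _))
        hN hN₂ hN₁ hN' hu₂
      have e := (hrel (point q M k)).pair_commute (hrel (point q M (k + 1))) ht (sg_ne_zero M) (sg_sq M)
        (sg_symm M) (qt_succ hkM) hN hN₁ hN' he
      rw [hNu, hNu', ← hy] at e
      have e' : Commute ((u (k + 1) * u k : (B⟦X⟧)ˣ) : B⟦X⟧) y := by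
        rw [Units.val_mul]; exact e
      unfold factor
      split_ifs
      · have := e'.units_inv_left
        rwa [mul_inv_rev, Units.val_mul] at this
      · omega
      · omega
      · rw [← hadj.eq] at e
        exact e

/-- The analogue of `ExchangeData.factor_zero_mode_upper` for `l⁻_{k+1,k}`, by transposition. -/
lemma ExchangeData.factor_zero_mode_lower (hq : q ≠ 0) (hκ : q - q⁻¹ ≠ 0)
    (h : ExchangeData q M n g τ τ' l) (hu : CornerUnits q M n l ε u) {k : ℕ} (hk : k + 1 < n) (hM : M ≤ n) :
    ((List.range n).map (factor M u)).prod * PowerSeries.C (l .minus 0 (k + 1) k) =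
      (if k + 1 = M then (-1) ^ (n - M) else 1 : K) •
        (PowerSeries.C (l .minus 0 (k + 1) k) * ((List.range n).map (factor M u)).prod) := by
  rw [← prod_sgnFactor hM]
  have hrel := fun c => (h.lowerRel hq ε c).opT
  have ht : ∀ a, (qt q M a)⁻¹ ≠ 0 := fun a => inv_ne_zero (qt_ne_zero hq M a)
  set y := PowerSeries.C (l .minus 0 (k + 1) k) with hy
  refine prod_mul_eq_smul (k := k) ?_ ?_ n le_rfl (by omega)
  · intro j hj h1 h2
    obtain ⟨N, hN, hNu⟩ := hu j hj
    have e := congrArg MulOpposite.unop ((hrel (point q M j)).far hN.opT h1 h2)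
    simp only [opT, ← MulOpposite.op_mul, ← MulOpposite.op_smul, MulOpposite.unop_op, hNu, ← hy] at e
    have e' : (u j : B⟦X⟧) * y = sgnFactor K M k j • (y * u j) := by
      rw [← sg_mul_sg, mul_comm, mul_smul, e, smul_smul, sg_sq, one_smul]
    unfold factor
    split_ifs
    · exact units_inv_mul_eq_smul (sgnFactor_sq M k j) e'
    · exact e'
  · obtain ⟨N, hN, hNu⟩ := hu k (by omega)
    obtain ⟨N', hN', hNu'⟩ := hu (k + 1) hk
    have hadj := h.adjacent_commute hN hN'
    rw [hNu, hNu'] at hadj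
    rcases eq_or_ne (k + 1) M with rfl | hkM
    · rw [point_boundary] at hN'
      obtain ⟨Z, e1, e2⟩ := (hrel (point q (k + 1) k)).odd_pair ht (sg_sq _) (sg_symm _)
        (by rw [qt_boundary, inv_neg]) hN.opT hN'.opT
      obtain ⟨Z, rfl⟩ := MulOpposite.op_surjective Z
      have e1 := congrArg MulOpposite.unop e1
      have e2 := congrArg MulOpposite.unop e2
      simp only [opT, ← MulOpposite.op_mul, ← MulOpposite.op_neg, MulOpposite.unop_op, hNu, hNu',
        ← hy] at e1 e2
      simp only [factor, sgnFactor, if_pos (Nat.lt_succ_self k), if_neg (lt_irrefl (k + 1)), true_and,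
        if_neg (Nat.not_succ_le_self k), le_refl, if_true, one_mul, neg_smul, one_smul]
      have e3 : Z * (↑(u k)⁻¹ : B⟦X⟧) = ↑(u k)⁻¹ * y := by
        rw [Units.mul_inv_eq_iff_eq_mul, mul_assoc, e1, ← mul_assoc, (u k).inv_mul, one_mul]
      rw [hadj.units_inv_left.eq, ← mul_assoc, e2, neg_mul, neg_neg, mul_assoc, mul_assoc, e3]
    · have hs : sgnFactor K M k k * sgnFactor K M k (k + 1) = 1 := by
        simp [sgnFactor, hkM]
      rw [hs, one_smul]
      obtain ⟨N₁, hN₁, -⟩ := h.exists_inv ε (point q M (k + 1)) (show k < n by omega)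
      obtain ⟨N₂, hN₂, hu₂⟩ := h.exists_inv ε (point q M k) hk
      have he := RZ.col_relation hq hκ (point_ne_zero hq k) (qt_succ hkM)
        (by rw [← point_succ hq hkM]; exact h.rz ε (point_ne_zero hq _) (point_ne_zero hq _))
        hN hN₂ hN₁ hN' hu₂
      have e := (hrel (point q M k)).pair_commute (hrel (point q M (k + 1))) ht (sg_ne_zero M) (sg_sq M)
        (sg_symm M) (by rw [qt_succ hkM]) hN.opT hN₁.opT hN'.opT (by
          have := congrArg MulOpposite.op he
          simp only [opT, rowMul, ← MulOpposite.op_mul, ← MulOpposite.op_smul, ← Finset.op_sum]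
          exact this)
      have e := congrArg MulOpposite.unop e
      simp only [opT, ← MulOpposite.op_mul, MulOpposite.unop_op, hNu, hNu', ← hy] at e
      have e' : Commute ((u k * u (k + 1) : (B⟦X⟧)ˣ) : B⟦X⟧) y := by
        rw [Units.val_mul]; exact e.symm
      unfold factor
      split_ifs
      · have := e'.units_inv_left
        rw [mul_inv_rev, Units.val_mul] at this
        rw [(hadj.units_inv_left.units_inv_right).eq]
        exact this
      · omega
      · omega
      · exact e.symm

lemma ExchangeData.factor_zero_mode_diag (hq : q ≠ 0) (h : ExchangeData q M n g τ τ' l)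
    (hu : CornerUnits q M n l ε u) (k : ℕ) :
    Commute ((List.range n).map (factor M u)).prod (PowerSeries.C (l .plus 0 k k)) := by
  refine Commute.list_prod_left _ _ fun x hx => ?_
  obtain ⟨j, hj, rfl⟩ := List.mem_map.mp hx
  obtain ⟨N, hN, hNu⟩ := hu j (List.mem_range.mp hj)
  have := (h.upperRel ε (point q M j)).diag_commute (qt_ne_zero hq M) (sg_ne_zero M) hN k
  rw [hNu] at this
  unfold factor
  split_ifs
  · exact Commute.units_inv_left this
  · exact this

lemma ExchangeData.factor_same (hq : q ≠ 0) (h : ExchangeData q M n g τ τ' l)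
    (hu : CornerUnits q M n l ε u) (r : ℕ) :
    Commute ((List.range n).map (factor M u)).prod (PowerSeries.C (l ε r 0 0)) := by
  refine Commute.list_prod_left _ _ fun x hx => ?_
  obtain ⟨j, hj, rfl⟩ := List.mem_map.mp hx
  obtain ⟨N, hN, hNu⟩ := hu j (List.mem_range.mp hj)
  have := h.same_corner_zero hq hN r
  rw [hNu] at this
  unfold factor
  split_ifs
  · exact Commute.units_inv_left this
  · exact this

/-- The series `ρ` for which the factor `e` of the Berezinian with index `k` satisfies `ρ(τ) e y = ρ(τ') y e`, where
`y` is the entry `(0,0)` of the series of the other sign. -/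
def factorScalar (q : K) (M : ℕ) (g : K⟦X⟧) (ε : Sgn) (k : ℕ) : K⟦X⟧ :=
  if k < M then (PowerSeries.rescale (scale ε (point q M k)) (crossScalar q M g ε k))⁻¹
  else PowerSeries.rescale (scale ε (point q M k)) (crossScalar q M g ε k)

lemma constantCoeff_rescale (c : K) (F : K⟦X⟧) :
    PowerSeries.constantCoeff (PowerSeries.rescale c F) = PowerSeries.constantCoeff F := by
  rw [← PowerSeries.coeff_zero_eq_constantCoeff_apply, PowerSeries.coeff_rescale, pow_zero, one_mul,
    PowerSeries.coeff_zero_eq_constantCoeff_apply]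

lemma constantCoeff_crossScalar_ne_zero (hq : q ≠ 0) (hg : PowerSeries.constantCoeff g ≠ 0) (k : ℕ) :
    PowerSeries.constantCoeff (crossScalar q M g ε k) ≠ 0 := by
  have hqt := qt_ne_zero hq M k
  have hqt' := qt_ne_zero hq M 0
  have hsg := sg_ne_zero (K := K) M k 0
  have hsg' := sg_ne_zero (K := K) M 0 k
  cases ε with
  | plus =>
    rw [crossScalar, map_mul, constantCoeff_lin, PowerSeries.constantCoeff_inv, map_mul,
      constantCoeff_unitarity hq]
    refine mul_ne_zero ?_ (inv_ne_zero (mul_ne_zero hg (by simp)))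
    unfold rho
    split_ifs <;> simpa
  | minus =>
    rw [crossScalar, map_mul, constantCoeff_lin]
    refine mul_ne_zero hg ?_
    unfold rho
    split_ifs <;> simpa

lemma constantCoeff_factorScalar_ne_zero (hq : q ≠ 0) (hg : PowerSeries.constantCoeff g ≠ 0) (k : ℕ) :
    PowerSeries.constantCoeff (factorScalar q M g ε k) ≠ 0 := by
  have := constantCoeff_crossScalar_ne_zero (M := M) (ε := ε) hq hg k
  unfold factorScalar
  split_ifs
  · rw [PowerSeries.constantCoeff_inv, constantCoeff_rescale]
    exact inv_ne_zero this
  · rwa [constantCoeff_rescale]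

section Scalars

variable {R Λ S : Type*} [CommRing R] [CommRing Λ] [Ring S] [Algebra Λ S] {φ φ' : R →+* Λ} {y : S}

/-- Relations `ρ(τ) e y = ρ(τ') y e` multiply. -/
lemma prod_smul_mul_eq {e : ℕ → S} {r : ℕ → R} {n : ℕ}
    (h : ∀ j < n, φ (r j) • (e j * y) = φ' (r j) • (y * e j)) (m : ℕ) (hm : m ≤ n) :
    φ (∏ j ∈ Finset.range m, r j) • (((List.range m).map e).prod * y) =
      φ' (∏ j ∈ Finset.range m, r j) • (y * ((List.range m).map e).prod) := by
  induction m with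
  | zero => simp
  | succ m ih =>
    simp only [List.range_succ, List.map_append, List.map_cons, List.map_nil, List.prod_append,
      List.prod_singleton, Finset.prod_range_succ, map_mul]
    rw [mul_assoc, mul_smul, ← mul_smul_comm, h m (by omega), mul_smul_comm, smul_comm, ← mul_assoc,
      ← smul_mul_assoc, ih (by omega), smul_mul_assoc, smul_smul, mul_assoc, mul_comm (φ' _)]

lemma smul_units_inv_mul_eq {u : Sˣ} {r s : R} (hrs : s * r = 1)
    (h : φ r • ((u : S) * y) = φ' r • (y * u)) :
    φ s • ((↑u⁻¹ : S) * y) = φ' s • (y * ↑u⁻¹) := by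
  have h1 : φ r • (y * (↑u⁻¹ : S)) = φ' r • (↑u⁻¹ * y) := by
    calc φ r • (y * (↑u⁻¹ : S)) = ↑u⁻¹ * (φ r • (↑u * y)) * ↑u⁻¹ := by
          rw [mul_smul_comm, smul_mul_assoc, ← mul_assoc, u.inv_mul, one_mul]
      _ = φ' r • (↑u⁻¹ * y) := by
        rw [h, mul_smul_comm, smul_mul_assoc, mul_assoc, mul_assoc, u.mul_inv, mul_one]
  have e := congrArg (fun F => (φ s * φ' s) • F) h1
  simp only [smul_smul] at e
  rw [show φ s * φ' s * φ r = φ' s by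
      rw [mul_right_comm, ← map_mul, hrs, map_one, one_mul],
    show φ s * φ' s * φ' r = φ s by rw [mul_assoc, ← map_mul, hrs, map_one, mul_one]] at e
  exact e.symm

end Scalars

/-- The product of all factors commutes with the entry `(0,0)` of the series of the other sign if the product of the
scalars has the same value at `τ` and `τ'`. -/
lemma ExchangeData.factor_cross (hq : q ≠ 0) (h : ExchangeData q M n g τ τ' l)
    (hu : CornerUnits q M n l ε u)
    (hQ : evHom K τ h.central (∏ k ∈ Finset.range n, factorScalar q M g ε k) =
      evHom K τ' h.central' (∏ k ∈ Finset.range n, factorScalar q M g ε k)) (r : ℕ) :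
    Commute ((List.range n).map (factor M u)).prod (PowerSeries.C (l ε.opp r 0 0)) := by
  have key := prod_smul_mul_eq (φ := evHom K τ h.central) (φ' := evHom K τ' h.central')
    (y := outer fun r => l ε.opp r 0 0) (e := fun k => PowerSeries.C (factor M u k))
    (r := factorScalar q M g ε) (n := n) (by
      intro j hj
      obtain ⟨N, hN, hNu⟩ := hu j hj
      have := h.cross_corner_zero hq hN
      rw [hNu] at this
      unfold factor factorScalar
      split_ifs
      · refine smul_units_inv_mul_eq (u := Units.map (PowerSeries.C (R := B⟦X⟧)).toMonoidHom (u j))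
          (PowerSeries.inv_mul_cancel _ ?_) this
        rw [constantCoeff_rescale]
        exact constantCoeff_crossScalar_ne_zero hq h.unit j
      · exact this) n le_rfl
  set Q := ∏ k ∈ Finset.range n, factorScalar q M g ε k with hQdef
  have hQ0 : PowerSeries.constantCoeff Q ≠ 0 := by
    rw [hQdef, map_prod]
    exact Finset.prod_ne_zero_iff.mpr fun k _ => constantCoeff_factorScalar_ne_zero hq h.unit k
  rw [← hQ] at key
  have e := congrArg (fun F => evHom K τ h.central Q⁻¹ • F) key
  simp only [smul_smul] at e
  rw [← map_mul, PowerSeries.inv_mul_cancel _ hQ0, map_one, one_smul, one_smul,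
    show ((List.range n).map fun k => PowerSeries.C (factor M u k)) =
      ((List.range n).map (factor M u)).map (PowerSeries.C (R := B⟦X⟧)) by rw [List.map_map]; rfl,
    ← map_list_prod] at e
  have := congrArg (PowerSeries.coeff r) e
  rwa [coeff_mul_outer, coeff_outer_mul] at this

lemma leadMinor_zero (X : ℕ → ℕ → ℕ → B) : leadMinor q X 0 = 1 := by
  simp [leadMinor, qdet, permLength]

lemma tailMinor_zero (P : ℕ → ℕ → ℕ → B) (k : ℕ) : tailMinor q P k 0 = 1 := by
  simp [tailMinor, qdet, permLength]

/-- The product of the two quantum minors is the ordered product of the diagonal entries of corner inverses, or their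
inverses: these are the quotients of successive minors, by `leadMinor_succ_mul` and `tailMinor_succ`. -/
theorem ExchangeData.minors_eq_prod (hq : q ≠ 0) (hq2 : q ^ 2 ≠ 1) (h : ExchangeData q M n g τ τ' l)
    (hu : CornerUnits q M n l ε u) (hM : M ≤ n) {P : ℕ → ℕ → ℕ → B⟦X⟧}
    (hP : ∀ k, IsInv n (ser l ε (point q M k)) (P k)) :
    leadMinor q (fun k => ser l ε (point q M k)) M * tailMinor q P M (n - M) =
      ((List.range n).map (factor M u)).prod := by
  have hz := fun k => point_ne_zero (M := M) hq k
  have hrz : ∀ k, k + 1 ≠ M → RZ q M (point q M k) (point q M k * qt q M k ^ 2)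
      (ser l ε (point q M k)) (ser l ε (point q M (k + 1))) := fun k hk => by
    have := h.rz ε (hz k) (hz (k + 1))
    rwa [point_succ hq hk] at this ⊢
  have hD : ∀ m ≤ M, leadMinor q (fun k => ser l ε (point q M k)) m =
      ((List.range m).map (factor M u)).prod := by
    intro m
    induction m with
    | zero => intro _; simp [leadMinor_zero]
    | succ m ih =>
      intro hm
      obtain ⟨N, hN, hNu⟩ := hu m (by omega)
      have := leadMinor_succ_mul (X := fun k => ser l ε (point q M k)) (show m < M by omega)
        (qAntisymm_columns hq hq2 hz (fun i hi => by
          have := hrz i (by omega)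
          rwa [show qt q M i = q by unfold qt; rw [if_pos (by omega)]] at this) hm) hN
      rw [hNu, ih (by omega)] at this
      simp only [List.range_succ, List.map_append, List.map_cons, List.map_nil, List.prod_append,
        List.prod_singleton]
      rw [← this, factor, if_pos (by omega), mul_assoc, (u m).mul_inv, mul_one]
  have hE : ∀ l' k, M ≤ k → k + l' = n → tailMinor q P k l' =
      ((List.range l').map fun j => factor M u (k + j)).prod := by
    intro l'
    induction l' with
    | zero => intro k _ _; simp [tailMinor_zero]
    | succ l' ih =>
      intro k hk hn
      obtain ⟨N, hN, hNu⟩ := hu k (by omega)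
      have := tailMinor_succ (P := P) (X := fun k => ser l ε (point q M k)) hk hn
        (qAntisymm_rows hq hq2 hz (fun i hi _ => by
          have := hrz i (by omega)
          rwa [show qt q M i ^ 2 = (q ^ 2)⁻¹ by
            unfold qt; rw [if_neg (by omega), neg_sq, inv_pow]] at this) (fun i _ _ => hP i) hk hn.le)
        (hP k) hN
      rw [this, hNu, ih (k + 1) (by omega) (by omega), List.range_succ_eq_map, List.map_cons,
        List.prod_cons, List.map_map, factor, if_neg (by omega)]
      congr 3
      funext j
      simp only [Function.comp, Nat.succ_eq_add_one]
      congr 1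
      omega
  obtain ⟨m, rfl⟩ := Nat.exists_eq_add_of_le hM
  rw [Nat.add_sub_cancel_left, hD M le_rfl, hE m M le_rfl rfl, List.range_add, List.map_append,
    List.prod_append, List.map_map]
  rfl

end Data

/-! ### The scalars of the affine case -/

section ScalarSeries

variable {K : Type*} [Field K]

/-- The series `1 - r y`. -/
def oneSub (r : K) : K⟦X⟧ := 1 - PowerSeries.C r * PowerSeries.X

lemma rescale_C_const (c r : K) : PowerSeries.rescale c (PowerSeries.C r) = PowerSeries.C r := by
  ext k
  rw [PowerSeries.coeff_rescale, PowerSeries.coeff_C]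
  split_ifs with h
  · rw [h, pow_zero, one_mul]
  · rw [mul_zero]

lemma rescale_oneSub (c r : K) : PowerSeries.rescale c (oneSub r) = oneSub (c * r) := by
  rw [oneSub, oneSub, map_sub, map_mul, map_one, rescale_C_const, PowerSeries.rescale_X, map_mul]
  ring

lemma constantCoeff_oneSub (r : K) : PowerSeries.constantCoeff (oneSub r) = 1 := by
  simp [oneSub]

lemma rescale_inv (c : K) {F : K⟦X⟧} (hF : PowerSeries.constantCoeff F ≠ 0) :
    PowerSeries.rescale c F⁻¹ = (PowerSeries.rescale c F)⁻¹ := by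
  rw [PowerSeries.eq_inv_iff_mul_eq_one (by rwa [constantCoeff_rescale]), ← map_mul,
    PowerSeries.inv_mul_cancel _ hF, map_one]

/-- A series invariant under a scaling of infinite order is constant. -/
lemma eq_C_of_rescale_eq {c : K} (hc : ∀ n : ℕ, 0 < n → c ^ n ≠ 1) {F : K⟦X⟧}
    (h : PowerSeries.rescale c F = F) : F = PowerSeries.C (PowerSeries.constantCoeff F) := by
  ext k
  rw [PowerSeries.coeff_C]
  split_ifs with hk
  · rw [hk, PowerSeries.coeff_zero_eq_constantCoeff_apply]
  · have := congrArg (PowerSeries.coeff k) h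
    rw [PowerSeries.coeff_rescale] at this
    have h2 : (c ^ k - 1) * PowerSeries.coeff k F = 0 := by rw [sub_mul, this, one_mul, sub_self]
    exact (mul_eq_zero.mp h2).resolve_left (sub_ne_zero.mpr (hc k (Nat.pos_of_ne_zero hk)))

/-- The point belonging to the index `k` is `q^{2 i}` for this `i`. -/
def pointExp (M k : ℕ) : ℤ := if k < M then k else 2 * M - k - 1

lemma point_eq_zpow (q : K) (M k : ℕ) : point q M k = q ^ (2 * pointExp M k) := by
  unfold point pointExp
  split_ifs
  · rw [← zpow_natCast]; push_cast; rfl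
  · congr 1; ring

lemma scale_point (q : K) (M k : ℕ) (ε : Sgn) :
    scale ε (point q M k) = scale ε q ^ (2 * pointExp M k) := by
  cases ε with
  | plus => rw [scale, scale, point_eq_zpow, inv_zpow]
  | minus => rw [scale, scale, point_eq_zpow]

/-- Scaling by `e²` of the product of the series `H(e^{2i} y)^{∓ 1}`, `i` running through the exponents of the points, changes
only the two ends. -/
lemma rescale_prod_telescope {e : K} (he : e ≠ 0) {H : K⟦X⟧} (hH : PowerSeries.constantCoeff H ≠ 0)
    (M : ℕ) (n : ℕ) :
    PowerSeries.rescale (e ^ 2) (∏ k ∈ Finset.range n,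
        if k < M then (PowerSeries.rescale (e ^ (2 * pointExp M k)) H)⁻¹
        else PowerSeries.rescale (e ^ (2 * pointExp M k)) H) *
      PowerSeries.rescale (e ^ (2 * if n ≤ M then (n : ℤ) else 2 * M - n)) H =
    (∏ k ∈ Finset.range n,
        if k < M then (PowerSeries.rescale (e ^ (2 * pointExp M k)) H)⁻¹
        else PowerSeries.rescale (e ^ (2 * pointExp M k)) H) * H := by
  have hc : ∀ c, PowerSeries.constantCoeff (PowerSeries.rescale c H) ≠ 0 := fun c => by
    rwa [constantCoeff_rescale]
  have hrr : ∀ i : ℤ, PowerSeries.rescale (e ^ 2) (PowerSeries.rescale (e ^ (2 * i)) H) =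
      PowerSeries.rescale (e ^ (2 * (i + 1))) H := fun i => by
    rw [PowerSeries.rescale_rescale]
    congr 2
    rw [← zpow_natCast, ← zpow_add₀ he]
    congr 1
    push_cast
    ring
  induction n with
  | zero => simp
  | succ n ih =>
    rw [Finset.prod_range_succ, map_mul, mul_assoc]
    have step : PowerSeries.rescale (e ^ 2)
          (if n < M then (PowerSeries.rescale (e ^ (2 * pointExp M n)) H)⁻¹
          else PowerSeries.rescale (e ^ (2 * pointExp M n)) H) *
        PowerSeries.rescale (e ^ (2 * if n + 1 ≤ M then ((n + 1 : ℕ) : ℤ) else 2 * M - (n + 1 : ℕ))) H =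
        (if n < M then (PowerSeries.rescale (e ^ (2 * pointExp M n)) H)⁻¹
          else PowerSeries.rescale (e ^ (2 * pointExp M n)) H) *
        PowerSeries.rescale (e ^ (2 * if n ≤ M then (n : ℤ) else 2 * M - n)) H := by
      by_cases h1 : n < M
      · rw [if_pos h1, if_pos (show n + 1 ≤ M by omega), if_pos h1.le, rescale_inv _ (hc _), hrr, pointExp,
          if_pos h1]
        push_cast
        rw [PowerSeries.inv_mul_cancel _ (hc _), PowerSeries.inv_mul_cancel _ (hc _)]
      · rw [if_neg h1, if_neg (show ¬ n + 1 ≤ M by omega), hrr, pointExp, if_neg h1, mul_comm]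
        have e1 : (if n ≤ M then (n : ℤ) else 2 * M - n) = 2 * M - n := by
          split_ifs <;> omega
        rw [e1]
        congr 5
        · push_cast; ring
        · ring
    rw [step, mul_left_comm, ih]
    ring

/-- If `H(y e^{2M-2N}) / H(y)` is the given rational function, the product of the scalars is constant; the zeroth scalar
contains an additional rational function. -/
lemma prod_scalars_eq_C {e : K} (he : e ≠ 0) (hroot : ∀ n : ℕ, 0 < n → e ^ n ≠ 1) {H : K⟦X⟧}
    (hH : PowerSeries.constantCoeff H ≠ 0) {M n : ℕ} (hM : M ≤ n) (hn : 0 < n) {F : ℕ → K⟦X⟧} {s : ℕ → K}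
    (h1 : ∀ k ≠ 0, F k = PowerSeries.C (s k) * H)
    (h0 : F 0 * oneSub 1 = PowerSeries.C (s 0) * oneSub (if 0 < M then (e ^ 2)⁻¹ else e ^ 2) * H)
    (hrec : PowerSeries.rescale (e ^ (2 * (2 * M - n : ℤ))) H * (oneSub 1 * oneSub 1) =
      H * (oneSub (e ^ 2) * oneSub (e ^ 2)⁻¹)) :
    ∃ c, ∏ k ∈ Finset.range n,
      (if k < M then (PowerSeries.rescale (e ^ (2 * pointExp M k)) (F k))⁻¹
        else PowerSeries.rescale (e ^ (2 * pointExp M k)) (F k)) = PowerSeries.C c := by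
  -- The additional rational function in the factor of index `0`; it is the same whether that index is even or odd.
  set κ : K⟦X⟧ := oneSub 1 * (oneSub (e ^ 2)⁻¹)⁻¹ with hκ
  have hne : ∀ r : K, PowerSeries.constantCoeff (oneSub r) ≠ 0 := fun r => by
    rw [constantCoeff_oneSub]; exact one_ne_zero
  have hCinv : ∀ r : K, (PowerSeries.C r)⁻¹ = PowerSeries.C r⁻¹ := fun r => by
    rw [PowerSeries.C_inv]
  have hF0 : F 0 = PowerSeries.C (s 0) * oneSub (if 0 < M then (e ^ 2)⁻¹ else e ^ 2) * H *
      (oneSub 1)⁻¹ := by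
    rw [← h0, mul_assoc, PowerSeries.mul_inv_cancel _ (hne 1), mul_one]
  have hfac : ∀ k, (if k < M then (PowerSeries.rescale (e ^ (2 * pointExp M k)) (F k))⁻¹
        else PowerSeries.rescale (e ^ (2 * pointExp M k)) (F k)) =
      PowerSeries.C (if k < M then (s k)⁻¹ else s k) * (if k = 0 then κ else 1) *
        (if k < M then (PowerSeries.rescale (e ^ (2 * pointExp M k)) H)⁻¹
        else PowerSeries.rescale (e ^ (2 * pointExp M k)) H) := by
    intro k
    rcases eq_or_ne k 0 with rfl | hk
    · by_cases hM0 : 0 < M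
      · have e0 : pointExp M 0 = 0 := by simp [pointExp, hM0]
        simp only [if_pos hM0, if_true, e0, mul_zero, zpow_zero, PowerSeries.rescale_one,
          RingHom.id_apply]
        rw [hF0, if_pos hM0, PowerSeries.mul_inv_rev, PowerSeries.mul_inv_rev, PowerSeries.mul_inv_rev,
          hCinv, hκ]
        have : ((oneSub (1 : K))⁻¹)⁻¹ = oneSub 1 := by
          rw [PowerSeries.inv_eq_iff_mul_eq_one, PowerSeries.mul_inv_cancel _ (hne 1)]
          rw [PowerSeries.constantCoeff_inv]
          exact inv_ne_zero (hne 1)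
        rw [this]
        ring
      · have hM0' : M = 0 := by omega
        subst hM0'
        have e0 : (e : K) ^ (2 * pointExp 0 0) = (e ^ 2)⁻¹ := by
          simp only [pointExp, lt_irrefl, if_false]
          rw [← zpow_natCast, ← zpow_neg]
          norm_num
        simp only [lt_irrefl, if_false, if_true, e0]
        rw [hF0, if_neg (lt_irrefl 0), map_mul, map_mul, map_mul, rescale_inv _ (hne 1), rescale_oneSub,
          rescale_oneSub, rescale_C_const, inv_mul_cancel₀ (pow_ne_zero 2 he), mul_one, hκ]
        ring
    · rw [if_neg hk, mul_one, h1 k hk, map_mul, rescale_C_const]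
      split_ifs
      · rw [PowerSeries.mul_inv_rev, hCinv, mul_comm]
      · rfl
  set P := ∏ k ∈ Finset.range n, (if k < M then (PowerSeries.rescale (e ^ (2 * pointExp M k)) H)⁻¹
        else PowerSeries.rescale (e ^ (2 * pointExp M k)) H) with hP
  set c := ∏ k ∈ Finset.range n, (if k < M then (s k)⁻¹ else s k) with hc
  have hprod : ∏ k ∈ Finset.range n,
      (if k < M then (PowerSeries.rescale (e ^ (2 * pointExp M k)) (F k))⁻¹
        else PowerSeries.rescale (e ^ (2 * pointExp M k)) (F k)) = PowerSeries.C c * κ * P := by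
    rw [Finset.prod_congr rfl fun k _ => hfac k, Finset.prod_mul_distrib, Finset.prod_mul_distrib,
      ← map_prod, Finset.prod_ite_eq', if_pos (Finset.mem_range.mpr hn)]
  have htel := rescale_prod_telescope he hH M n
  have e1 : (if n ≤ M then (n : ℤ) else 2 * M - n) = 2 * M - n := by
    split_ifs <;> omega
  rw [← hP, e1] at htel
  set Hp := PowerSeries.rescale (e ^ (2 * (2 * M - n : ℤ))) H with hHp
  have hHp0 : Hp ≠ 0 := by
    intro h
    apply hH
    rw [← constantCoeff_rescale (e ^ (2 * (2 * M - n : ℤ))) H, ← hHp, h, map_zero]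
  have hκ' : PowerSeries.rescale (e ^ 2) κ * H = κ * Hp := by
    have hne0 : ∀ r : K, oneSub r ≠ 0 := fun r h => hne r (by rw [h, map_zero])
    rw [hκ, map_mul, rescale_inv _ (hne _), rescale_oneSub, rescale_oneSub, mul_one,
      mul_inv_cancel₀ (pow_ne_zero 2 he)]
    apply mul_right_cancel₀ (mul_ne_zero (hne0 1) (hne0 (e ^ 2)⁻¹))
    have i1 := PowerSeries.inv_mul_cancel _ (hne 1)
    have i2 := PowerSeries.inv_mul_cancel _ (hne (e ^ 2)⁻¹)
    linear_combination (oneSub (e ^ 2) * H * oneSub (e ^ 2)⁻¹) * i1 -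
      (oneSub 1 * Hp * oneSub 1) * i2 - hrec
  -- By `htel` and `hκ'` the product is invariant under the scaling by `e²`.
  rw [hprod]
  refine ⟨_, eq_C_of_rescale_eq (c := e ^ 2) (fun m hm => ?_) ?_⟩
  · rw [← pow_mul]
    exact hroot _ (by omega)
  · rw [map_mul, map_mul, rescale_C_const]
    apply mul_right_cancel₀ hHp0
    linear_combination (PowerSeries.C c * PowerSeries.rescale (e ^ 2) κ) * htel +
      (PowerSeries.C c * P) * hκ'

variable {q : K} {M N : ℕ}

/-- The normalizing series divided by `z q - w q⁻¹`, i.e. the factor of `R(z,w)` in the affine case. -/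
def affineScalar (q : K) (M N : ℕ) : K⟦X⟧ :=
  normSeries q M N * (PowerSeries.C q - PowerSeries.C q⁻¹ * PowerSeries.X)⁻¹

lemma C_mul_C_inv {r : K} (hr : r ≠ 0) : PowerSeries.C r * PowerSeries.C r⁻¹ = 1 := by
  rw [← map_mul, mul_inv_cancel₀ hr, map_one]

lemma lin_eq_oneSub {a b r : K} (h : b = -(a * r)) : lin (a, b) = PowerSeries.C a * oneSub r := by
  rw [lin, oneSub, h, map_neg, map_mul]
  ring

lemma oneSub_ne_zero (r : K) : oneSub r ≠ 0 := fun h => by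
  have := constantCoeff_oneSub r
  rw [h, map_zero] at this
  exact zero_ne_one this

lemma affineScalar_mul (hq : q ≠ 0) :
    affineScalar q M N * (PowerSeries.C q * oneSub (q ^ 2)⁻¹) = normSeries q M N := by
  have e : PowerSeries.C q - PowerSeries.C q⁻¹ * PowerSeries.X =
      PowerSeries.C q * oneSub (q ^ 2)⁻¹ := by
    rw [← lin_eq_oneSub (b := -q⁻¹) (by field_simp), lin, map_neg]
    ring
  rw [affineScalar, e, mul_assoc, PowerSeries.inv_mul_cancel, mul_one]
  rw [map_mul, constantCoeff_oneSub, mul_one]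
  simpa using hq

lemma constantCoeff_affineScalar_ne_zero (hq : q ≠ 0) (hroot : ∀ n : ℕ, 0 < n → q ^ n ≠ 1) (hMN : M ≠ N) :
    PowerSeries.constantCoeff (affineScalar q M N) ≠ 0 := by
  intro h
  have := congrArg PowerSeries.constantCoeff (affineScalar_mul (M := M) (N := N) hq)
  rw [map_mul, h, zero_mul, (normSeries_spec q hq hroot hMN).1] at this
  exact zero_ne_one this

lemma normRatio_mul (hq : q ≠ 0) :
    normRatio q M N * (oneSub 1 * oneSub (q ^ (2 * (M : ℤ) - 2 * N))) =
      oneSub (q ^ 2) * oneSub (q ^ (2 * (M : ℤ) - 2 * N) * (q ^ 2)⁻¹) := by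
  have h1 : ∀ r : K, r ≠ 0 → PowerSeries.X - PowerSeries.C r = PowerSeries.C (-r) * oneSub r⁻¹ := by
    intro r hr
    rw [oneSub, mul_sub, mul_one, ← mul_assoc, ← map_mul, neg_mul, mul_inv_cancel₀ hr, map_neg, map_neg,
      map_one]
    ring
  have e1 : q ^ (2 * (N : ℤ) - 2 * M) = (q ^ (2 * (M : ℤ) - 2 * N))⁻¹ := by
    rw [← zpow_neg]; congr 1; ring
  have e2 : q ^ (2 * (N : ℤ) - 2 * M + 2) = (q ^ (2 * (M : ℤ) - 2 * N))⁻¹ * q ^ 2 := by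
    rw [zpow_add₀ hq, e1]; norm_cast
  have e3 : q ^ (-2 : ℤ) = (q ^ 2)⁻¹ := by rw [zpow_neg]; norm_cast
  have hp : q ^ (2 * (M : ℤ) - 2 * N) ≠ 0 := zpow_ne_zero _ hq
  set p := q ^ (2 * (M : ℤ) - 2 * N)
  have hq2 : q ^ 2 ≠ 0 := pow_ne_zero 2 hq
  have hX : (PowerSeries.X : K⟦X⟧) - 1 = PowerSeries.X - PowerSeries.C 1 := by rw [map_one]
  rw [normRatio, e1, e2, e3, hX, h1 _ (inv_ne_zero hq2), h1 _ (mul_ne_zero (inv_ne_zero hp) hq2),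
    h1 _ one_ne_zero, h1 _ (inv_ne_zero hp), inv_inv, inv_inv, inv_one, mul_inv_rev, inv_inv]
  have hD : PowerSeries.constantCoeff (PowerSeries.C (-1) * oneSub 1 * (PowerSeries.C (-p⁻¹) * oneSub p)) ≠ 0 := by
    rw [map_mul, map_mul, map_mul, constantCoeff_oneSub, constantCoeff_oneSub]
    simpa using hp
  have hc : PowerSeries.C (-(q ^ 2)⁻¹) * PowerSeries.C (-(p⁻¹ * q ^ 2)) =
      PowerSeries.C (-1) * PowerSeries.C (-p⁻¹) := by
    rw [← map_mul, ← map_mul]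
    congr 1
    field_simp
  have hinv := PowerSeries.inv_mul_cancel _ hD
  have hcc : PowerSeries.C (-1) * PowerSeries.C (-p⁻¹) * PowerSeries.C p = 1 := by
    rw [← map_mul, ← map_mul]
    simp [hp]
  rw [mul_comm p]
  set D := (PowerSeries.C (-1) * oneSub 1 * (PowerSeries.C (-p⁻¹) * oneSub p))⁻¹
  linear_combination (oneSub (q ^ 2) * oneSub ((q ^ 2)⁻¹ * p) * D * oneSub 1 * oneSub p) * hc +
    (oneSub (q ^ 2) * oneSub ((q ^ 2)⁻¹ * p)) * hinv

/-- In the affine case the product of the scalars is constant, by the functional equation of the normalizing series.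
For `ε = -` the common part `H` of the scalars is `g(y) (1 - y)`; for `ε = +` it is `1 - y` divided by `g` and the
scalar of unitarity, and `q` is replaced by `q⁻¹`. -/
theorem prod_factorScalar_affine (hq : q ≠ 0) (hroot : ∀ n : ℕ, 0 < n → q ^ n ≠ 1) (hMN : M ≠ N)
    (ε : Sgn) :
    ∃ c, ∏ k ∈ Finset.range (M + N), factorScalar q M (affineScalar q M N) ε k = PowerSeries.C c := by
  have hg := affineScalar_mul (M := M) (N := N) hq
  have hg0 := constantCoeff_affineScalar_ne_zero hq hroot hMN
  obtain ⟨hf1, hf⟩ := normSeries_spec q hq hroot hMN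
  have hr := normRatio_mul (M := M) (N := N) hq
  have hp : q ^ (2 * (M : ℤ) - 2 * N) ≠ 0 := zpow_ne_zero _ hq
  have hexp : ((2 : ℤ) * (2 * M - (M + N : ℕ))) = 2 * (M : ℤ) - 2 * N := by push_cast; ring
  have hcq := C_mul_C_inv hq
  have hC : ∀ r : K, r ≠ 0 → PowerSeries.C r ≠ 0 := fun r hr h => hr (by simpa using h)
  simp only [factorScalar, scale_point]
  cases ε with
  | minus =>
    refine prod_scalars_eq_C (H := affineScalar q M N * oneSub 1)
      (s := fun k => if k = 0 then qt q M 0 else sg K M 0 k) hq hroot ?_ (by omega) (by omega) ?_ ?_ ?_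
    · rw [map_mul, constantCoeff_oneSub, mul_one]
      exact hg0
    · intro k hk
      rw [crossScalar, rho, if_neg hk.symm, lin_eq_oneSub (r := 1) (by ring), if_neg hk]
      ring
    · rw [crossScalar, rho, if_pos rfl, if_pos rfl, lin_eq_oneSub (r := if 0 < M then (q ^ 2)⁻¹ else q ^ 2)]
      · ring
      · unfold qt
        split_ifs
        · field_simp
        · field_simp
    · rw [hexp]
      set p := q ^ (2 * (M : ℤ) - 2 * N)
      have hgp := congrArg (PowerSeries.rescale p) hg
      rw [map_mul, map_mul, rescale_C_const, rescale_oneSub, hf] at hgp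
      rw [map_mul, rescale_oneSub, mul_one]
      apply mul_right_cancel₀ (mul_ne_zero (hC q hq) (oneSub_ne_zero (p * (q ^ 2)⁻¹)))
      linear_combination (oneSub p * oneSub 1 * oneSub 1) * hgp +
        (normSeries q M N * oneSub 1) * hr -
        (oneSub 1 * oneSub (q ^ 2) * oneSub (p * (q ^ 2)⁻¹)) * hg
  | plus =>
    have hun : affineScalar q M N * unitarity q = -(normSeries q M N * (PowerSeries.C q⁻¹ * oneSub (q ^ 2))) := by
      rw [unitarity, lin_eq_oneSub (a := q) (r := (q ^ 2)⁻¹) (by field_simp),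
        lin_eq_oneSub (a := -q⁻¹) (r := q ^ 2) (by field_simp), map_neg, ← hg]
      ring
    have hun0 : PowerSeries.constantCoeff (affineScalar q M N * unitarity q) ≠ 0 := by
      rw [map_mul, constantCoeff_unitarity hq]
      simpa using hg0
    have hinv := PowerSeries.inv_mul_cancel _ hun0
    refine prod_scalars_eq_C (H := oneSub 1 * (affineScalar q M N * unitarity q)⁻¹)
      (s := fun k => if k = 0 then -(qt q M 0)⁻¹ else -sg K M k 0) (inv_ne_zero hq) ?_ ?_ (by omega)
      (by omega) ?_ ?_ ?_
    · intro m hm h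
      rw [inv_pow, inv_eq_one] at h
      exact hroot m hm h
    · rw [map_mul, constantCoeff_oneSub, one_mul, PowerSeries.constantCoeff_inv]
      exact inv_ne_zero hun0
    · intro k hk
      rw [crossScalar, rho, if_neg hk, Prod.swap_prod_mk, lin_eq_oneSub (r := 1) (by ring), if_neg hk]
      ring
    · rw [crossScalar, rho, if_pos rfl, if_pos rfl, Prod.swap_prod_mk,
        lin_eq_oneSub (r := if 0 < M then ((q⁻¹) ^ 2)⁻¹ else (q⁻¹) ^ 2)]
      · ring
      · unfold qt
        split_ifs
        · field_simp
        · field_simp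
    · rw [hexp, inv_zpow, inv_pow, inv_inv]
      set p := q ^ (2 * (M : ℤ) - 2 * N)
      set H := oneSub 1 * (affineScalar q M N * unitarity q)⁻¹ with hH
      set f := normSeries q M N
      have h1 : H * (f * (PowerSeries.C q⁻¹ * oneSub (q ^ 2))) = -oneSub 1 := by
        rw [hun] at hinv hH
        rw [hH]
        linear_combination (-oneSub 1) * hinv
      have h2 := congrArg (PowerSeries.rescale p⁻¹) h1
      have hff : PowerSeries.rescale p⁻¹ (PowerSeries.rescale p f) = f := by
        rw [PowerSeries.rescale_rescale, mul_inv_cancel₀ hp, PowerSeries.rescale_one, RingHom.id_apply]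
      rw [hf, map_mul] at hff
      have hr2 := congrArg (PowerSeries.rescale p⁻¹) hr
      simp only [map_mul, map_neg, rescale_C_const, rescale_oneSub, mul_one, inv_mul_cancel₀ hp,
        inv_mul_cancel_left₀ hp] at h2 hr2
      have hf0 : f ≠ 0 := fun h => by
        rw [h, map_zero] at hf1
        exact zero_ne_one hf1
      apply mul_right_cancel₀ (mul_ne_zero (mul_ne_zero hf0 (hC _ (inv_ne_zero hq))) (oneSub_ne_zero p⁻¹))
      linear_combination
        (-(PowerSeries.rescale p⁻¹ H * oneSub 1 * oneSub 1 * PowerSeries.C q⁻¹ * oneSub p⁻¹)) * hff +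
        (PowerSeries.rescale p⁻¹ H * PowerSeries.C q⁻¹ * oneSub 1 * PowerSeries.rescale p⁻¹ f) * hr2 +
        (oneSub 1 * oneSub (q ^ 2)⁻¹) * h2 - (oneSub (q ^ 2)⁻¹ * oneSub p⁻¹) * h1

end ScalarSeries

section EvConst

variable {K : Type*} [Field K] {B : Type*} [Ring B] [Algebra K B]

/-- Constants do not depend on the central element. -/
lemma evHom_C (c : K) {t t' : B} (ht : ∀ x, Commute t x) (ht' : ∀ x, Commute t' x) :
    evHom K t ht (PowerSeries.C c) = evHom K t' ht' (PowerSeries.C c) := by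
  ext k : 2
  simp only [evHom, RingHom.coe_mk, MonoidHom.coe_mk, OneHom.coe_mk, PowerSeries.coeff_mk,
    PowerSeries.coeff_C]
  split_ifs with hk
  · rw [hk, pow_zero, pow_zero]
  · rw [zero_smul, zero_smul]

end EvConst

/-! ### Generation of an exchange algebra -/

section Generation

variable {K : Type*} [Field K] {B : Type*} [Ring B] [Algebra K B]
  {q : K} {M n : ℕ} {g : K⟦X⟧} {τ τ' : B} {l : Sgn → ℕ → ℕ → ℕ → B}

lemma mem_of_eq_add_smul {Z : Subalgebra K B} {κ : K} (hκ : κ ≠ 0) {a b c v w : B}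
    (h : a + b = c + κ • (v * w)) (ha : a ∈ Z) (hb : b ∈ Z) (hc : c ∈ Z) : v * w ∈ Z := by
  have : v * w = κ⁻¹ • (a + b - c) := by
    rw [h, add_sub_cancel_left, smul_smul, inv_mul_cancel₀ hκ, one_smul]
  rw [this]
  exact Z.smul_mem (Z.sub_mem (Z.add_mem ha hb) hc) _

/-- The modes of the entry `(0,0)`, the diagonal zero modes, and the zero modes next to the diagonal generate all
other modes: the exchange relations with zero modes produce the entries of the corner blocks one row and column at
a time. -/
theorem ExchangeData.mode_mem (hq : q ≠ 0) (hκ : q - q⁻¹ ≠ 0) (h : ExchangeData q M n g τ τ' l)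
    {Z : Subalgebra K B} (h00 : ∀ ε r, l ε r 0 0 ∈ Z) (hd : ∀ k < n, l .plus 0 k k ∈ Z)
    (hd' : ∀ k < n, l .minus 0 k k ∈ Z)
    (hu : ∀ k, k + 1 < n → l .plus 0 k (k + 1) ∈ Z) (hl : ∀ k, k + 1 < n → l .minus 0 (k + 1) k ∈ Z)
    (ε : Sgn) (s : ℕ) {k : ℕ} (hk : k < n) : ∀ i ≤ k, ∀ j ≤ k, l ε s i j ∈ Z := by
  induction k with
  | zero =>
    intro i hi j hj
    obtain rfl := Nat.le_zero.mp hi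
    obtain rfl := Nat.le_zero.mp hj
    exact h00 ε s
  | succ k ih =>
    have ih := ih (by omega)
    have hdl := h.diag_left k (by omega)
    have hdr := h.diag_right k (by omega)
    -- The relation of `l⁺_{k,k+1}` with the entry `(i,k)` contains `l_{i,k+1} l⁺_{kk}`.
    have col : ∀ i ≤ k, l ε s i (k + 1) ∈ Z := by
      intro i hi
      have := h.zero_plus ε s k (k + 1) i k
      beta_reduce at this
      rw [if_pos (Nat.lt_succ_self k), if_neg (show ¬ k < i by omega), zero_smul] at this
      have := mem_of_eq_add_smul hκ this
        (Z.smul_mem (Z.mul_mem (hu k hk) (ih i hi k le_rfl)) _) Z.zero_mem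
        (Z.smul_mem (Z.mul_mem (ih i hi k le_rfl) (hu k hk)) _)
      have e := Z.mul_mem this (hd' k (by omega))
      rwa [mul_assoc, hdr, mul_one] at e
    -- The relation of `l⁻_{k+1,k}` with the entry `(k,j)` contains `l⁻_{kk} l_{k+1,j}`.
    have row : ∀ j ≤ k, l ε s (k + 1) j ∈ Z := by
      intro j hj
      have := h.zero_minus hq ε s (k + 1) k k j
      beta_reduce at this
      rw [if_pos (Nat.lt_succ_self k), if_neg (show ¬ k < j by omega), zero_smul] at this
      have := mem_of_eq_add_smul (neg_ne_zero.mpr hκ) (this.symm)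
        (Z.smul_mem (Z.mul_mem (ih k le_rfl j hj) (hl k hk)) _) Z.zero_mem
        (Z.smul_mem (Z.mul_mem (hl k hk) (ih k le_rfl j hj)) _)
      have e := Z.mul_mem (hd k (by omega)) this
      rwa [← mul_assoc, hdr, one_mul] at e
    -- The relation of `l⁺_{k,k+1}` with the entry `(k+1,k)` contains `l_{k+1,k+1} l⁺_{kk}`.
    have corner : l ε s (k + 1) (k + 1) ∈ Z := by
      have := h.zero_plus ε s k (k + 1) (k + 1) k
      beta_reduce at this
      rw [if_pos (Nat.lt_succ_self k)] at this
      have := mem_of_eq_add_smul hκ this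
        (Z.smul_mem (Z.mul_mem (hu k hk) (row k le_rfl)) _)
        (Z.smul_mem (Z.mul_mem (hd (k + 1) hk) (ih k le_rfl k le_rfl)) _)
        (Z.smul_mem (Z.mul_mem (row k le_rfl) (hu k hk)) _)
      have e := Z.mul_mem this (hd' k (by omega))
      rwa [mul_assoc, hdr, mul_one] at e
    intro i hi j hj
    rcases Nat.lt_or_ge k i with hki | hki <;> rcases Nat.lt_or_ge k j with hkj | hkj
    · obtain rfl : i = k + 1 := by omega
      obtain rfl : j = k + 1 := by omega
      exact corner
    · obtain rfl : i = k + 1 := by omega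
      exact row j hkj
    · obtain rfl : j = k + 1 := by omega
      exact col i hki
    · exact ih i hki j hkj

end Generation

/-! ### Removing the signs of the graded tensor product -/

section Hat

variable {K : Type*} [Field K] {A : Type*} [Ring A] [Algebra K A]

/-- The tensor product of `x` with an integral `2 × 2` matrix. -/
def hat (K : Type*) [Field K] {A : Type*} [Ring A] [Algebra K A] (m : Matrix (Fin 2) (Fin 2) ℤ) :
    A →ₗ[K] Matrix (Fin 2) (Fin 2) A where
  toFun x := Matrix.of fun i j => m i j • x
  map_add' x y := by ext i j; simp
  map_smul' c x := by ext i j; simp [smul_comm]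

lemma hat_apply (m : Matrix (Fin 2) (Fin 2) ℤ) (x : A) (i j : Fin 2) :
    hat K m x i j = m i j • x := rfl

lemma hat_mul_hat (m m' : Matrix (Fin 2) (Fin 2) ℤ) (x y : A) :
    hat K m x * hat K m' y = hat K (m * m') (x * y) := by
  ext i j
  simp only [Matrix.mul_apply, hat_apply, Fin.sum_univ_two, smul_mul_smul_comm, add_smul]

lemma hat_one_one : hat K 1 (1 : A) = 1 := by
  ext i j
  rw [hat_apply, Matrix.one_apply, Matrix.one_apply]
  split_ifs <;> simp

lemma hat_one_pow (t : A) (k : ℕ) : hat K 1 t ^ k = hat K 1 (t ^ k) := by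
  induction k with
  | zero => rw [pow_zero, pow_zero, hat_one_one]
  | succ k ih => rw [pow_succ, pow_succ, ih, hat_mul_hat, one_mul]

lemma hat_neg_one_pow_smul (k : ℕ) (m : Matrix (Fin 2) (Fin 2) ℤ) (x : A) :
    hat K ((-1 : ℤ) ^ k • m) x = (-1 : K) ^ k • hat K m x := by
  ext i j
  rcases neg_one_pow_eq_or ℤ k with h | h
  · have h' : (-1 : K) ^ k = 1 := by simpa using congrArg (Int.cast : ℤ → K) h
    rw [h, h', one_smul, one_smul]
  · have h' : (-1 : K) ^ k = -1 := by simpa using congrArg (Int.cast : ℤ → K) h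
    rw [h, h', neg_smul, neg_smul, one_smul, one_smul, Matrix.neg_apply, hat_apply, hat_apply,
      Matrix.neg_apply, neg_smul]

lemma hat_injective {m m' : Matrix (Fin 2) (Fin 2) ℤ} (h : m' * m = 1) :
    Function.Injective (hat K m : A → Matrix (Fin 2) (Fin 2) A) := by
  intro x y hxy
  have := congrArg (fun F => (hat K m' (1 : A) * F) 0 0) hxy
  simpa [hat_mul_hat, h, hat_apply] using this

lemma hat_one_central {t : A} (ht : ∀ x, Commute t x) (X : Matrix (Fin 2) (Fin 2) A) :
    Commute (hat K 1 t) X := by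
  have e : hat K 1 t = Matrix.scalar (Fin 2) t := by
    ext i j
    rw [hat_apply, Matrix.scalar_apply, Matrix.diagonal_apply, Matrix.one_apply]
    split_ifs <;> simp
  rw [e]
  exact Matrix.scalar_commute t ht X

/-- The matrix `diag(1, -1)`. -/
def hMat : Matrix (Fin 2) (Fin 2) ℤ := !![1, 0; 0, -1]

/-- The permutation matrix of the transposition; it anticommutes with `hMat`. -/
def pMat : Matrix (Fin 2) (Fin 2) ℤ := !![0, 1; 1, 0]

/-- The factor attached to an entry with row parity `i` and column parity `j`. By `parityMat_mul` the products of these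
factors produce the signs of the graded tensor product. -/
def parityMat (i j : ℕ) : Matrix (Fin 2) (Fin 2) ℤ := hMat ^ (i + j) * pMat ^ i

lemma parityMat_mul {a b c d : ℕ} (ha : a = 0 ∨ a = 1) (hb : b = 0 ∨ b = 1) (hc : c = 0 ∨ c = 1)
    (hd : d = 0 ∨ d = 1) : parityMat a b * parityMat c d =
      (-1 : ℤ) ^ (a * (c + d)) • (hMat ^ (a + b + c + d) * pMat ^ (a + c)) := by
  rcases ha with rfl | rfl <;> rcases hb with rfl | rfl <;> rcases hc with rfl | rfl <;>
    rcases hd with rfl | rfl <;> decide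

/-- The entries `x_{ij}`, tensored with `parityMat` and extended by zero to all natural indices. -/
def hatEntry (K : Type*) [Field K] {A : Type*} [Ring A] [Algebra K A] {M N : ℕ} (x : Idx M N → Idx M N → A)
    (i j : ℕ) : Matrix (Fin 2) (Fin 2) A :=
  if h : i < M + N ∧ j < M + N then
    hat K (parityMat (par (⟨i, h.1⟩ : Idx M N)) (par (⟨j, h.2⟩ : Idx M N))) (x ⟨i, h.1⟩ ⟨j, h.2⟩)
  else 0

variable {M N : ℕ}

lemma hatEntry_idx (x : Idx M N → Idx M N → A) (i j : Idx M N) :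
    hatEntry K x i j = hat K (parityMat (par i) (par j)) (x i j) := by
  rw [hatEntry, dif_pos ⟨i.isLt, j.isLt⟩]

lemma hatEntry_of_not_lt (x : Idx M N → Idx M N → A) {i j : ℕ} (h : ¬ (i < M + N ∧ j < M + N)) :
    hatEntry K x i j = 0 := by
  rw [hatEntry, dif_neg h]

/-- The coefficient of `E_{ab} ⊗ E_{cd}` in `R L₁ L₂` in the graded tensor product, up to sign: `rllLeft`
with modes instead of exponents of `z`, for one pair of modes. -/
def superLeft (q : K) (act : K × K → (ℕ → ℕ → A) → A) (x y : ℕ → Idx M N → Idx M N → A)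
    (a b c d : Idx M N) : A :=
  (-1 : K) ^ (par a * (par c + par d)) • act (rDiag q a c) (fun r s => x r a b * y s c d) +
    (-1 : K) ^ (par c * par d) • act (rExch q a c) (fun r s => x r c b * y s a d)

/-- The coefficient of `E_{ab} ⊗ E_{cd}` in `L₂ L₁ R`, with the same sign as in `superLeft`. -/
def superRight (q : K) (act : K × K → (ℕ → ℕ → A) → A) (x y : ℕ → Idx M N → Idx M N → A)
    (a b c d : Idx M N) : A :=
  (-1 : K) ^ (par b * (par c + par d)) • act (rDiag q b d) (fun r s => y s c d * x r a b) +
    (-1 : K) ^ (par c * par d) • act (rExch q d b) (fun r s => y s c b * x r a d)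

/-- The action `act'` of linear forms corresponds to `act` under all maps `hat`. -/
structure HatAction (act : K × K → (ℕ → ℕ → A) → A)
    (act' : K × K → (ℕ → ℕ → Matrix (Fin 2) (Fin 2) A) → Matrix (Fin 2) (Fin 2) A) : Prop where
  nat : ∀ m p F, hat K m (act p F) = act' p fun r s => hat K m (F r s)
  smul : ∀ (c : K) p F, act' p (fun r s => c • F r s) = c • act' p F
  form : ∀ (c : K) p F, act' (c • p) F = c • act' p F

lemma rDiag_smul (q : K) (a c : Idx M N) :
    (-1 : K) ^ (par a * par c) • rDiag q a c = rho q M a c := by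
  unfold rDiag rho
  simp only [Fin.ext_iff]
  have hs : (-1 : K) ^ (par a * par c) = sg K M a c := by
    unfold par sg
    split_ifs <;> first | omega | simp
  rw [hs]
  split_ifs with h
  · rw [← h]
    unfold sg qIdx qt par
    by_cases h1 : (a : ℕ) < M
    · simp [h1]
    · simp [h1, not_lt.mp h1]
  · simp

/-- After tensoring with the matrices `parityMat`, the relations of the graded tensor product become relations without
signs. -/
theorem HatAction.exchange {q : K} {act₁ act₂ : K × K → (ℕ → ℕ → A) → A}
    {act₁' act₂' : K × K → (ℕ → ℕ → Matrix (Fin 2) (Fin 2) A) → Matrix (Fin 2) (Fin 2) A}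
    (h₁ : HatAction act₁ act₁') (h₂ : HatAction act₂ act₂') {x y : ℕ → Idx M N → Idx M N → A}
    (h : ∀ a b c d, superLeft q act₁ x y a b c d = superRight q act₂ x y a b c d) (a b c d : ℕ) :
    act₁' (rho q M a c) (fun r s => hatEntry K (x r) a b * hatEntry K (y s) c d) +
        act₁' (rex q a c) (fun r s => hatEntry K (x r) c b * hatEntry K (y s) a d) =
      act₂' (rho q M b d) (fun r s => hatEntry K (y s) c d * hatEntry K (x r) a b) +
        act₂' (rex q d b) (fun r s => hatEntry K (y s) c b * hatEntry K (x r) a d) := by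
  by_cases hr : (a < M + N ∧ b < M + N) ∧ (c < M + N ∧ d < M + N)
  · obtain ⟨⟨ha, hb⟩, hc, hd⟩ := hr
    lift a to Idx M N using ha
    lift b to Idx M N using hb
    lift c to Idx M N using hc
    lift d to Idx M N using hd
    have pa := par_le a
    have pb := par_le b
    have pc := par_le c
    have pd := par_le d
    set m := hMat ^ (par a + par b + par c + par d) * pMat ^ (par a + par c) with hm
    have e1 : ∀ r s, hatEntry K (x r) a b * hatEntry K (y s) c d =
        (-1 : K) ^ (par a * (par c + par d)) • hat K m (x r a b * y s c d) := fun r s => by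
      rw [hatEntry_idx, hatEntry_idx, hat_mul_hat, parityMat_mul pa pb pc pd, hat_neg_one_pow_smul]
    have e2 : ∀ r s, hatEntry K (x r) c b * hatEntry K (y s) a d =
        (-1 : K) ^ (par c * (par a + par d)) • hat K m (x r c b * y s a d) := fun r s => by
      rw [hatEntry_idx, hatEntry_idx, hat_mul_hat, parityMat_mul pc pb pa pd, hat_neg_one_pow_smul,
        hm, add_comm (par c) (par a), show par c + par b + par a + par d =
          par a + par b + par c + par d by ring]
    have e3 : ∀ r s, hatEntry K (y s) c d * hatEntry K (x r) a b =
        (-1 : K) ^ (par c * (par a + par b)) • hat K m (y s c d * x r a b) := fun r s => by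
      rw [hatEntry_idx, hatEntry_idx, hat_mul_hat, parityMat_mul pc pd pa pb, hat_neg_one_pow_smul,
        hm, add_comm (par c) (par a), show par c + par d + par a + par b =
          par a + par b + par c + par d by ring]
    have e4 : ∀ r s, hatEntry K (y s) c b * hatEntry K (x r) a d =
        (-1 : K) ^ (par c * (par a + par d)) • hat K m (y s c b * x r a d) := fun r s => by
      rw [hatEntry_idx, hatEntry_idx, hat_mul_hat, parityMat_mul pc pb pa pd, hat_neg_one_pow_smul,
        hm, add_comm (par c) (par a), show par c + par b + par a + par d =
          par a + par b + par c + par d by ring]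
    have key := congrArg (fun z => (-1 : K) ^ (par a * par c) • hat K m z) (h a b c d)
    simp only [superLeft, superRight, map_add, map_smul, h₁.nat, h₂.nat] at key
    simp only [e1, e2, e3, e4, h₁.smul, h₂.smul, ← rDiag_smul, ← show ∀ a c : Idx M N, rExch q a c = rex q a c from fun _ _ => rfl, h₁.form, h₂.form]
    simp only [smul_add, smul_smul] at key ⊢
    have s1 : (-1 : K) ^ (par a * (par c + par d)) * (-1) ^ (par a * par c) =
        (-1) ^ (par a * par c) * (-1) ^ (par a * (par c + par d)) := mul_comm _ _
    have s2 : (-1 : K) ^ (par c * (par a + par d)) =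
        (-1) ^ (par a * par c) * (-1) ^ (par c * par d) := by rw [← pow_add]; congr 1; ring
    have s3 : (-1 : K) ^ (par c * (par a + par b)) * (-1) ^ (par b * par d) =
        (-1) ^ (par a * par c) * (-1) ^ (par b * (par c + par d)) := by
      rw [← pow_add, ← pow_add]; congr 1; ring
    rw [s1, s2, s3]
    exact key
  · have z1 : ∀ r s, hatEntry K (x r) a b * hatEntry K (y s) c d = 0 := fun r s => by
      by_cases h1 : a < M + N ∧ b < M + N
      · rw [hatEntry_of_not_lt (y s) (fun h2 => hr ⟨h1, h2⟩), mul_zero]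
      · rw [hatEntry_of_not_lt (x r) h1, zero_mul]
    have z2 : ∀ r s, hatEntry K (x r) c b * hatEntry K (y s) a d = 0 := fun r s => by
      by_cases h1 : c < M + N ∧ b < M + N
      · rw [hatEntry_of_not_lt (y s) (fun h2 => hr ⟨⟨h2.1, h1.2⟩, h1.1, h2.2⟩), mul_zero]
      · rw [hatEntry_of_not_lt (x r) h1, zero_mul]
    have z3 : ∀ r s, hatEntry K (y s) c d * hatEntry K (x r) a b = 0 := fun r s => by
      by_cases h1 : a < M + N ∧ b < M + N
      · rw [hatEntry_of_not_lt (y s) (fun h2 => hr ⟨h1, h2⟩), zero_mul]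
      · rw [hatEntry_of_not_lt (x r) h1, mul_zero]
    have z4 : ∀ r s, hatEntry K (y s) c b * hatEntry K (x r) a d = 0 := fun r s => by
      by_cases h1 : c < M + N ∧ b < M + N
      · rw [hatEntry_of_not_lt (x r) (fun h2 => hr ⟨⟨h2.1, h1.2⟩, h1.1, h2.2⟩), mul_zero]
      · rw [hatEntry_of_not_lt (y s) h1, zero_mul]
    have zero₁ : ∀ p, act₁' p (fun _ _ => 0) = 0 := fun p => by
      simpa using h₁.smul 0 p fun _ _ => 0
    have zero₂ : ∀ p, act₂' p (fun _ _ => 0) = 0 := fun p => by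
      simpa using h₂.smul 0 p fun _ _ => 0
    simp only [z1, z2, z3, z4, zero₁, zero₂]

lemma hatAction_shiftMul (ε : Sgn) (r s : ℕ) :
    HatAction (fun (p : K × K) (F : ℕ → ℕ → A) => shiftMul (formSnd ε p) (formFst ε p) F r s)
      (fun p F => shiftMul (formSnd ε p) (formFst ε p) F r s) where
  nat m p F := by
    unfold shiftMul
    split_ifs <;> simp
  smul c p F := by
    unfold shiftMul
    split_ifs <;> simp [smul_comm c]
  form c p F := by
    cases ε <;> simp [shiftMul, formSnd, formFst, mul_smul]

lemma lin_smul (c : K) (p : K × K) : lin (c • p) = PowerSeries.C c * lin p := by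
  simp only [lin, Prod.smul_fst, Prod.smul_snd, smul_eq_mul, map_mul]
  ring

lemma hatAction_diagMul (g : K⟦X⟧) (t : A) (r s : ℕ) :
    HatAction (fun p (F : ℕ → ℕ → A) => diagMul (g * lin p) t F r s)
      (fun p F => diagMul (g * lin p) (hat K 1 t) F r s) where
  nat m p F := by
    simp only [diagMul, map_sum, map_smul, hat_one_pow, hat_mul_hat, one_mul]
  smul c p F := by
    simp only [diagMul, Finset.smul_sum, mul_smul_comm]
    exact Finset.sum_congr rfl fun k _ => smul_comm _ _ _
  form c p F := by
    simp only [diagMul, lin_smul, mul_left_comm g, PowerSeries.coeff_C_mul, mul_smul, Finset.smul_sum]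

/-- Modes `x^ε_r` satisfying the relations of the quantum affine superalgebra, with `R`-matrices
`g(w t / z) R(z, w t) / z` and `g(w t' / z) R(z, w t') / z` in the relation between `x⁺` and `x⁻`. -/
structure SuperExchangeData (q : K) (M N : ℕ) (g : K⟦X⟧) (t t' : A)
    (x : Sgn → ℕ → Idx M N → Idx M N → A) : Prop where
  upper : ∀ i j, i < j → x .plus 0 j i = 0
  lower : ∀ i j, i < j → x .minus 0 i j = 0
  diag_left : ∀ i, x .minus 0 i i * x .plus 0 i i = 1
  diag_right : ∀ i, x .plus 0 i i * x .minus 0 i i = 1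
  same : ∀ ε r s a b c d,
    superLeft q (fun p F => shiftMul (formSnd ε p) (formFst ε p) F r s) (x ε) (x ε) a b c d =
      superRight q (fun p F => shiftMul (formSnd ε p) (formFst ε p) F r s) (x ε) (x ε) a b c d
  cross : ∀ r s a b c d,
    superLeft q (fun p F => diagMul (g * lin p) t F r s) (x .plus) (x .minus) a b c d =
      superRight q (fun p F => diagMul (g * lin p) t' F r s) (x .plus) (x .minus) a b c d
  central : ∀ y, Commute t y
  central' : ∀ y, Commute t' y
  unit : PowerSeries.constantCoeff g ≠ 0

lemma parityMat_self (i : Idx M N) : parityMat (par i) (par i) * parityMat (par i) (par i) = 1 := by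
  rcases par_le i with h | h <;> rw [h] <;> decide

/-- The modes tensored with the matrices `parityMat` satisfy the ungraded exchange relations. -/
theorem SuperExchangeData.exchangeData {q : K} {g : K⟦X⟧} {t t' : A}
    {x : Sgn → ℕ → Idx M N → Idx M N → A} (h : SuperExchangeData q M N g t t' x) :
    ExchangeData q M (M + N) g (hat K 1 t) (hat K 1 t') (fun ε r => hatEntry K (x ε r)) where
  upper i j hij := by
    by_cases hn : j < M + N ∧ i < M + N
    · rw [hatEntry, dif_pos hn, h.upper ⟨i, hn.2⟩ ⟨j, hn.1⟩ hij, map_zero]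
    · exact hatEntry_of_not_lt _ hn
  lower i j hij := by
    by_cases hn : i < M + N ∧ j < M + N
    · rw [hatEntry, dif_pos hn, h.lower ⟨i, hn.1⟩ ⟨j, hn.2⟩ hij, map_zero]
    · exact hatEntry_of_not_lt _ hn
  diag_left i hi := by
    lift i to Idx M N using hi
    rw [hatEntry_idx, hatEntry_idx, hat_mul_hat, h.diag_left, parityMat_self, hat_one_one]
  diag_right i hi := by
    lift i to Idx M N using hi
    rw [hatEntry_idx, hatEntry_idx, hat_mul_hat, h.diag_right, parityMat_self, hat_one_one]
  same ε a b c d r s := (hatAction_shiftMul ε r s).exchange (hatAction_shiftMul ε r s) (h.same ε r s) a b c d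
  cross a b c d r s := (hatAction_diagMul g t r s).exchange (hatAction_diagMul g t' r s) (h.cross r s) a b c d
  central := hat_one_central h.central
  central' := hat_one_central h.central'
  unit := h.unit

end Hat

/-! ### The Berezinian commutes with all modes -/

section HatSeries

variable {K : Type*} [Field K] {A : Type*} [Ring A] [Algebra K A]

/-- The map `hat` on all coefficients of a series. -/
def hatSeries (K : Type*) [Field K] {A : Type*} [Ring A] [Algebra K A] (m : Matrix (Fin 2) (Fin 2) ℤ) :
    A⟦X⟧ →ₗ[K] (Matrix (Fin 2) (Fin 2) A)⟦X⟧ where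
  toFun F := PowerSeries.mk fun r => hat K m (PowerSeries.coeff r F)
  map_add' F G := by ext r : 1; simp
  map_smul' c F := by ext r : 1; simp

lemma coeff_hatSeries (m : Matrix (Fin 2) (Fin 2) ℤ) (F : A⟦X⟧) (r : ℕ) :
    PowerSeries.coeff r (hatSeries K m F) = hat K m (PowerSeries.coeff r F) := by
  simp [hatSeries]

lemma hatSeries_mul_hatSeries (m m' : Matrix (Fin 2) (Fin 2) ℤ) (F G : A⟦X⟧) :
    hatSeries K m F * hatSeries K m' G = hatSeries K (m * m') (F * G) := by
  ext r : 1
  rw [PowerSeries.coeff_mul, coeff_hatSeries, PowerSeries.coeff_mul, map_sum]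
  exact Finset.sum_congr rfl fun p _ => by rw [coeff_hatSeries, coeff_hatSeries, hat_mul_hat]

lemma hatSeries_one_one : hatSeries K 1 (1 : A⟦X⟧) = 1 := by
  ext r : 1
  rw [coeff_hatSeries, PowerSeries.coeff_one, PowerSeries.coeff_one]
  split_ifs
  · exact hat_one_one
  · exact map_zero _

lemma hatSeries_zsmul (c : ℤ) (m : Matrix (Fin 2) (Fin 2) ℤ) (F : A⟦X⟧) :
    hatSeries K (c • m) F = hatSeries K m (c • F) := by
  ext r i j
  rw [coeff_hatSeries, coeff_hatSeries, hat_apply, hat_apply, map_zsmul, Matrix.smul_apply, smul_eq_mul,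
    mul_comm, mul_smul]

lemma prod_ofFn_hatSeries (m : Matrix (Fin 2) (Fin 2) ℤ) {k : ℕ} (F : Fin k → A⟦X⟧) :
    (List.ofFn fun i => hatSeries K m (F i)).prod = hatSeries K (m ^ k) (List.ofFn F).prod := by
  induction k with
  | zero => simp [hatSeries_one_one]
  | succ k ih =>
    rw [List.ofFn_succ, List.prod_cons, ih fun i => F i.succ, hatSeries_mul_hatSeries, List.ofFn_succ,
      List.prod_cons, pow_succ']

/-- The substitution `z ↦ z t` as a ring homomorphism. -/
def shiftHom (A : Type*) [Ring A] [Algebra K A] (ε : Sgn) (t : K) : A⟦X⟧ →+* A⟦X⟧ where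
  toFun := shift ε t
  map_zero' := by ext r; simp [shift]
  map_one' := by
    ext r
    rw [shift, PowerSeries.coeff_mk, PowerSeries.coeff_one]
    split_ifs with h
    · subst h
      cases ε <;> simp
    · rw [smul_zero]
  map_add' F G := by ext r; simp [shift]
  map_mul' F G := by
    ext r
    rw [shift, PowerSeries.coeff_mk, PowerSeries.coeff_mul, PowerSeries.coeff_mul, Finset.smul_sum]
    refine Finset.sum_congr rfl fun p hp => ?_
    rw [shift, shift, PowerSeries.coeff_mk, PowerSeries.coeff_mk, smul_mul_smul_comm,
      ← Finset.HasAntidiagonal.mem_antidiagonal.mp hp]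
    cases ε <;> simp only [pow_add]

variable {M N : ℕ}

lemma ser_hatEntry (x : Sgn → ℕ → Idx M N → Idx M N → A) (ε : Sgn) (c : K) (i j : Idx M N) :
    ser (fun ε r => hatEntry K (x ε r)) ε c i j =
      hatSeries K (parityMat (par i) (par j)) (shift ε c (entry (lSeries (x ε)) i j)) := by
  ext r : 1
  rw [coeff_hatSeries, ser, PowerSeries.coeff_mk, hatEntry_idx, shift, PowerSeries.coeff_mk, map_smul]
  cases ε <;> simp [scale, entry, lSeries]

/-- The factor attached to an entry of the inverse matrix. With it the product of the graded tensor product becomes the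
ordinary matrix product. -/
def invParityMat (i j : ℕ) : Matrix (Fin 2) (Fin 2) ℤ :=
  (-1 : ℤ) ^ (i * (i + j)) • (hMat ^ (i + j) * pMat ^ j)

/-- The inverse of `L^ε(z c)`, tensored with the matrices `invParityMat`. -/
def hatInv (K : Type*) [Field K] {A : Type*} [Ring A] [Algebra K A] {M N : ℕ}
    (x : Sgn → ℕ → Idx M N → Idx M N → A) (ε : Sgn) (c : K) (i j : ℕ) : (Matrix (Fin 2) (Fin 2) A)⟦X⟧ :=
  if h : i < M + N ∧ j < M + N then
    hatSeries K (invParityMat (par (⟨i, h.1⟩ : Idx M N)) (par (⟨j, h.2⟩ : Idx M N)))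
      (shift ε c (entry (superInv (lSeries (x ε))) ⟨i, h.1⟩ ⟨j, h.2⟩))
  else 0

lemma hatInv_idx (x : Sgn → ℕ → Idx M N → Idx M N → A) (ε : Sgn) (c : K) (i j : Idx M N) :
    hatInv K x ε c i j = hatSeries K (invParityMat (par i) (par j))
      (shift ε c (entry (superInv (lSeries (x ε))) i j)) := by
  rw [hatInv, dif_pos ⟨i.isLt, j.isLt⟩]

/-- After tensoring, the inverse in the graded tensor product is the ordinary inverse matrix. -/
lemma isInv_hatInv (x : Sgn → ℕ → Idx M N → Idx M N → A) (ε : Sgn)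
    (hx : IsUnit (twist (lSeries (x ε)))) (c : K) :
    IsInv (M + N) (ser (fun ε r => hatEntry K (x ε r)) ε c) (hatInv K x ε c) := by
  have m1 : ∀ i j k : Idx M N, invParityMat (par i) (par j) * parityMat (par j) (par k) =
      (-1 : ℤ) ^ ((par i + par j) * (par j + par k)) •
        ((-1 : ℤ) ^ (par i * (1 + par k)) • hMat ^ (par i + par k)) := by
    intro i j k
    rcases par_le i with hi | hi <;> rcases par_le j with hj | hj <;> rcases par_le k with hk | hk <;>
      rw [hi, hj, hk] <;> decide
  have m2 : ∀ i j k : Idx M N, parityMat (par i) (par j) * invParityMat (par j) (par k) =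
      (-1 : ℤ) ^ ((par i + par j) * (par j + par k)) •
        (hMat ^ (par i + par k) * pMat ^ (par i + par k)) := by
    intro i j k
    rcases par_le i with hi | hi <;> rcases par_le j with hj | hj <;> rcases par_le k with hk | hk <;>
      rw [hi, hj, hk] <;> decide
  have hif : ∀ i k : Idx M N, shiftHom A ε c (if i = k then 1 else 0) = if i = k then 1 else 0 := by
    intro i k
    split_ifs
    · exact map_one _
    · exact map_zero _
  constructor
  · intro i hi d hd
    lift i to Idx M N using hi
    lift d to Idx M N using hd
    have h := congrArg (shiftHom A ε c) (superInv_spec (lSeries (x ε)) hx i d).2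
    rw [map_sum, hif] at h
    simp only [map_zsmul, map_mul] at h
    rw [Finset.sum_range]
    simp only [hatInv_idx, ser_hatEntry, hatSeries_mul_hatSeries, m1]
    simp only [hatSeries_zsmul _ (_ • _), ← map_sum]
    change hatSeries K _ (∑ j, _ • (shiftHom A ε c _ * shiftHom A ε c _)) = _
    rw [h]
    by_cases hid : i = d
    · subst hid
      have e : ((-1 : ℤ) ^ (par i * (1 + par i)) • hMat ^ (par i + par i)) = 1 := by
        rcases par_le i with hi | hi <;> rw [hi] <;> decide
      rw [if_pos rfl, if_pos rfl, e, hatSeries_one_one]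
    · rw [if_neg hid, if_neg (fun h => hid (Fin.ext h)), map_zero]
  · intro i hi d hd
    lift i to Idx M N using hi
    lift d to Idx M N using hd
    have h := congrArg (shiftHom A ε c) (superInv_spec (lSeries (x ε)) hx i d).1
    rw [map_sum, hif] at h
    simp only [map_zsmul, map_mul] at h
    rw [Finset.sum_range]
    simp only [hatInv_idx, ser_hatEntry, hatSeries_mul_hatSeries, m2]
    simp only [hatSeries_zsmul _ (_ * _), ← map_sum]
    change hatSeries K _ (∑ j, _ • (shiftHom A ε c _ * shiftHom A ε c _)) = _
    rw [h]
    by_cases hid : i = d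
    · subst hid
      have e : hMat ^ (par i + par i) * pMat ^ (par i + par i) = 1 := by
        rcases par_le i with hi | hi <;> rw [hi] <;> decide
      rw [if_pos rfl, if_pos rfl, e, hatSeries_one_one]
    · rw [if_neg hid, if_neg (fun h => hid (Fin.ext h)), map_zero]

/-- In the two minors of the Berezinian all row and column indices have the same parity, so the factors attached to the
entries are `1` in the first minor and `pMat` in the second. -/
lemma minors_eq_hatSeries_berezinian (q : K) (x : Sgn → ℕ → Idx M N → Idx M N → A) (ε : Sgn) :
    leadMinor q (fun k => ser (fun ε r => hatEntry K (x ε r)) ε (point q M k)) M *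
        tailMinor q (fun k => hatInv K x ε (point q M k)) M N =
      hatSeries K (pMat ^ N) (berezinian q ε (x ε)) := by
  have e1 : leadMinor q (fun k => ser (fun ε r => hatEntry K (x ε r)) ε (point q M k)) M =
      hatSeries K 1 (∑ σ : Equiv.Perm (Fin M), (((-q)⁻¹) ^ permLength σ) •
      (List.ofFn fun i : Fin M =>
        shift ε (q ^ (2 * (i : ℕ)))
          (entry (lSeries (x ε)) (Fin.castAdd N (σ i)) (Fin.castAdd N i))).prod) := by
    rw [leadMinor, qdet, map_sum]
    refine Finset.sum_congr rfl fun σ _ => ?_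
    rw [map_smul, ← one_pow M, ← prod_ofFn_hatSeries]
    congr 3
    funext i
    have := ser_hatEntry x ε (point q M i) (Fin.castAdd N (σ i)) (Fin.castAdd N i)
    have p0 : ∀ a : Fin M, par (Fin.castAdd N a : Idx M N) = 0 := fun a => by
      rw [par, Fin.val_castAdd, if_pos a.isLt]
    rw [p0, p0, point, if_pos i.isLt, show parityMat 0 0 = 1 by decide] at this
    rw [point, if_pos i.isLt]
    exact this
  have e2 : tailMinor q (fun k => hatInv K x ε (point q M k)) M N =
      hatSeries K (pMat ^ N) (∑ τ : Equiv.Perm (Fin N), (((-q)⁻¹) ^ permLength τ) •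
      (List.ofFn fun j : Fin N =>
        shift ε (q ^ (2 * (M : ℤ) - 2 * ((j : ℕ) + 1)))
          (entry (superInv (lSeries (x ε))) (Fin.natAdd M j) (Fin.natAdd M (τ j)))).prod) := by
    rw [tailMinor, qdet, map_sum]
    refine Finset.sum_congr rfl fun τ _ => ?_
    rw [map_smul, ← prod_ofFn_hatSeries]
    congr 3
    funext j
    have := hatInv_idx x ε (point q M (M + j)) (Fin.natAdd M j) (Fin.natAdd M (τ j))
    have p1 : ∀ a : Fin N, par (Fin.natAdd M a : Idx M N) = 1 := fun a => by
      rw [par, Fin.val_natAdd, if_neg (by omega)]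
    have hpt : point q M (M + j) = q ^ (2 * (M : ℤ) - 2 * ((j : ℕ) + 1)) := by
      rw [point, if_neg (by omega)]
      congr 1
      push_cast
      ring
    rw [p1, p1, show invParityMat 1 1 = pMat by decide, hpt] at this
    rw [hpt]
    exact this
  rw [e1, e2, hatSeries_mul_hatSeries, one_mul, berezinian]

lemma pMat_pow_mul_parityMat (N : ℕ) (i j : Idx M N) :
    pMat ^ N * parityMat (par i) (par j) =
      (-1 : ℤ) ^ (N * (par i + par j)) • (parityMat (par i) (par j) * pMat ^ N) := by
  have h1 : pMat * parityMat (par i) (par j) =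
      (-1 : ℤ) ^ (par i + par j) • (parityMat (par i) (par j) * pMat) := by
    rcases par_le i with hi | hi <;> rcases par_le j with hj | hj <;> rw [hi, hj] <;> decide
  have : ∀ k : ℕ, pMat ^ k * parityMat (par i) (par j) =
      (-1 : ℤ) ^ (k * (par i + par j)) • (parityMat (par i) (par j) * pMat ^ k) := by
    intro k
    induction k with
    | zero => simp
    | succ k ih =>
      rw [pow_succ, mul_assoc, h1, mul_smul_comm, ← mul_assoc, ih, smul_mul_assoc, smul_smul, mul_assoc,
        ← pow_add]
      congr 2
      ring
  exact this N

lemma exists_left_inverse_parityMat (i j : Idx M N) (k : ℕ) :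
    ∃ m', m' * (parityMat (par i) (par j) * pMat ^ k) = 1 := by
  have hp : pMat ^ k * pMat ^ k = 1 := by
    rw [← (Commute.refl pMat).mul_pow, show pMat * pMat = 1 by decide, one_pow]
  have h1 : ∃ m, m * parityMat (par i) (par j) = 1 := by
    refine ⟨pMat ^ par i * hMat ^ (par i + par j), ?_⟩
    rcases par_le i with hi | hi <;> rcases par_le j with hj | hj <;> rw [hi, hj] <;> decide
  obtain ⟨m, hm⟩ := h1
  refine ⟨pMat ^ k * m, ?_⟩
  rw [mul_assoc, ← mul_assoc m, hm, one_mul, hp]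

/-- Commutation up to the sign of `pMat ^ N` and `parityMat` means commutation in the algebra itself. -/
lemma commute_of_hatSeries {F : A⟦X⟧} {y : Idx M N → Idx M N → A} {i j : Idx M N}
    (h : hatSeries K (pMat ^ N) F * PowerSeries.C (hatEntry K y i j) =
      (-1 : K) ^ (N * (par i + par j)) • (PowerSeries.C (hatEntry K y i j) * hatSeries K (pMat ^ N) F))
    (r : ℕ) : Commute (PowerSeries.coeff r F) (y i j) := by
  have h1 := congrArg (PowerSeries.coeff r) h
  rw [PowerSeries.coeff_smul, PowerSeries.coeff_mul_C, PowerSeries.coeff_C_mul, coeff_hatSeries,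
    hatEntry_idx, hat_mul_hat, hat_mul_hat, pMat_pow_mul_parityMat, hat_neg_one_pow_smul] at h1
  obtain ⟨m', hm'⟩ := exists_left_inverse_parityMat i j N
  refine hat_injective hm' (smul_right_injective _ (pow_ne_zero (N * (par i + par j)) ?_) h1)
  exact neg_ne_zero.mpr one_ne_zero

lemma commute_hat_one_iff {b : A} {y : Idx M N → Idx M N → A} {i j : Idx M N} :
    Commute (hat K 1 b) (hatEntry K y i j) ↔ Commute b (y i j) := by
  rw [hatEntry_idx, Commute, SemiconjBy, hat_mul_hat, hat_mul_hat, one_mul, mul_one]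
  constructor
  · intro h
    obtain ⟨m', hm'⟩ := exists_left_inverse_parityMat i j 0
    rw [pow_zero, mul_one] at hm'
    exact hat_injective hm' h
  · intro h
    rw [h.eq]

/-- The coefficients of the Berezinian commute with all modes, provided that the scalars in the commutation with the
modes of the other sign cancel. -/
theorem SuperExchangeData.commute_berezinian {q : K} (hq : q ≠ 0) (hq2 : q ^ 2 ≠ 1) {g : K⟦X⟧} {t t' : A}
    {x : Sgn → ℕ → Idx M N → Idx M N → A} (h : SuperExchangeData q M N g t t' x)
    (hQ : t = t' ∨ ∀ ε, ∃ c, ∏ k ∈ Finset.range (M + N), factorScalar q M g ε k = PowerSeries.C c)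
    (ε : Sgn) (r : ℕ) (ε' : Sgn) (s : ℕ) (i j : Idx M N) :
    Commute (PowerSeries.coeff r (berezinian q ε (x ε))) (x ε' s i j) := by
  have hκ : q - q⁻¹ ≠ 0 := by
    intro h0
    apply hq2
    rw [sub_eq_zero] at h0
    rw [sq]
    nth_rewrite 2 [h0]
    exact mul_inv_cancel₀ hq
  have hE := h.exchangeData
  obtain ⟨u, hu⟩ := hE.exists_cornerUnits ε
  have hx : IsUnit (twist (lSeries (x ε))) :=
    isUnit_twist_lSeries x h.upper h.lower h.diag_left h.diag_right ε
  have hprod := hE.minors_eq_prod hq hq2 hu (Nat.le_add_right M N)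
    (P := fun k => hatInv K x ε (point q M k)) (fun k => isInv_hatInv x ε hx _)
  rw [Nat.add_sub_cancel_left, minors_eq_hatSeries_berezinian] at hprod
  have hQ' : evHom K (hat K 1 t) hE.central (∏ k ∈ Finset.range (M + N), factorScalar q M g ε k) =
      evHom K (hat K 1 t') hE.central' (∏ k ∈ Finset.range (M + N), factorScalar q M g ε k) := by
    rcases hQ with rfl | hQ
    · rfl
    · obtain ⟨c, hc⟩ := hQ ε
      rw [hc]
      exact evHom_C c _ _
  set F := berezinian q ε (x ε)
  set b := PowerSeries.coeff r F with hb
  set l : Sgn → ℕ → ℕ → ℕ → Matrix (Fin 2) (Fin 2) A := fun ε r => hatEntry K (x ε r) with hl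
  -- The elements commuting with `b`, inside the exchange algebra.
  set Z := Subalgebra.centralizer K {hat K 1 b}
  have hZ : ∀ (ε₁ : Sgn) (s₁ : ℕ) (a c : Idx M N), (hatSeries K (pMat ^ N) F * PowerSeries.C (l ε₁ s₁ a c) =
      (-1 : K) ^ (N * (par a + par c)) • (PowerSeries.C (l ε₁ s₁ a c) * hatSeries K (pMat ^ N) F)) →
      l ε₁ s₁ a c ∈ Z := by
    intro ε₁ s₁ a c hac
    rw [Subalgebra.mem_centralizer_iff]
    rintro _ rfl
    exact commute_hat_one_iff.mpr (commute_of_hatSeries hac r)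
  have hpar : ∀ (k : ℕ) (hk : k + 1 < M + N),
      (-1 : K) ^ (N * (par (⟨k, by omega⟩ : Idx M N) + par (⟨k + 1, hk⟩ : Idx M N))) =
        if k + 1 = M then (-1) ^ N else 1 := by
    intro k hk
    unfold par
    dsimp only
    split_ifs <;> first | omega | (rw [mul_comm, pow_mul]; norm_num)
  have hdiag : ∀ k < M + N, l .plus 0 k k ∈ Z := by
    intro k hk
    refine hZ .plus 0 ⟨k, hk⟩ ⟨k, hk⟩ ?_
    rw [← two_mul, mul_left_comm, pow_mul, neg_one_sq, one_pow, one_smul, hprod]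
    exact hE.factor_zero_mode_diag hq hu k
  suffices hmem : l ε' s i j ∈ Z from
    commute_hat_one_iff.mp ((Subalgebra.mem_centralizer_iff K).mp hmem _ rfl)
  have hi := i.isLt
  have hj := j.isLt
  refine hE.mode_mem (Z := Z) hq hκ ?_ hdiag ?_ ?_ ?_ ε' s (show M + N - 1 < M + N by omega) i (by omega) j
    (by omega)
  · intro ε₁ s₁
    by_cases h0 : 0 < M + N
    · refine hZ ε₁ s₁ ⟨0, h0⟩ ⟨0, h0⟩ ?_
      rw [← two_mul, mul_left_comm, pow_mul, neg_one_sq, one_pow, one_smul, hprod]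
      have h1 := hE.factor_same hq hu s₁
      have h2 := hE.factor_cross hq hu hQ' s₁
      cases ε <;> cases ε₁
      · exact h1
      · exact h2
      · exact h2
      · exact h1
    -- For `M + N = 0` the entry `(0,0)` is zero by convention.
    · have : l ε₁ s₁ 0 0 = 0 := hatEntry_of_not_lt _ (by omega)
      rw [this]
      exact Z.zero_mem
  · intro k hk
    have h1 := hE.diag_left k hk
    have h2 := hE.diag_right k hk
    have hc : Commute (hat K 1 b) (l .plus 0 k k) := (Subalgebra.mem_centralizer_iff K).mp (hdiag k hk) _ rfl
    rw [Subalgebra.mem_centralizer_iff]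
    rintro _ rfl
    exact Commute.units_inv_right (u := ⟨l .plus 0 k k, l .minus 0 k k, h2, h1⟩) hc
  · intro k hk
    refine hZ .plus 0 ⟨k, by omega⟩ ⟨k + 1, hk⟩ ?_
    have := hE.factor_zero_mode_upper hq hκ hu hk (Nat.le_add_right M N)
    rw [← hprod, Nat.add_sub_cancel_left] at this
    rw [hpar k hk]
    exact this
  · intro k hk
    refine hZ .minus 0 ⟨k + 1, hk⟩ ⟨k, by omega⟩ ?_
    have := hE.factor_zero_mode_lower hq hκ hu hk (Nat.le_add_right M N)
    rw [← hprod, Nat.add_sub_cancel_left] at this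
    rw [add_comm (par _), hpar k hk]
    exact this

end HatSeries

/-! ### The quantum affine and the quantum loop superalgebra -/

section Modes

variable {K : Type*} [Field K] {A : Type*} [Ring A] [Algebra K A] {M N : ℕ}

/-- The exponent of `z` at the mode `r` of `L^ε(z)`. -/
def zExp (ε : Sgn) (r : ℤ) : ℤ :=
  match ε with
  | .plus => -r
  | .minus => r

/-- The array `F`, indexed by the exponents of `z` and `w`, consists of the modes `G` of series of signs `ε` and
`ε'`. -/
def IsModeArray (ε ε' : Sgn) (F : ℤ → ℤ → A) (G : ℕ → ℕ → A) : Prop :=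
  ∀ r s, F (zExp ε r) (zExp ε' s) = if 0 ≤ r ∧ 0 ≤ s then G r.toNat s.toNat else 0

lemma zCoeff_zExp (ε : Sgn) (x : ℕ → A) (r : ℤ) :
    zCoeff ε x (zExp ε r) = if 0 ≤ r then x r.toNat else 0 := by
  by_cases hr : 0 ≤ r <;> cases ε <;> simp [zCoeff, zExp, hr]

lemma isModeArray_mul (ε ε' : Sgn) (x y : ℕ → A) :
    IsModeArray ε ε' (fun m n => zCoeff ε x m * zCoeff ε' y n) (fun r s => x r * y s) := by
  intro r s
  beta_reduce
  rw [zCoeff_zExp, zCoeff_zExp]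
  by_cases hr : 0 ≤ r <;> by_cases hs : 0 ≤ s <;> simp [hr, hs]

lemma isModeArray_mul' (ε ε' : Sgn) (x y : ℕ → A) :
    IsModeArray ε ε' (fun m n => zCoeff ε' y n * zCoeff ε x m) (fun r s => y s * x r) := by
  intro r s
  beta_reduce
  rw [zCoeff_zExp, zCoeff_zExp]
  by_cases hr : 0 ≤ r <;> by_cases hs : 0 ≤ s <;> simp [hr, hs]

lemma IsModeArray.natCast {ε ε' : Sgn} {F : ℤ → ℤ → A} {G : ℕ → ℕ → A} (h : IsModeArray ε ε' F G)
    (r s : ℕ) : F (zExp ε r) (zExp ε' s) = G r s := by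
  rw [h, if_pos ⟨by omega, by omega⟩, Int.toNat_natCast, Int.toNat_natCast]

lemma IsModeArray.fst_pred {ε ε' : Sgn} {F : ℤ → ℤ → A} {G : ℕ → ℕ → A} (h : IsModeArray ε ε' F G)
    (r s : ℕ) : F (zExp ε (r - 1)) (zExp ε' s) = if r = 0 then 0 else G (r - 1) s := by
  rw [h]
  rcases r with _ | r
  · rw [if_neg (by omega), if_pos rfl]
  · rw [if_pos (by omega), if_neg (Nat.succ_ne_zero r)]
    congr 1
    omega

lemma IsModeArray.snd_pred {ε ε' : Sgn} {F : ℤ → ℤ → A} {G : ℕ → ℕ → A} (h : IsModeArray ε ε' F G)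
    (r s : ℕ) : F (zExp ε r) (zExp ε' (s - 1)) = if s = 0 then 0 else G r (s - 1) := by
  rw [h]
  rcases s with _ | s
  · rw [if_neg (by omega), if_pos rfl]
  · rw [if_pos (by omega), if_neg (Nat.succ_ne_zero s)]
    congr 1
    omega

/-- The exponent of `z` at which `(α z + β w) F` contains the modes `r` and `r - 1` of the series of sign `ε` in `z`. -/
def relExp (ε : Sgn) (r : ℕ) : ℤ :=
  match ε with
  | .plus => 1 - r
  | .minus => r

lemma actPoly_eq_shiftMul {ε : Sgn} {F : ℤ → ℤ → A} {G : ℕ → ℕ → A} (h : IsModeArray ε ε F G)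
    (p : K × K) (r s : ℕ) :
    actPoly p F (relExp ε r) (relExp ε s) = shiftMul (formSnd ε p) (formFst ε p) G r s := by
  rw [shiftMul, ← h.fst_pred, ← h.snd_pred]
  cases ε with
  | plus =>
    simp only [actPoly, formSnd, formFst, relExp, zExp]
    rw [add_comm]
    congr 3 <;> ring
  | minus => simp only [actPoly, formSnd, formFst, relExp, zExp]

lemma actSeries_eq_diagMul {F : ℤ → ℤ → A} {G : ℕ → ℕ → A} (h : IsModeArray .plus .minus F G)
    (ρ : K⟦X⟧) (t : A) (r s : ℕ) : actSeries ρ t F (-r) s = diagMul ρ t G r s := by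
  have hF : ∀ k, F (-r + (k : ℕ)) (s - (k : ℕ)) = if k ≤ r ∧ k ≤ s then G (r - k) (s - k) else 0 := by
    intro k
    have := h (r - k) (s - k)
    simp only [zExp, neg_sub] at this
    rw [neg_add_eq_sub, this]
    split_ifs <;> first | omega | rfl | (congr 1 <;> omega)
  rw [actSeries, diagMul, Int.toNat_natCast]
  symm
  refine Finset.sum_subset_zero_on_sdiff (Finset.range_mono (by omega)) (fun k hk => ?_)
    fun k hk => ?_
  · simp only [Finset.mem_sdiff, Finset.mem_range] at hk
    rw [hF, if_neg (by omega), mul_zero, smul_zero]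
  · rw [Finset.mem_range] at hk
    rw [hF, if_pos (by omega)]

/-- Division of `α z + β w` by `z` shifts the exponent of `z` by one. -/
lemma actPoly_eq_diagMul {F : ℤ → ℤ → A} {G : ℕ → ℕ → A} (h : IsModeArray .plus .minus F G)
    (p : K × K) (r s : ℕ) : actPoly p F (1 - r) s = diagMul (1 * lin p) 1 G r s := by
  have c0 : PowerSeries.coeff 0 (lin p) = p.1 := by
    rw [PowerSeries.coeff_zero_eq_constantCoeff_apply, constantCoeff_lin]
  have c1 : PowerSeries.coeff 1 (lin p) = p.2 := by
    simp [lin, PowerSeries.coeff_C]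
  have c2 : ∀ k, PowerSeries.coeff (k + 2) (lin p) = 0 := fun k => by
    simp [lin]
  have e1 : F (1 - r - 1) s = G r s := by
    rw [← h.natCast]
    congr 1
    simp only [zExp]
    ring
  have e2 : F (1 - r) (s - 1) = if r = 0 ∨ s = 0 then 0 else G (r - 1) (s - 1) := by
    have := h (r - 1) (s - 1)
    simp only [zExp, neg_sub] at this
    rw [this]
    split_ifs <;> first | omega | rfl | (congr 1 <;> omega)
  rw [actPoly, e1, e2, diagMul, one_mul]
  simp only [one_pow, one_mul]
  split_ifs with h0
  · rw [show min r s + 1 = 1 by omega, Finset.sum_range_one, c0, smul_zero, add_zero]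
    rfl
  · obtain ⟨j, hj⟩ : ∃ j, min r s = j + 1 := Nat.exists_eq_succ_of_ne_zero (by omega)
    rw [hj, Finset.sum_range_succ', Finset.sum_range_succ', Finset.sum_eq_zero fun k _ => by rw [c2, zero_smul], c0, c1]
    simp only [zero_add, Nat.sub_zero]
    exact add_comm _ _

section Map

variable {A' : Type*} [Ring A'] [Algebra K A']

lemma map_rllLeft (q : K) (π : A →ₐ[K] A') {act : K × K → (ℤ → ℤ → A) → ℤ → ℤ → A}
    {act' : K × K → (ℤ → ℤ → A') → ℤ → ℤ → A'}
    (hact : ∀ p F m n, π (act p F m n) = act' p (fun m n => π (F m n)) m n)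
    (X Y : Idx M N → Idx M N → ℤ → A) (a b c d : Idx M N) (m n : ℤ) :
    π (rllLeft q act X Y a b c d m n) =
      rllLeft q act' (fun i j m => π (X i j m)) (fun i j m => π (Y i j m)) a b c d m n := by
  simp only [rllLeft, map_add, map_smul, hact, map_mul]

lemma map_rllRight (q : K) (π : A →ₐ[K] A') {act : K × K → (ℤ → ℤ → A) → ℤ → ℤ → A}
    {act' : K × K → (ℤ → ℤ → A') → ℤ → ℤ → A'}
    (hact : ∀ p F m n, π (act p F m n) = act' p (fun m n => π (F m n)) m n)
    (X Y : Idx M N → Idx M N → ℤ → A) (a b c d : Idx M N) (m n : ℤ) :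
    π (rllRight q act X Y a b c d m n) =
      rllRight q act' (fun i j m => π (X i j m)) (fun i j m => π (Y i j m)) a b c d m n := by
  simp only [rllRight, map_add, map_smul, hact, map_mul]

lemma map_actPoly (π : A →ₐ[K] A') (p : K × K) (F : ℤ → ℤ → A) (m n : ℤ) :
    π (actPoly p F m n) = actPoly p (fun m n => π (F m n)) m n := by
  simp only [actPoly, map_add, map_smul]

lemma map_actSeries (π : A →ₐ[K] A') (ρ : K⟦X⟧) (t : A) (F : ℤ → ℤ → A) (m n : ℤ) :
    π (actSeries ρ t F m n) = actSeries ρ (π t) (fun m n => π (F m n)) m n := by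
  simp only [actSeries, map_sum, map_smul, map_mul, map_pow]

lemma map_zCoeff (π : A →ₐ[K] A') (ε : Sgn) (x : ℕ → A) (m : ℤ) :
    π (zCoeff ε x m) = zCoeff ε (fun r => π (x r)) m := by
  cases ε <;> simp only [zCoeff] <;> split_ifs <;> simp

end Map

/-- The array of the coefficients of the series with modes `x`. -/
def coeffArray (ε : Sgn) (x : ℕ → Idx M N → Idx M N → A) (i j : Idx M N) (m : ℤ) : A :=
  zCoeff ε (fun r => x r i j) m

lemma rllLeft_eq_superLeft {ε ε' : Sgn} {q : K} {act : K × K → (ℤ → ℤ → A) → ℤ → ℤ → A}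
    {act' : K × K → (ℕ → ℕ → A) → A} {m n : ℤ}
    (hact : ∀ p F G, IsModeArray ε ε' F G → act p F m n = act' p G)
    (x y : ℕ → Idx M N → Idx M N → A) (a b c d : Idx M N) :
    rllLeft q act (coeffArray ε x) (coeffArray ε' y) a b c d m n = superLeft q act' x y a b c d := by
  unfold rllLeft superLeft coeffArray
  rw [hact _ _ _ (isModeArray_mul ε ε' _ _), hact _ _ _ (isModeArray_mul ε ε' _ _)]

lemma rllRight_eq_superRight {ε ε' : Sgn} {q : K} {act : K × K → (ℤ → ℤ → A) → ℤ → ℤ → A}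
    {act' : K × K → (ℕ → ℕ → A) → A} {m n : ℤ}
    (hact : ∀ p F G, IsModeArray ε ε' F G → act p F m n = act' p G)
    (x y : ℕ → Idx M N → Idx M N → A) (a b c d : Idx M N) :
    rllRight q act (coeffArray ε x) (coeffArray ε' y) a b c d m n = superRight q act' x y a b c d := by
  unfold rllRight superRight coeffArray
  rw [hact _ _ _ (isModeArray_mul' ε ε' _ _), hact _ _ _ (isModeArray_mul' ε ε' _ _)]

end Modes

section Presentation

variable {K : Type*} [Field K] {A : Type*} [Ring A] [Algebra K A] {M N : ℕ}

lemma commute_of_commute_generators {X : Type*} {π : FreeAlgebra K X →ₐ[K] A}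
    (hπ : Function.Surjective π) {y : A} (hy : ∀ g, Commute y (π (FreeAlgebra.ι K g))) (z : A) :
    Commute y z := by
  obtain ⟨z, rfl⟩ := hπ z
  induction z using FreeAlgebra.induction with
  | grade0 c =>
    rw [AlgHom.commutes]
    exact (Algebra.commutes c y).symm
  | grade1 g => exact hy g
  | mul a b ha hb =>
    rw [map_mul]
    exact ha.mul_right hb
  | add a b ha hb =>
    rw [map_add]
    exact ha.add_right hb

section Quotient

variable {q : K} {π : FreeAlgebra K (Gen M N) →ₐ[K] A}

lemma map_coeffArray (π : FreeAlgebra K (Gen M N) →ₐ[K] A) (ε : Sgn) :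
    (fun i j m => π (fL K M N ε i j m)) = coeffArray ε fun r i j => π (fl K M N ε r i j) := by
  funext i j m
  rw [fL, map_zCoeff, coeffArray]

lemma qc_central_of_rel (hsurj : Function.Surjective π) (h : ∀ x y, BaseRel K q M N x y → π x = π y)
    (z : A) : Commute (π (fqc K M N)) z := by
  refine commute_of_commute_generators hsurj (fun g => ?_) z
  cases g with
  | l ε r i j => simpa [Commute, SemiconjBy] using h _ _ (BaseRel.qc_central ε r i j)
  | qc => exact Commute.refl _
  | qcInv =>
    have hl := h _ _ BaseRel.qc_left
    have hr := h _ _ BaseRel.qc_right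
    rw [map_mul, map_one] at hl hr
    exact hl.trans hr.symm

lemma qcInv_central_of_rel (hsurj : Function.Surjective π) (h : ∀ x y, BaseRel K q M N x y → π x = π y)
    (z : A) : Commute (π (fqcInv K M N)) z := by
  have hl := h _ _ BaseRel.qc_left
  have hr := h _ _ BaseRel.qc_right
  rw [map_mul, map_one] at hl hr
  exact (show Commute ((Units.mk (π (fqc K M N)) _ hl hr : Aˣ) : A) z from
    qc_central_of_rel hsurj h z).units_inv_left

/-- A quotient of the free algebra satisfying the common relations and the relation between `L⁺(z)` and `L⁻(w)`
for a normalizing series `g` carries exchange data. -/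
lemma superExchangeData_of_rel {g : K⟦X⟧} (hsurj : Function.Surjective π)
    (h : ∀ x y, BaseRel K q M N x y → π x = π y)
    (hcross : ∀ r s a b c d,
      superLeft q (fun p F => diagMul (g * lin p) (π (fqcInv K M N)) F r s)
          (fun r i j => π (fl K M N .plus r i j)) (fun r i j => π (fl K M N .minus r i j)) a b c d =
        superRight q (fun p F => diagMul (g * lin p) (π (fqc K M N)) F r s)
          (fun r i j => π (fl K M N .plus r i j)) (fun r i j => π (fl K M N .minus r i j)) a b c d)
    (hg : PowerSeries.constantCoeff g ≠ 0) :
    SuperExchangeData q M N g (π (fqcInv K M N)) (π (fqc K M N))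
      (fun ε r i j => π (fl K M N ε r i j)) where
  upper i j hij := by rw [h _ _ (BaseRel.upper i j hij), map_zero]
  lower i j hij := by rw [h _ _ (BaseRel.lower i j hij), map_zero]
  diag_left i := by rw [← map_mul, h _ _ (BaseRel.diag_left i), map_one]
  diag_right i := by rw [← map_mul, h _ _ (BaseRel.diag_right i), map_one]
  same ε r s a b c d := by
    have := h _ _ (BaseRel.rll ε a b c d (relExp ε r) (relExp ε s))
    rw [map_rllLeft q π (map_actPoly π), map_rllRight q π (map_actPoly π), map_coeffArray] at this
    rwa [rllLeft_eq_superLeft fun p F G hF => actPoly_eq_shiftMul hF p r s,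
      rllRight_eq_superRight fun p F G hF => actPoly_eq_shiftMul hF p r s] at this
  cross := hcross
  central := qcInv_central_of_rel hsurj h
  central' := qc_central_of_rel hsurj h
  unit := hg

end Quotient

end Presentation

section Instances

variable {K : Type*} [Field K] {q : K} {M N : ℕ}

lemma normalized_eq (q : K) (M N : ℕ) (p : K × K) :
    normalized q M N p = affineScalar q M N * lin p := by
  rw [normalized, affineScalar, lin]
  ring

theorem superExchangeData_affineGen (hq : q ≠ 0) (hroot : ∀ n : ℕ, 0 < n → q ^ n ≠ 1) (hMN : M ≠ N) :
    SuperExchangeData q M N (affineScalar q M N)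
      (RingQuot.mkAlgHom K (AffineRel K q M N) (fqcInv K M N))
      (RingQuot.mkAlgHom K (AffineRel K q M N) (fqc K M N)) (affineGen K q M N) := by
  refine superExchangeData_of_rel (RingQuot.mkAlgHom_surjective K _)
    (fun x y h => RingQuot.mkAlgHom_rel K (AffineRel.base h)) (fun r s a b c d => ?_)
    (constantCoeff_affineScalar_ne_zero hq hroot hMN)
  have := RingQuot.mkAlgHom_rel K (AffineRel.cross (q := q) a b c d (-r) s)
  rw [map_rllLeft q _ fun p => map_actSeries _ _ _, map_rllRight q _ fun p => map_actSeries _ _ _,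
    map_coeffArray, map_coeffArray] at this
  refine (rllLeft_eq_superLeft (fun p F G hF => ?_) _ _ a b c d).symm.trans
    (this.trans (rllRight_eq_superRight (fun p F G hF => ?_) _ _ a b c d)) <;>
  · rw [← normalized_eq]
    exact actSeries_eq_diagMul hF _ _ r s

lemma mkAlgHom_fqc_loop : RingQuot.mkAlgHom K (LoopRel K q M N) (fqc K M N) = 1 := by
  rw [RingQuot.mkAlgHom_rel K LoopRel.qc_one, map_one]

lemma mkAlgHom_fqcInv_loop : RingQuot.mkAlgHom K (LoopRel K q M N) (fqcInv K M N) = 1 := by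
  have := RingQuot.mkAlgHom_rel K (LoopRel.base (BaseRel.qc_left (K := K) (q := q) (M := M) (N := N)))
  rwa [map_mul, map_one, mkAlgHom_fqc_loop, one_mul] at this

theorem superExchangeData_loopGen : SuperExchangeData q M N 1 1 1 (loopGen K q M N) := by
  have key := superExchangeData_of_rel (q := q) (M := M) (N := N) (g := 1)
    (RingQuot.mkAlgHom_surjective K (LoopRel K q M N))
    (fun x y h => RingQuot.mkAlgHom_rel K (LoopRel.base h)) (fun r s a b c d => ?_) (by simp)
  · rwa [mkAlgHom_fqc_loop, mkAlgHom_fqcInv_loop] at key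
  · have := RingQuot.mkAlgHom_rel K (LoopRel.cross (q := q) a b c d (1 - r) s)
    rw [map_rllLeft q _ (map_actPoly _), map_rllRight q _ (map_actPoly _),
      map_coeffArray, map_coeffArray] at this
    rw [rllLeft_eq_superLeft fun p F G hF => actPoly_eq_diagMul hF p r s,
      rllRight_eq_superRight fun p F G hF => actPoly_eq_diagMul hF p r s] at this
    rwa [mkAlgHom_fqc_loop, mkAlgHom_fqcInv_loop]

lemma mem_center_of_commute {A : Type*} [Ring A] [Algebra K A] {π : FreeAlgebra K (Gen M N) →ₐ[K] A}
    (hsurj : Function.Surjective π) (h : ∀ x y, BaseRel K q M N x y → π x = π y) {y : A}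
    (hy : ∀ ε r i j, Commute y (π (fl K M N ε r i j))) : y ∈ Subalgebra.center K A := by
  rw [Subalgebra.mem_center_iff]
  intro z
  refine (commute_of_commute_generators hsurj (fun g => ?_) z).eq.symm
  cases g with
  | l ε r i j => exact hy ε r i j
  | qc => exact (qc_central_of_rel hsurj h y).symm
  | qcInv => exact (qcInv_central_of_rel hsurj h y).symm

end Instances

end QBer

end

theorem mainTheorem1 {K : Type*} [Field K] [CharZero K] (q : K) (hq : q ≠ 0)
    (hroot : ∀ n : ℕ, 0 < n → q ^ n ≠ 1) (M N : ℕ) (ε : QBer.Sgn) (i : ℕ) :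
    (M ≠ N →
      PowerSeries.coeff i (QBer.berezinian q ε (QBer.affineGen K q M N ε)) ∈
        Subalgebra.center K (QBer.QuantumAffine K q M N)) ∧
    PowerSeries.coeff i (QBer.berezinian q ε (QBer.loopGen K q M N ε)) ∈
      Subalgebra.center K (QBer.QuantumLoop K q M N) := by
  have hq2 : q ^ 2 ≠ 1 := hroot 2 two_pos
  refine ⟨fun hMN => ?_, ?_⟩
  · exact QBer.mem_center_of_commute (q := q) (RingQuot.mkAlgHom_surjective K _)
      (fun x y h => RingQuot.mkAlgHom_rel K (QBer.AffineRel.base h)) fun ε' r a b =>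
      (QBer.superExchangeData_affineGen hq hroot hMN).commute_berezinian hq hq2
        (Or.inr (QBer.prod_factorScalar_affine hq hroot hMN)) ε i ε' r a b
  · exact QBer.mem_center_of_commute (q := q) (RingQuot.mkAlgHom_surjective K _)
      (fun x y h => RingQuot.mkAlgHom_rel K (QBer.LoopRel.base h)) fun ε' r a b =>
      QBer.superExchangeData_loopGen.commute_berezinian hq hq2 (Or.inl rfl) ε i ε' r a b
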